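/- **Setting.** Let $m\ge 1$, $p\ge 0$, let $\mathcal H$ be an infinite-dimensional real Hilbert space (in applications a reproducing kernel Hilbert space), $\mathcal Q=\mathbb R^p\times\mathcal H$, and write $\tau=(\theta,h)\in\mathcal Q$. For $l=1,\dots,m$ let $\mathcal X_l$ be a sample space with dominating measure $dx$ and $\eta_l(x;\tau)$ a real function on $\mathcal X_l\times\mathcal Q$. For $\tau$ with $\int e^{\eta_l(x;\tau)}dx<\infty$ let $\mu_{l,\tau}$ be expectation under the density $f_l(\cdot;\tau)=e^{\eta_l(\cdot;\tau)}/\int e^{\eta_l(x;\tau)}dx$, $V_{l,\tau}(f,g)$ the covariance under it, $V_{l,\tau}(f)=V_{l,\tau}(f,f)$. Let $\tau_0=(\theta_0,h_0)$ be the true parameter, $L^2_0(\mathcal X_l)$ the orthogonal complement of the constants in $L^2(f_l(\cdot;\tau_0)dx)$, and let all observations $X_{li}\sim f_l(\cdot;\tau_0)$ ($1\le l\le m$, $i\ge 1$) be independent. Put $$\mathfrak L_{n_l}(\tau)=-\frac1{n_l}\sum_{i=1}^{n_l}\eta_l(X_{li};\tau)+\log\int e^{\eta_l(x;\tau)}dx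 .$$ **Assumptions.** There are neighbourhoods $\mathcal N_{\theta_0}$, $\mathcal N_{h_0}$ of $\theta_0$, $h_0$ (open, with $\mathcal N=\mathcal N_{\theta_0}\times\mathcal N_{h_0}$ convex) such that: 1. $J$ is a square seminorm on $\mathcal H$, $J(\cdot,\cdot)$ its semi-inner product, and its null space is finite-dimensional. 2. There are injective bounded linear operators $L_{l,\theta}:\mathbb R^p\to L^2_0(\mathcal X_l)$ and $L_{l,h}:\mathcal H\to L^2_0(\mathcal X_l)$ such that (i) for every $\lambda>0$ there are $M_1,M_2>0$ with $M_1\|g\|^2\le\sum_l V_{l,\tau_0}(L_{l,h}g)+\lambda J(g)\le M_2\|g\|^2$ for all $g\in\mathcal H$; (ii) there is $c_\delta>0$ with $\sum_l V_{l,\tau_0}(L_{l,\theta}\zeta-L_{l,h}g)>c_\delta$ for all $\|\zeta\|_{l^2}=1$ and $g\in\mathcal H$. 3. On $\mathcal N$, $\eta_l(\cdot;\tau)$ is measurable with $e^{\eta_l}$ integrable, and $\tau\mapsto\eta_l(\tau)$ is a one-to-one, three times continuously Fréchet differentiable map into $L^2_0(\mathcal X_l)$; for each $x$, $\tau\mapsto\eta_l(x;\tau)$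 is Fréchet differentiable. $\tau_0$ is the unique root in $\mathcal N$ of $\mathbb E[D_\theta\sum_l\mathfrak L_{n_l}(\tau)]=0$, $\mathbb E[D_h\sum_l\mathfrak L_{n_l}(\tau)]=0$. 4. There are $C_1,C_2>0$ such that for all $\tau\in\mathcal N$, $(\zeta,g)\in\mathcal Q$, $$C_1\sum_lV_{l,\tau_0}(L_{l,\theta}\zeta+L_{l,h}g)\le\sum_lV_{l,\tau_0}(D_\theta\eta_l(\tau)\zeta+D_h\eta_l(\tau)g)\le C_2\sum_lV_{l,\tau_0}(L_{l,\theta}\zeta+L_{l,h}g).$$ 5. There is $0<C_d<2C_1$ such that for all $\tau_1,\tau_2\in\mathcal N$, $(\zeta,g)\in\mathcal Q$, $$\sum_lV_{l,\tau_0}\big[(D_\theta\eta_l(\tau_1)-D_\theta\eta_l(\tau_2))\zeta+(D_h\eta_l(\tau_1)-D_h\eta_l(\tau_2))g\big]\le C_d\sum_lV_{l,\tau_0}(L_{l,\theta}\zeta+L_{l,h}g).$$ 6. There are $C_3,C_4>0$ with $C_3\sum_lV_{l,\tau_0}(f_l)\le\sum_lV_{l,\tau}(f_l)\le C_4\sum_lV_{l,\tau_0}(f_l)$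 for all $\tau\in\mathcal N$ and $f_l\in L^2_0(\mathcal X_l)$. 7. $g\mapsto\sum_lV_{l,\tau_0}(L_{l,h}g)$ is completely continuous with respect to $J$ (for every $\varepsilon>0$ it is $\le\varepsilon J(g)$ on the common kernel of finitely many bounded linear functionals). The eigenvalues $0\le\rho_1\le\rho_2\le\dots\to\infty$ of $J$ with respect to it (so that for a complete system $(\phi_\nu)$, $\sum_lV_{l,\tau_0}(L_{l,h}\phi_\nu,L_{l,h}\phi_\mu)=\delta_{\nu\mu}$ and $J(\phi_\nu,\phi_\mu)=\rho_\nu\delta_{\nu\mu}$) satisfy $\rho_\nu=\kappa_\nu\nu^r$ for all large $\nu$, with $r>1$ and $\kappa_\nu\in(\beta_1,\beta_2)$, where $0<\beta_1<\beta_2<\infty$. Almost surely $\sum_l\mathfrak L_{n_l}$ is convex on $\mathcal N$. With probability tending to one, $\hat\tau=(\hat\theta,\hat h)$ lies in $\mathcal N$ and is the unique local minimizer in $\mathcal N$ of the penalized likelihood $\sum_l\mathfrak L_{n_l}(\theta,h)+\frac\lambda2J(h)$. The linear approximation $\tilde\tau=(\tilde\theta,\tilde h)$ of $\hat\tau$ is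 the minimizer over $\mathcal Q$ of $$\sum_l\Big\{-\frac1{n_l}\sum_{i=1}^{n_l}\big[D_\theta\eta_l(X_{li};\tau_0)\theta+D_h\eta_l(X_{li};\tau_0)h\big]+\mu_{l,\tau_0}\big[D_\theta\eta_l(\tau_0)\theta+D_h\eta_l(\tau_0)h\big]+\tfrac12V_{l,\tau_0}\big[D_\theta\eta_l(\tau_0)(\theta-\theta_0)+D_h\eta_l(\tau_0)(h-h_0)\big]\Big\}+\frac\lambda2J(h).$$ **Theorem.** As $n=\min_l n_l\to\infty$, $\lambda\to0$ ($\lambda>0$) and $n\lambda^{1/r}\to\infty$, $$\sum_{l=1}^mV_{l,\tau_0}\big[L_{l,\theta}(\hat\theta-\tilde\theta)+L_{l,h}(\hat h-\tilde h)\big]+\lambda J(\hat h-\tilde h)=O_p\big(n^{-1}\lambda^{-1/r}+\lambda\big),$$ $$\sum_{l=1}^mV_{l,\tau_0}\big[L_{l,\theta}(\hat\theta-\theta_0)+L_{l,h}(\hat h-h_0)\big]+\lambda J(\hat h-h_0)=O_p\big(n^{-1}\lambda^{-1/r}+\lambda\big).$$ -/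

import Mathlib

open MeasureTheory ProbabilityTheory Filter Topology
open scoped ENNReal

noncomputable section

namespace SemiparDensity

universe u v w

/-- The joint parameter space `ℝ^p × H`; `τ.1` is the Euclidean parameter `θ`,
`τ.2` the nonparametric component `h`. -/
abbrev Param (p : ℕ) (H : Type v) : Type v := EuclideanSpace ℝ (Fin p) × H

/-- The space `L²(P) ⊖ {1}`, the orthogonal complement of the constants in `L²(P)`. -/
abbrev L20 {X : Type u} [MeasurableSpace X] (P : Measure X) [IsFiniteMeasure P] :
    Submodule ℝ (Lp ℝ 2 P) :=
  (Submodule.span ℝ {Lp.const 2 P (1 : ℝ)})ᗮ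

/-- Stochastic boundedness `Y k = O_p(a k)` as `k → ∞`. -/
def IsBigOp {Ω : Type w} [MeasurableSpace Ω] (P : Measure Ω) (Y : ℕ → Ω → ℝ) (a : ℕ → ℝ) : Prop :=
  ∀ ε : ℝ, 0 < ε → ∃ C : ℝ, 0 < C ∧
    ∀ᶠ k in atTop, P {ω | C * a k < |Y k ω|} ≤ ENNReal.ofReal ε

/-- The data of a semiparametric density model for `m` samples: the dominating measures
("`dx`" on the `l`-th sample space), the logistic transformations `η l τ x` of the densities,
the semi-inner product `J` of the penalty, and the true parameter `τ₀ = (θ₀, h₀)`. -/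
structure Model (p m : ℕ) (X : Fin m → Type u) [∀ l, MeasurableSpace (X l)]
    (H : Type v) [NormedAddCommGroup H] [InnerProductSpace ℝ H] where
  base : ∀ l, Measure (X l)
  η : ∀ l, Param p H → X l → ℝ
  J : H →ₗ[ℝ] H →ₗ[ℝ] ℝ
  τ₀ : Param p H

namespace Model

variable {p m : ℕ} {X : Fin m → Type u} [∀ l, MeasurableSpace (X l)]
  {H : Type v} [NormedAddCommGroup H] [InnerProductSpace ℝ H] (M : Model p m X H)

/-- The law with density `exp (η l τ) / ∫ exp (η l τ)`. Expectation under it is `μ_{l,τ}`,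
covariance under it is `V_{l,τ}`. -/
def law (l : Fin m) (τ : Param p H) : Measure (X l) := (M.base l).tilted (M.η l τ)

instance (l : Fin m) (τ : Param p H) : IsFiniteMeasure (M.law l τ) :=
  inferInstanceAs (IsFiniteMeasure ((M.base l).tilted (M.η l τ)))

/-- The sum over the samples of `V_{l,τ}(f_l, g_l)`. -/
def V (τ : Param p H) (f g : ∀ l, X l → ℝ) : ℝ := ∑ l, cov[f l, g l; M.law l τ]

open Classical in
/-- `τ ↦ η l τ` as a map into `L²` of the true law (with the value `0` where `η l τ` is not
square integrable). -/
def ηL2 (l : Fin m) (τ : Param p H) : Lp ℝ 2 (M.law l M.τ₀) :=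
  if hf : MemLp (M.η l τ) 2 (M.law l M.τ₀) then hf.toLp (M.η l τ) else 0

/-- `D_θ η_l(τ) ζ + D_h η_l(τ) g` for `v = (ζ, g)`, with the Fréchet derivative of the `L²`-valued
map `η_l`; it is given as a tuple over `l`. -/
def Dη (τ : Param p H) (v : Param p H) : ∀ l, X l → ℝ :=
  fun l => (fderiv ℝ (M.ηL2 l) τ v : Lp ℝ 2 (M.law l M.τ₀))

/-- `D_θ η_l(x; τ) ζ + D_h η_l(x; τ) g` for `v = (ζ, g)`, at the individual point `x`. -/
def Dηpt (l : Fin m) (x : X l) (τ v : Param p H) : ℝ := fderiv ℝ (fun σ => M.η l σ x) τ v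

/-- The auxiliary operators `L_{l,θ}` and `L_{l,h}`. -/
structure Ops where
  Lθ : ∀ l, EuclideanSpace ℝ (Fin p) →L[ℝ] L20 (M.law l M.τ₀)
  Lh : ∀ l, H →L[ℝ] L20 (M.law l M.τ₀)

section operators

variable {M} (L : M.Ops)

/-- `L_{l,θ} ζ + L_{l,h} g` for `v = (ζ, g)`, as a tuple over `l`. -/
def Ops.app (v : Param p H) : ∀ l, X l → ℝ :=
  fun l => ((L.Lθ l v.1 + L.Lh l v.2 : L20 (M.law l M.τ₀)) : Lp ℝ 2 (M.law l M.τ₀))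

/-- The bilinear form `(g₁, g₂) ↦ ∑_l V_{l,τ₀}(L_{l,h} g₁, L_{l,h} g₂)` on `H`. -/
def Ops.VH (g₁ g₂ : H) : ℝ := M.V M.τ₀ (L.app (0, g₁)) (L.app (0, g₂))

/-- `∑_l V_{l,τ₀}(L_{l,θ} ζ + L_{l,h} g) + lam J(g)` for `v = (ζ, g)`. -/
def Ops.sqNorm (lam : ℝ) (v : Param p H) : ℝ :=
  M.V M.τ₀ (L.app v) (L.app v) + lam * M.J v.2 v.2

end operators

/-! ### Likelihoods -/

section likelihood

variable {Ω : Type w} (ξ : ∀ l, ℕ → Ω → X l) (n : Fin m → ℕ)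

/-- Joint negative log likelihood of the first `n l` observations `ξ l i` of each sample `l`. -/
def negLogLik (ω : Ω) (τ : Param p H) : ℝ :=
  ∑ l, (-((n l : ℝ)⁻¹ * ∑ i ∈ Finset.range (n l), M.η l τ (ξ l i ω))
    + Real.log (∫ x, Real.exp (M.η l τ x) ∂(M.base l)))

/-- Penalized joint negative log likelihood. -/
def penLik (lam : ℝ) (ω : Ω) (τ : Param p H) : ℝ :=
  M.negLogLik ξ n ω τ + lam / 2 * M.J τ.2 τ.2

/-- The quadratic approximation of the penalized likelihood, whose minimizer is the linear
approximation of the estimator. -/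
def quadLik (lam : ℝ) (ω : Ω) (τ : Param p H) : ℝ :=
  ∑ l, (-((n l : ℝ)⁻¹ * ∑ i ∈ Finset.range (n l), M.Dηpt l (ξ l i ω) M.τ₀ τ)
    + ∫ x, M.Dη M.τ₀ τ l x ∂(M.law l M.τ₀))
  + 1 / 2 * M.V M.τ₀ (M.Dη M.τ₀ (τ - M.τ₀)) (M.Dη M.τ₀ (τ - M.τ₀))
  + lam / 2 * M.J τ.2 τ.2

/-- `τ` solves `E[D_θ ∑_l 𝓛_{n_l}(τ)] = 0` and `E[D_h ∑_l 𝓛_{n_l}(τ)] = 0`. -/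
def IsMeanScoreRoot [MeasurableSpace Ω] (P : Measure Ω) (τ : Param p H) : Prop :=
  (∀ ζ : EuclideanSpace ℝ (Fin p),
    ∫ ω, fderiv ℝ (fun θ => M.negLogLik ξ n ω (θ, τ.2)) τ.1 ζ ∂P = 0) ∧
  (∀ g : H, ∫ ω, fderiv ℝ (fun h => M.negLogLik ξ n ω (τ.1, h)) τ.2 g ∂P = 0)

end likelihood

/-! ### Assumptions -/

/-- `J` is a square seminorm with finite-dimensional null space. -/
structure PenaltyAssumption : Prop where
  symm : ∀ g h, M.J g h = M.J h g
  nonneg : ∀ h, 0 ≤ M.J h h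
  finite_null : ∃ S : Submodule ℝ H, FiniteDimensional ℝ S ∧ ∀ h, h ∈ S ↔ M.J h h = 0

/-- The auxiliary operators are injective, `∑_l V_{l,τ₀}(L_{l,h} g) + lam J(g)` is equivalent to the
squared norm of `H` for each smoothing parameter, and the ranges of the parametric and of the
nonparametric operators are separated. -/
structure NormAssumption (L : M.Ops) : Prop where
  injθ : ∀ l, Function.Injective (L.Lθ l)
  injh : ∀ l, Function.Injective (L.Lh l)
  equiv : ∀ lam : ℝ, 0 < lam → ∃ M₁ M₂ : ℝ, 0 < M₁ ∧ 0 < M₂ ∧ ∀ g : H,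
    M₁ * ‖g‖ ^ 2 ≤ L.VH g g + lam * M.J g g ∧ L.VH g g + lam * M.J g g ≤ M₂ * ‖g‖ ^ 2
  separated : ∃ cδ : ℝ, 0 < cδ ∧ ∀ (ζ : EuclideanSpace ℝ (Fin p)) (g : H), ‖ζ‖ = 1 →
    cδ < M.V M.τ₀ (L.app (ζ, -g)) (L.app (ζ, -g))

/-- `Nθ × Nh` is a convex open neighbourhood of the true parameter on which `η_l` gives densities
and is an injective, three times continuously Fréchet differentiable map into `L² ⊖ {1}`, whose
values at the individual points `x` (which enter the likelihood) are differentiable as well. -/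
structure SmoothnessAssumption (Nθ : Set (EuclideanSpace ℝ (Fin p))) (Nh : Set H) : Prop where
  openθ : IsOpen Nθ
  openh : IsOpen Nh
  convex : Convex ℝ (Nθ ×ˢ Nh)
  mem : M.τ₀ ∈ Nθ ×ˢ Nh
  measurable : ∀ l, ∀ τ ∈ Nθ ×ˢ Nh, Measurable (M.η l τ)
  integrable : ∀ l, ∀ τ ∈ Nθ ×ˢ Nh, Integrable (fun x => Real.exp (M.η l τ x)) (M.base l)
  memLp : ∀ l, ∀ τ ∈ Nθ ×ˢ Nh, MemLp (M.η l τ) 2 (M.law l M.τ₀)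
  mem_L20 : ∀ l, ∀ τ ∈ Nθ ×ˢ Nh, M.ηL2 l τ ∈ L20 (M.law l M.τ₀)
  injOn : ∀ l, Set.InjOn (M.ηL2 l) (Nθ ×ˢ Nh)
  contDiffOn : ∀ l, ContDiffOn ℝ 3 (M.ηL2 l) (Nθ ×ˢ Nh)
  differentiableOn : ∀ l x, DifferentiableOn ℝ (fun τ => M.η l τ x) (Nθ ×ˢ Nh)

/-- Comparison of the derivatives of `η_l` on the neighbourhood with the auxiliary operators, and
the bound on the oscillation of these derivatives. -/
def DerivativeAssumption (L : M.Ops) (Nθ : Set (EuclideanSpace ℝ (Fin p))) (Nh : Set H) : Prop :=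
  ∃ C₁ C₂ Cd : ℝ, 0 < C₁ ∧ 0 < C₂ ∧ 0 < Cd ∧ Cd < 2 * C₁ ∧
    (∀ τ ∈ Nθ ×ˢ Nh, ∀ v : Param p H,
      C₁ * M.V M.τ₀ (L.app v) (L.app v) ≤ M.V M.τ₀ (M.Dη τ v) (M.Dη τ v) ∧
      M.V M.τ₀ (M.Dη τ v) (M.Dη τ v) ≤ C₂ * M.V M.τ₀ (L.app v) (L.app v)) ∧
    (∀ τ₁ ∈ Nθ ×ˢ Nh, ∀ τ₂ ∈ Nθ ×ˢ Nh, ∀ v : Param p H,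
      M.V M.τ₀ (M.Dη τ₁ v - M.Dη τ₂ v) (M.Dη τ₁ v - M.Dη τ₂ v) ≤
        Cd * M.V M.τ₀ (L.app v) (L.app v))

/-- Uniform equivalence of the variances under the laws of the neighbourhood. -/
def WeightAssumption (Nθ : Set (EuclideanSpace ℝ (Fin p))) (Nh : Set H) : Prop :=
  ∃ C₃ C₄ : ℝ, 0 < C₃ ∧ 0 < C₄ ∧
    ∀ τ ∈ Nθ ×ˢ Nh, ∀ f : ∀ l, L20 (M.law l M.τ₀),
      let F : ∀ l, X l → ℝ := fun l => ((f l : Lp ℝ 2 (M.law l M.τ₀)) : X l → ℝ)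
      C₃ * M.V M.τ₀ F F ≤ M.V τ F F ∧ M.V τ F F ≤ C₄ * M.V M.τ₀ F F

/-- The quadratic functional `∑_l V_{l,τ₀}(L_{l,h} g)` is completely continuous with respect to
`J`: for each `ε > 0` it is at most `ε J(g)` on the common kernel of finitely many bounded linear
functionals. -/
def CompletelyContinuous (L : M.Ops) : Prop :=
  ∀ ε : ℝ, 0 < ε → ∃ (N : ℕ) (φ : Fin N → H →L[ℝ] ℝ),
    ∀ g : H, (∀ i, φ i g = 0) → L.VH g g ≤ ε * M.J g g

/-- `φ`, `ρ` is the (complete, ordered) eigensystem of `J` with respect to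
`∑_l V_{l,τ₀}(L_{l,h} ·, L_{l,h} ·)`. -/
structure IsEigensystem (L : M.Ops) (φ : ℕ → H) (ρ : ℕ → ℝ) : Prop where
  orthonormal : ∀ i j, L.VH (φ i) (φ j) = if i = j then 1 else 0
  diagonal : ∀ i j, M.J (φ i) (φ j) = if i = j then ρ i else 0
  nonneg : ∀ i, 0 ≤ ρ i
  mono : Monotone ρ
  tendsto : Tendsto ρ atTop atTop
  expansion : ∀ h : H, HasSum (fun i => L.VH h (φ i) • φ i) h

/-- `H` is infinite-dimensional and the eigenvalues of `J` with respect to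
`∑_l V_{l,τ₀}(L_{l,h} ·)` are of the form `ρ_ν = κ_ν ν ^ r` for all large `ν = i + 1`, where the
`κ_ν` stay in an interval bounded away from `0` and `∞`. -/
structure EigenvalueGrowth (L : M.Ops) (r : ℝ) : Prop where
  one_lt : 1 < r
  infinite : ¬ FiniteDimensional ℝ H
  growth : ∀ (φ : ℕ → H) (ρ : ℕ → ℝ), M.IsEigensystem L φ ρ →
    ∃ β₁ β₂ : ℝ, 0 < β₁ ∧ ∀ᶠ i in atTop, ∃ κ : ℝ, β₁ < κ ∧ κ < β₂ ∧
      ρ i = κ * ((i : ℝ) + 1) ^ r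

end Model

end SemiparDensity

end

/-! Both rates follow once the errors of the estimator and of its linear approximation at the true
parameter are `O_p(R)`, with `R = n⁻¹ lam^(-1/r) + lam`; the distance between the two is then
handled by the triangle inequality. Write `q v` for the quadratic form of `L_θ ζ + L_h g`, with `v =
(ζ, g)`.

Coordinates. Complete continuity makes the form on `H` a compact positive operator relative to form
plus `J`, so the two are diagonalized simultaneously. Since the ranges of `L_θ` and `L_h` are
separated, Euclidean coordinates can be added (`Ops.exists_coordinates`): `q v` is comparable to the
sum `W v` of the `x_j²`, and `J` is the sum of the `ρ_j x_j²`. The eigenvalue growth bounds the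
effective dimension, the sum of the `(1 + lam ρ_j)⁻¹`, by a multiple of `lam^(-1/r)`. Hence the dual
norm of the score, relative to `W + lam J`, has second moment of order `n⁻¹ lam^(-1/r)`
(`LocalBounds.measure_score_gt`).

Basic inequalities. The likelihood increment from the true parameter is `nonlinear v - score v`. For
the linear approximation the first term is a coercive quadratic form, and comparison with the true
parameter gives the rate. For the estimator, convexity moves this comparison to a sphere `W + lam J
= a` with `a` a large multiple of `R`. If the penalty makes up a fixed fraction of `a`, it already
contradicts minimality; otherwise `nonlinear v ≥ c₀ a` is needed, uniformly over the rest of the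
sphere (`LocalBounds.exists_nonlinear_bound`).

The lower bound. The deterministic part of `nonlinear` is a sum of relative entropies. Comparing
variances of indicators bounds the densities, the condition `Cd < 2 C₁` bounds increments of `η`
below, and together they give `excess v ≥ c q v`. The empirical remainder has no smoothness that
would control it uniformly; almost sure convexity takes its place. As the observations are
independent, an inequality that holds for almost every sample forces the tangent remainders to be
bounded above almost everywhere (`exists_ae_upper_bounds`). So the likelihood lies above truncated
tangents, simultaneously in the endpoint. At a fixed base point these depend on a linear family of
functions, and a Gaussian change of measure (PAC-Bayes) with a clipped logarithm bounds all
directions at once, outside an event of probability of order `exp (-t)`, using second moments only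
(`measure_exists_clipped_sum_gt`). Finally `exp (A lam^(-1/r))` base points suffice for the sphere,
and taking `t` of order `lam^(-1/r)` pays for the union bound. -/

noncomputable section

namespace SemiparDensity

universe u v w

/-! ### A clipped logarithm -/

/-- A function that lies between `-1` and `2`, satisfies `exp (clipLog u) ≤ 1 - u + 24 u²`, and
whose Gaussian averages dominate `min (-u) 1` up to the variance. -/
def clipLog (u : ℝ) : ℝ := if u < -1 / 2 then 2 else max (-u) (-1)

theorem measurable_clipLog : Measurable clipLog := by
  unfold clipLog
  exact Measurable.ite measurableSet_Iio measurable_const (by fun_prop)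

theorem neg_one_le_clipLog (u : ℝ) : -1 ≤ clipLog u := by
  unfold clipLog
  split_ifs
  · norm_num
  · exact le_max_right _ _

theorem clipLog_le_two (u : ℝ) : clipLog u ≤ 2 := by
  unfold clipLog
  split_ifs
  · exact le_rfl
  · refine max_le ?_ ?_ <;> linarith

theorem exp_le_one_add_add_sq {x : ℝ} (hx : x ≤ 1) : Real.exp x ≤ 1 + x + x ^ 2 := by
  rcases le_total (-1) x with h | h
  · have := Real.abs_exp_sub_one_sub_id_le (abs_le.2 ⟨h, hx⟩)
    have := (abs_le.1 this).2
    linarith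
  · have : Real.exp x ≤ 1 := Real.exp_le_one_iff.2 (by linarith)
    nlinarith

theorem exp_clipLog_le (u : ℝ) : Real.exp (clipLog u) ≤ 1 - u + 24 * u ^ 2 := by
  unfold clipLog
  split_ifs with h
  -- Here `u < -1/2`, so the right-hand side exceeds `1 + 1/2 + 6 = 7.5`. The factor 24 pays for the
  -- plateau value 2.
  · have h2 : Real.exp 2 ≤ 7.5 := by
      have := Real.exp_one_lt_d9
      have h3 : Real.exp 2 = Real.exp 1 * Real.exp 1 := by rw [← Real.exp_add]; norm_num
      rw [h3]
      have := Real.exp_pos 1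
      nlinarith
    nlinarith
  · push Not at h
    rcases le_total (-u) (-1) with h' | h'
    · rw [max_eq_right h']
      have : Real.exp (-1) ≤ 1 := Real.exp_le_one_iff.2 (by norm_num)
      nlinarith
    · rw [max_eq_left h']
      have := exp_le_one_add_add_sq (x := -u) (by linarith)
      nlinarith

/-- Quadratic minorants of `clipLog` that touch `min (-y) 1` at `y`. -/
theorem exists_minorant_clipLog (y : ℝ) :
    ∃ k : ℝ, ∀ h : ℝ, min (-y) 1 - k * h - 2 * h ^ 2 ≤ clipLog (y + h) := by
  rcases le_total (-1) y with hy | hy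
  -- The slope is that of the branch `-u`. The term `-2 h²` keeps the minorant below the plateau:
  -- `-y ≤ 1` and `-h - 2 h² ≤ 1/8`.
  · refine ⟨1, fun h => ?_⟩
    rw [min_eq_left (by linarith)]
    unfold clipLog
    split_ifs with hu
    · nlinarith [sq_nonneg (h + 1 / 4)]
    · exact le_trans (by nlinarith) (le_max_left _ _)
  -- Leaving the plateau from `y ≤ -1` takes `h ≥ 1/2`, and then `1 - 2 h² ≤ 1 - h ≤ -(y + h)`.
  · refine ⟨0, fun h => ?_⟩
    rw [min_eq_right (by linarith)]
    unfold clipLog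
    split_ifs with hu
    · nlinarith
    · push Not at hu
      refine le_trans ?_ (le_max_left _ _)
      nlinarith

/-! ### Standard Gaussian vectors -/

/-- The standard Gaussian measure on `ℝ^D`. -/
def gaussianPi (D : ℕ) : Measure (Fin D → ℝ) := Measure.pi fun _ => gaussianReal 0 1

instance (D : ℕ) : IsProbabilityMeasure (gaussianPi D) := by
  unfold gaussianPi; infer_instance

theorem gaussianPDFReal_shift (a x : ℝ) :
    gaussianPDFReal a 1 x = Real.exp (a * x - a ^ 2 / 2) * gaussianPDFReal 0 1 x := by
  simp only [gaussianPDFReal, NNReal.coe_one]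
  rw [mul_left_comm, ← Real.exp_add]
  congr 2
  ring

theorem gaussianReal_shift (a : ℝ) (s : Set ℝ) :
    gaussianReal a 1 s
      = ∫⁻ x in s, ENNReal.ofReal (Real.exp (a * x - a ^ 2 / 2)) ∂(gaussianReal 0 1) := by
  rw [gaussianReal_of_var_ne_zero 0 one_ne_zero,
    setLIntegral_withDensity_eq_setLIntegral_mul_non_measurable₀',
    gaussianReal_of_var_ne_zero a one_ne_zero, withDensity_apply']
  · refine lintegral_congr fun x => ?_
    simp only [Pi.mul_apply, gaussianPDF]
    rw [← ENNReal.ofReal_mul (gaussianPDFReal_nonneg _ _ _), gaussianPDFReal_shift, mul_comm]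
  · exact (measurable_gaussianPDF _ _).aemeasurable
  · exact ae_of_all _ fun x => gaussianPDF_lt_top

theorem integrable_exp_shift (a : ℝ) :
    Integrable (fun x => Real.exp (a * x - a ^ 2 / 2)) (gaussianReal 0 1) := by
  simp only [Real.exp_sub]
  exact (integrable_exp_mul_gaussianReal a).div_const _

/-- Translates of the standard Gaussian measure have an exponential density. -/
theorem map_add_gaussianPi {D : ℕ} (μ : Fin D → ℝ) :
    (gaussianPi D).map (fun z => z + μ)
      = (gaussianPi D).withDensity
        fun z => ENNReal.ofReal (∏ i, Real.exp (μ i * z i - μ i ^ 2 / 2)) := by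
  have h1 : (gaussianPi D).map (fun z => z + μ) = Measure.pi fun i => gaussianReal (μ i) 1 := by
    have := Measure.pi_map_pi (μ := fun _ : Fin D => gaussianReal 0 1)
      (f := fun i (x : ℝ) => x + μ i) (fun i => by fun_prop)
    simp only [gaussianReal_map_add_const, zero_add] at this
    exact this
  rw [h1]
  refine Measure.pi_eq fun s hs => ?_
  rw [withDensity_apply _ (MeasurableSet.univ_pi hs), gaussianPi, Measure.restrict_pi_pi,
    ← ofReal_integral_eq_lintegral_ofReal]
  · rw [integral_fintype_prod_eq_prod (f := fun i x => Real.exp (μ i * x - μ i ^ 2 / 2)),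
      ENNReal.ofReal_prod_of_nonneg]
    · refine Finset.prod_congr rfl fun i _ => ?_
      rw [gaussianReal_shift, ofReal_integral_eq_lintegral_ofReal]
      · exact (integrable_exp_shift _).integrableOn
      · exact ae_of_all _ fun x => (Real.exp_pos _).le
    · exact fun i _ => integral_nonneg fun x => (Real.exp_pos _).le
  · exact Integrable.fintype_prod (f := fun i x => Real.exp (μ i * x - μ i ^ 2 / 2))
      fun i => (integrable_exp_shift _).integrableOn
  · exact ae_of_all _ fun x => Finset.prod_nonneg fun i _ => (Real.exp_pos _).le

theorem integrable_coord_sq (D : ℕ) (i : Fin D) :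
    Integrable (fun z : Fin D → ℝ => z i ^ 2) (gaussianPi D) :=
  integrable_comp_eval (μ := fun _ : Fin D => gaussianReal 0 1) (f := fun x : ℝ => x ^ 2)
    (memLp_id_gaussianReal 2).integrable_sq

theorem integrable_coord (D : ℕ) (i : Fin D) :
    Integrable (fun z : Fin D → ℝ => z i) (gaussianPi D) :=
  integrable_comp_eval (μ := fun _ : Fin D => gaussianReal 0 1) (f := fun x : ℝ => x)
    ((memLp_id_gaussianReal 2).integrable (by norm_num))

theorem integral_coord (D : ℕ) (i : Fin D) : ∫ z, z i ∂(gaussianPi D) = 0 := by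
  have := integral_comp_eval (μ := fun _ : Fin D => gaussianReal 0 1) (i := i)
    (f := fun x : ℝ => x) (by fun_prop)
  rw [gaussianPi, this]
  exact integral_id_gaussianReal

theorem integral_coord_sq (D : ℕ) (i : Fin D) : ∫ z, z i ^ 2 ∂(gaussianPi D) = 1 := by
  have := integral_comp_eval (μ := fun _ : Fin D => gaussianReal 0 1) (i := i)
    (f := fun x : ℝ => x ^ 2) (by fun_prop)
  rw [gaussianPi, this]
  have h := variance_fun_id_gaussianReal (μ := 0) (v := 1)
  rw [variance_of_integral_eq_zero (by fun_prop) integral_id_gaussianReal] at h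
  simpa using h

theorem memLp_linear (D : ℕ) (c : Fin D → ℝ) :
    MemLp (fun z : Fin D → ℝ => ∑ i, c i * z i) 2 (gaussianPi D) := by
  refine memLp_finsetSum _ fun i _ => MemLp.const_mul ?_ _
  rw [memLp_two_iff_integrable_sq (measurable_pi_apply i).aestronglyMeasurable]
  exact integrable_coord_sq D i

theorem integral_linear (D : ℕ) (c : Fin D → ℝ) :
    ∫ z, (∑ i, c i * z i) ∂(gaussianPi D) = 0 := by
  rw [integral_finsetSum _ fun i _ => (integrable_coord D i).const_mul _]
  simp [integral_const_mul, integral_coord]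

theorem integral_linear_sq (D : ℕ) (c : Fin D → ℝ) :
    ∫ z, (∑ i, c i * z i) ^ 2 ∂(gaussianPi D) = ∑ i, c i ^ 2 := by
  have h := variance_sum_pi (μ := fun _ : Fin D => gaussianReal 0 1)
    (X := fun i (x : ℝ) => c i * x) (fun i => (memLp_id_gaussianReal 2).const_mul _)
  have h2 : Var[∑ i, fun z : Fin D → ℝ => c i * z i; Measure.pi fun _ => gaussianReal 0 1]
      = ∫ z, (∑ i, c i * z i) ^ 2 ∂(gaussianPi D) := by
    have : (∑ i, fun z : Fin D → ℝ => c i * z i) = fun z => ∑ i, c i * z i := by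
      ext z; simp
    rw [this]
    exact variance_of_integral_eq_zero (memLp_linear D c).aestronglyMeasurable.aemeasurable
      (integral_linear D c)
  rw [← h2, h]
  refine Finset.sum_congr rfl fun i _ => ?_
  rw [variance_const_mul, variance_fun_id_gaussianReal]
  simp

/-- Gaussian smoothing of `clipLog`. -/
theorem integral_clipLog_ge {D : ℕ} (y : ℝ) (c : Fin D → ℝ) :
    min (-y) 1 - 2 * min (∑ i, c i ^ 2) 1
      ≤ ∫ z, clipLog (y + ∑ i, c i * z i) ∂(gaussianPi D) := by
  have hm : Measurable fun z : Fin D → ℝ => clipLog (y + ∑ i, c i * z i) :=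
    measurable_clipLog.comp (by fun_prop)
  have hint : Integrable (fun z => clipLog (y + ∑ i, c i * z i)) (gaussianPi D) := by
    refine Integrable.of_bound hm.aestronglyMeasurable 2 (ae_of_all _ fun z => ?_)
    rw [Real.norm_eq_abs, abs_le]
    constructor <;> linarith [neg_one_le_clipLog (y + ∑ i, c i * z i),
      clipLog_le_two (y + ∑ i, c i * z i)]
  -- For variance at most one, the quadratic minorant is integrated and its linear term averages to
  -- zero. For larger variance the left-hand side is at most `-1`, a lower bound of `clipLog`.
  rcases le_total (∑ i, c i ^ 2) 1 with h | h
  · rw [min_eq_left h]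
    obtain ⟨k, hk⟩ := exists_minorant_clipLog y
    have hi1 := ((memLp_linear D c).integrable (by norm_num)).const_mul k
    have hi2 := ((memLp_linear D c).integrable_sq).const_mul 2
    have h3 : ∫ z, (min (-y) 1 - k * (∑ i, c i * z i) - 2 * (∑ i, c i * z i) ^ 2) ∂(gaussianPi D)
        = min (-y) 1 - 2 * ∑ i, c i ^ 2 := by
      have hi3 : Integrable (fun z : Fin D → ℝ => min (-y) 1 - k * ∑ i, c i * z i)
          (gaussianPi D) := (integrable_const _).sub hi1
      rw [integral_sub hi3 hi2, integral_sub (integrable_const _) hi1, integral_const_mul, integral_const_mul,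
        integral_linear, integral_linear_sq]
      simp
    rw [← h3]
    exact integral_mono (((integrable_const _).sub hi1).sub hi2) hint fun z => hk _
  · rw [min_eq_right h]
    calc min (-y) 1 - 2 * 1 ≤ -1 := by linarith [min_le_right (-y) 1]
      _ = ∫ z, (-1 : ℝ) ∂(gaussianPi D) := by simp
      _ ≤ _ := integral_mono (integrable_const _) hint fun z => neg_one_le_clipLog _

/-- The change of measure inequality for translates of the standard Gaussian measure. -/
theorem exp_integral_translate_le {D : ℕ} (Φ : (Fin D → ℝ) → ℝ) (hΦ : Measurable Φ) {B : ℝ}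
    (hB : ∀ z, Φ z ≤ B) (μ : Fin D → ℝ) (hint : Integrable (fun z => Φ (z + μ)) (gaussianPi D)) :
    Real.exp (∫ z, Φ (z + μ) ∂(gaussianPi D) - 1 / 2 * ∑ i, μ i ^ 2)
      ≤ ∫ z, Real.exp (Φ z) ∂(gaussianPi D) := by
  set γ := gaussianPi D
  -- pull the integrand back along the translation
  have hexp : ∀ z : Fin D → ℝ, (∏ i, Real.exp (-μ i * z i - (-μ i) ^ 2 / 2))
      = Real.exp (-(∑ i, μ i * z i) - 1 / 2 * ∑ i, μ i ^ 2) := by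
    intro z
    rw [← Real.exp_sum, Finset.sum_sub_distrib, Finset.mul_sum, ← Finset.sum_neg_distrib]
    congr 2
    · exact Finset.sum_congr rfl fun i _ => by ring
    · exact Finset.sum_congr rfl fun i _ => by ring
  -- `γ` is its own translate by `-μ`, moved back by `μ`. Integrals against `γ` thereby become
  -- integrals of the translated integrand with a Cameron–Martin weight.
  have hbase : γ = (γ.withDensity
      fun z => ENNReal.ofReal (∏ i, Real.exp (-μ i * z i - (-μ i) ^ 2 / 2))).map
        (fun z => z + μ) := by
    have h := map_add_gaussianPi (D := D) (fun i => -μ i)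
    rw [← h, Measure.map_map (by fun_prop) (by fun_prop)]
    have : ((fun z => z + μ) ∘ fun z : Fin D → ℝ => z + fun i => -μ i) = id := by
      ext z i; simp
    rw [this, Measure.map_id]
  have hI : ∫ z, Real.exp (Φ z) ∂γ
      = ∫ z, Real.exp (Φ (z + μ) - (∑ i, μ i * z i) - 1 / 2 * ∑ i, μ i ^ 2) ∂γ := by
    conv_lhs => rw [hbase]
    rw [integral_map (by fun_prop) (hΦ.exp.aestronglyMeasurable),
      integral_withDensity_eq_integral_toReal_smul (by fun_prop)
        (ae_of_all _ fun _ => ENNReal.ofReal_lt_top)]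
    refine integral_congr_ae (ae_of_all _ fun z => ?_)
    simp only [smul_eq_mul]
    rw [ENNReal.toReal_ofReal (Finset.prod_nonneg fun i _ => (Real.exp_pos _).le), hexp,
      ← Real.exp_add]
    congr 1
    ring
  have hintE : Integrable
      (fun z => Real.exp (Φ (z + μ) - (∑ i, μ i * z i) - 1 / 2 * ∑ i, μ i ^ 2)) γ := by
    have hdom : Integrable (fun z : Fin D → ℝ =>
        Real.exp B * ∏ i, Real.exp (-μ i * z i - (-μ i) ^ 2 / 2)) γ :=
      (Integrable.fintype_prod (f := fun i x => Real.exp (-μ i * x - (-μ i) ^ 2 / 2))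
        fun i => integrable_exp_shift _).const_mul _
    refine hdom.mono' (by fun_prop) (ae_of_all _ fun z => ?_)
    rw [Real.norm_eq_abs, Real.abs_exp, hexp, ← Real.exp_add]
    exact Real.exp_le_exp.2 (by linarith [hB (z + μ)])
  rw [hI]
  set Ψ : (Fin D → ℝ) → ℝ := fun z => Φ (z + μ) - (∑ i, μ i * z i) - 1 / 2 * ∑ i, μ i ^ 2
  have hlin : Integrable (fun z : Fin D → ℝ => ∑ i, μ i * z i) γ :=
    (memLp_linear D μ).integrable (by norm_num)
  have hΨ : Integrable Ψ γ := (hint.sub hlin).sub (integrable_const _)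
  have hΨI : ∫ z, Ψ z ∂γ = ∫ z, Φ (z + μ) ∂γ - 1 / 2 * ∑ i, μ i ^ 2 := by
    simp only [Ψ]
    have hi3 : Integrable (fun z : Fin D → ℝ => Φ (z + μ) - ∑ i, μ i * z i) γ := hint.sub hlin
    rw [integral_sub hi3 (integrable_const _), integral_sub hint hlin, integral_linear]
    simp
  rw [← hΨI]
  set c := ∫ z, Ψ z ∂γ
  -- Jensen's inequality for `exp`, by means of the tangent at the mean `c`.
  have h1 : ∫ z, Real.exp c * (1 + (Ψ z - c)) ∂γ = Real.exp c := by
    have hi3 : Integrable (fun z : Fin D → ℝ => Ψ z - c) γ := hΨ.sub (integrable_const _)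
    rw [integral_const_mul, integral_add (integrable_const _) hi3,
      integral_sub hΨ (integrable_const _)]
    simp [c]
  rw [← h1]
  refine integral_mono ?_ hintE fun z => ?_
  · exact ((integrable_const _).add (hΨ.sub (integrable_const _))).const_mul _
  · calc Real.exp c * (1 + (Ψ z - c)) ≤ Real.exp c * Real.exp (Ψ z - c) := by
          gcongr
          linarith [Real.add_one_le_exp (Ψ z - c)]
      _ = Real.exp (Ψ z) := by rw [← Real.exp_add]; congr 1; ring

/-! ### A uniform one-sided deviation bound for linear families -/

theorem measure_exp_le_of_integral_le_one {α : Type*} [MeasurableSpace α] (μ : Measure α)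
    [IsProbabilityMeasure μ] {g : α → ℝ} (hg0 : ∀ x, 0 ≤ g x) (hg : Integrable g μ)
    (hg1 : ∫ x, g x ∂μ ≤ 1) (t : ℝ) :
    μ {x | Real.exp t ≤ g x} ≤ ENNReal.ofReal (Real.exp (-t)) := by
  have h := mul_meas_ge_le_integral_of_nonneg (ae_of_all _ hg0) hg (Real.exp t)
  rw [← ENNReal.ofReal_toReal (measure_ne_top μ _)]
  refine ENNReal.ofReal_le_ofReal ?_
  rw [Real.exp_neg, ← one_div, le_div_iff₀ (Real.exp_pos _), mul_comm]
  exact h.trans hg1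

/-- Chernoff's method. A variable `u` in `[0, 1]` satisfies `exp u ≤ 1 + u + u² ≤ 1 + 2 u`, so each
clipped summand has exponential moment at most `exp (2 ∫ g)`, although `g` itself is merely
integrable. -/
theorem measure_sum_clipped_ge {X : Type*} [MeasurableSpace X] (Q : Measure X)
    [IsProbabilityMeasure Q] (N : ℕ) {g : X → ℝ} (hg : Measurable g) (hg0 : ∀ x, 0 ≤ g x)
    (hgi : Integrable g Q) (t : ℝ) :
    Measure.pi (fun _ : Fin N => Q) {x | 2 * N * (∫ x, g x ∂Q) + t ≤ ∑ i, min (g (x i)) 1}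
      ≤ ENNReal.ofReal (Real.exp (-t)) := by
  set κ := ∫ x, g x ∂Q
  have hm : Measurable fun x : Fin N → X => ∑ i, min (g (x i)) 1 := by fun_prop
  have hκ : 0 ≤ κ := integral_nonneg hg0
  have hmeas : Measurable fun x : X => Real.exp (min (g x) 1) := by fun_prop
  have hb : ∀ x, Real.exp (min (g x) 1) ≤ Real.exp 1 :=
    fun x => Real.exp_le_exp.2 (min_le_right _ _)
  have hi1 : Integrable (fun x => Real.exp (min (g x) 1)) Q :=
    Integrable.of_bound hmeas.aestronglyMeasurable (Real.exp 1)
      (ae_of_all _ fun x => by rw [Real.norm_eq_abs, Real.abs_exp]; exact hb x)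
  have h1 : ∫ x, Real.exp (min (g x) 1) ∂Q ≤ Real.exp (2 * κ) := by
    calc ∫ x, Real.exp (min (g x) 1) ∂Q ≤ ∫ x, (1 + 2 * g x) ∂Q := by
          refine integral_mono hi1 ((integrable_const _).add (hgi.const_mul 2)) fun x => ?_
          have h0 : 0 ≤ min (g x) 1 := le_min (hg0 x) zero_le_one
          have := exp_le_one_add_add_sq (min_le_right (g x) 1)
          have h2 : min (g x) 1 ^ 2 ≤ min (g x) 1 := by
            nlinarith [min_le_right (g x) 1]
          linarith [min_le_left (g x) 1]
      _ = 2 * κ + 1 := by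
          rw [integral_add (integrable_const _) (hgi.const_mul 2), integral_const_mul]
          simp [κ, add_comm]
      _ ≤ _ := Real.add_one_le_exp _
  have hexp : ∀ x : Fin N → X, Real.exp (∑ i, min (g (x i)) 1 - 2 * N * κ)
      = Real.exp (-(2 * N * κ)) * ∏ i, Real.exp (min (g (x i)) 1) := by
    intro x
    rw [← Real.exp_sum, ← Real.exp_add]
    congr 1
    ring
  have key := measure_exp_le_of_integral_le_one (Measure.pi fun _ : Fin N => Q)
    (g := fun x => Real.exp (∑ i, min (g (x i)) 1 - 2 * N * κ)) (fun x => (Real.exp_pos _).le)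
    ?_ ?_ t
  · refine le_trans (measure_mono fun x hx => ?_) key
    simp only [Set.mem_ofPred_eq] at hx ⊢
    exact Real.exp_le_exp.2 (by linarith)
  · simp only [hexp]
    exact (Integrable.fintype_prod (f := fun _ x => Real.exp (min (g x) 1))
      fun _ => hi1).const_mul _
  · simp only [hexp]
    rw [integral_const_mul, integral_fintype_prod_eq_prod (f := fun _ x => Real.exp (min (g x) 1)),
      Finset.prod_const, Finset.card_univ, Fintype.card_fin]
    calc _ ≤ Real.exp (-(2 * N * κ)) * Real.exp (2 * κ) ^ N := by
          gcongr
      _ = 1 := by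
          rw [← Real.exp_nat_mul, ← Real.exp_add]
          rw [Real.exp_eq_one_iff]
          ring

/-- With high probability the clipped sums of a linear family of centred functions are bounded
above simultaneously for all members of the family. -/
theorem measure_exists_clipped_sum_gt {X : Type*} [MeasurableSpace X] (Q : Measure X)
    [IsProbabilityMeasure Q] (N : ℕ) {D : ℕ} {f : X → ℝ} {ψ : Fin D → X → ℝ}
    (hf : Measurable f) (hψ : ∀ j, Measurable (ψ j))
    (hf2 : MemLp f 2 Q) (hψ2 : ∀ j, MemLp (ψ j) 2 Q)
    (hf0 : ∫ x, f x ∂Q = 0) (hψ0 : ∀ j, ∫ x, ψ j x ∂Q = 0) {F C : ℝ}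
    (hF : ∫ x, f x ^ 2 ∂Q ≤ F)
    (hC : ∀ z : Fin D → ℝ, ∫ x, (∑ j, z j * ψ j x) ^ 2 ∂Q ≤ C * ∑ j, z j ^ 2)
    {σ : Fin D → ℝ} (hσ : ∀ j, 0 < σ j) (t : ℝ) :
    Measure.pi (fun _ : Fin N => Q) {x | ∃ w : Fin D → ℝ,
        48 * N * (F + C * (∑ j, w j ^ 2 + ∑ j, σ j ^ 2)) + 1 / 2 * ∑ j, (w j / σ j) ^ 2 + t
          + 2 * (2 * N * (C * ∑ j, σ j ^ 2) + t)
          < ∑ i, min (-(f (x i) + ∑ j, w j * ψ j (x i))) 1}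
      ≤ 2 * ENNReal.ofReal (Real.exp (-t)) := by
  set γ := gaussianPi D
  -- The direction is randomized by a Gaussian prior with standard deviations `σ j`. Since `v z`
  -- dominates 24 times the second moment of `Y · z`, the exponential of `Φ x z` below has
  -- expectation at most one for every `z`.
  set Y : X → (Fin D → ℝ) → ℝ := fun x z => f x + ∑ j, (σ j * z j) * ψ j x with hY
  set v : (Fin D → ℝ) → ℝ := fun z => 48 * (F + C * ∑ j, (σ j * z j) ^ 2) with hv
  set g : X → ℝ := fun x => ∑ j, (σ j * ψ j x) ^ 2 with hg
  have hYm : Measurable fun p : X × (Fin D → ℝ) => Y p.1 p.2 := by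
    simp only [hY]
    have : ∀ j, Measurable fun p : X × (Fin D → ℝ) => ψ j p.1 := fun j => (hψ j).comp measurable_fst
    have : Measurable fun p : X × (Fin D → ℝ) => f p.1 := hf.comp measurable_fst
    fun_prop
  have hvm : Measurable v := by simp only [hv]; fun_prop
  have hlin2 : ∀ z : Fin D → ℝ, MemLp (fun x => ∑ j, z j * ψ j x) 2 Q := fun z =>
    memLp_finsetSum _ fun j _ => (hψ2 j).const_mul _
  have hY2 : ∀ z, MemLp (fun x => Y x z) 2 Q := fun z => hf2.add (hlin2 fun j => σ j * z j)
  have hY0 : ∀ z, ∫ x, Y x z ∂Q = 0 := by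
    intro z
    simp only [hY]
    rw [integral_add (hf2.integrable (by norm_num)) ((hlin2 fun j => σ j * z j).integrable
      (by norm_num)), hf0, integral_finsetSum _ fun j _ =>
        ((hψ2 j).integrable (by norm_num)).const_mul _]
    simp [integral_const_mul, hψ0]
  have hYsq : ∀ z, 24 * ∫ x, Y x z ^ 2 ∂Q ≤ v z := by
    intro z
    have h1 : ∫ x, Y x z ^ 2 ∂Q
        ≤ ∫ x, (2 * f x ^ 2 + 2 * (∑ j, (σ j * z j) * ψ j x) ^ 2) ∂Q := by
      refine integral_mono (hY2 z).integrable_sq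
        ((hf2.integrable_sq.const_mul 2).add
          ((hlin2 fun j => σ j * z j).integrable_sq.const_mul 2)) fun x => ?_
      simp only [hY]
      nlinarith [sq_nonneg (f x - ∑ j, (σ j * z j) * ψ j x)]
    rw [integral_add (hf2.integrable_sq.const_mul 2)
          ((hlin2 fun j => σ j * z j).integrable_sq.const_mul 2), integral_const_mul,
        integral_const_mul] at h1
    have h2 := hC fun j => σ j * z j
    simp only [hv]
    linarith
  have hYe : ∀ z, ∫ x, Real.exp (clipLog (Y x z)) ∂Q ≤ Real.exp (v z) := by
    intro z
    have hYz := (hY2 z)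
    have hi : Integrable (fun x => 1 - Y x z + 24 * Y x z ^ 2) Q :=
      ((integrable_const _).sub (hYz.integrable (by norm_num))).add (hYz.integrable_sq.const_mul 24)
    have hi' : Integrable (fun x => 1 - Y x z) Q :=
      (integrable_const _).sub (hYz.integrable (by norm_num))
    calc ∫ x, Real.exp (clipLog (Y x z)) ∂Q ≤ ∫ x, (1 - Y x z + 24 * Y x z ^ 2) ∂Q :=
          integral_mono_of_nonneg (ae_of_all _ fun x => (Real.exp_pos _).le) hi
            (ae_of_all _ fun x => exp_clipLog_le _)
      _ = 24 * ∫ x, Y x z ^ 2 ∂Q + 1 := by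
          rw [integral_add hi' (hYz.integrable_sq.const_mul 24),
            integral_sub (integrable_const _) (hYz.integrable (by norm_num)), hY0,
            integral_const_mul]
          simp [add_comm]
      _ ≤ v z + 1 := by linarith [hYsq z]
      _ ≤ _ := Real.add_one_le_exp _
  have hv0 : ∀ z, 0 ≤ v z := fun z =>
    (mul_nonneg (by norm_num) (integral_nonneg fun x => sq_nonneg _)).trans (hYsq z)
  set Φ : (Fin N → X) → (Fin D → ℝ) → ℝ := fun x z => ∑ i, clipLog (Y (x i) z) - N * v z with hΦ
  have hΦm : Measurable fun p : (Fin N → X) × (Fin D → ℝ) => Φ p.1 p.2 := by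
    simp only [hΦ]
    refine Measurable.sub (Finset.measurable_sum _ fun i _ => ?_) (by fun_prop)
    have h := hYm.comp (((measurable_pi_apply i).comp measurable_fst).prodMk measurable_snd :
      Measurable fun p : (Fin N → X) × (Fin D → ℝ) => (p.1 i, p.2))
    exact measurable_clipLog.comp h
  have hΦle : ∀ x z, Φ x z ≤ N * 2 := by
    intro x z
    have h1 : ∑ i, clipLog (Y (x i) z) ≤ ∑ _i : Fin N, (2 : ℝ) :=
      Finset.sum_le_sum fun i _ => clipLog_le_two _
    have h2 : 0 ≤ (N : ℝ) * v z := mul_nonneg N.cast_nonneg (hv0 z)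
    simp only [Finset.sum_const, Finset.card_univ, Fintype.card_fin, nsmul_eq_mul] at h1
    simp only [hΦ]
    linarith
  set μ := Measure.pi fun _ : Fin N => Q
  have hprodint : Integrable (fun p : (Fin N → X) × (Fin D → ℝ) => Real.exp (Φ p.1 p.2))
      (μ.prod γ) := by
    refine Integrable.of_bound (hΦm.exp.aestronglyMeasurable) (Real.exp (N * 2))
      (ae_of_all _ fun p => ?_)
    rw [Real.norm_eq_abs, Real.abs_exp]
    exact Real.exp_le_exp.2 (hΦle _ _)
  -- By Fubini the average over the prior still has expectation at most one. Markov's inequality is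
  -- thus applied only once, for all directions together.
  have hZ1 : ∫ x, ∫ z, Real.exp (Φ x z) ∂γ ∂μ ≤ 1 := by
    rw [integral_integral_swap hprodint]
    calc ∫ z, ∫ x, Real.exp (Φ x z) ∂μ ∂γ ≤ ∫ _z, (1 : ℝ) ∂γ := by
          refine integral_mono hprodint.integral_prod_right (integrable_const _) fun z => ?_
          have : ∀ x : Fin N → X, Real.exp (Φ x z)
              = Real.exp (-(N * v z)) * ∏ i, Real.exp (clipLog (Y (x i) z)) := by
            intro x
            rw [← Real.exp_sum, ← Real.exp_add]
            congr 1
            simp only [hΦ]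
            ring
          simp only [this]
          rw [integral_const_mul, integral_fintype_prod_eq_prod
            (f := fun _ x => Real.exp (clipLog (Y x z))), Finset.prod_const, Finset.card_univ,
            Fintype.card_fin]
          calc _ ≤ Real.exp (-(N * v z)) * Real.exp (v z) ^ N := by
                have h0 : 0 ≤ ∫ x, Real.exp (clipLog (Y x z)) ∂Q :=
                  integral_nonneg fun x => (Real.exp_pos _).le
                exact mul_le_mul_of_nonneg_left (pow_le_pow_left₀ h0 (hYe z) N) (Real.exp_pos _).le
            _ = 1 := by
                rw [← Real.exp_nat_mul, ← Real.exp_add, Real.exp_eq_one_iff]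
                ring
      _ = 1 := by simp
  have hE1 := measure_exp_le_of_integral_le_one μ (g := fun x => ∫ z, Real.exp (Φ x z) ∂γ)
    (fun x => integral_nonneg fun z => (Real.exp_pos _).le) hprodint.integral_prod_left hZ1 t
  have hgm : Measurable g := by simp only [hg]; fun_prop
  have hgi : Integrable g Q :=
    integrable_finsetSum _ fun j _ => ((hψ2 j).const_mul (σ j)).integrable_sq
  have hE2 := measure_sum_clipped_ge Q N hgm
    (fun x => Finset.sum_nonneg fun j _ => sq_nonneg _) hgi t
  have hgC : ∫ x, g x ∂Q ≤ C * ∑ j, σ j ^ 2 := by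
    simp only [hg]
    rw [integral_finsetSum _ fun j _ => ((hψ2 j).const_mul (σ j)).integrable_sq, Finset.mul_sum]
    refine Finset.sum_le_sum fun j _ => ?_
    have h := hC (Pi.single j (σ j))
    simpa [Pi.single_apply, ite_pow] using h
  refine (measure_mono ?_).trans ((measure_union_le _ _).trans
    ((add_le_add hE1 hE2).trans (two_mul _).ge))
  rintro x ⟨w, hw⟩
  by_contra hx
  simp only [Set.mem_union, Set.mem_ofPred_eq, not_or, not_le] at hx
  obtain ⟨hx1, hx2⟩ := hx
  -- Centring the randomization at `w` means translating the standard Gaussian by `m`, at the cost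
  -- `1/2 ∑ (w j / σ j)²`. The average of `clipLog` then gives back the clipped value at `w`, up to
  -- twice the clipped sum of `g`, which the second exceptional event controls.
  set m : Fin D → ℝ := fun j => w j / σ j with hm
  have hYadd : ∀ a z, Y a (z + m) = (f a + ∑ j, w j * ψ j a) + ∑ j, (σ j * ψ j a) * z j := by
    intro a z
    simp only [hY, hm, Pi.add_apply]
    rw [add_assoc, ← Finset.sum_add_distrib]
    congr 1
    refine Finset.sum_congr rfl fun j _ => ?_
    have := (hσ j).ne'
    field_simp
    ring
  have hcl : ∀ a : X, Integrable (fun z => clipLog (Y a (z + m))) γ := by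
    intro a
    have hmm : Measurable fun z : Fin D → ℝ => clipLog (Y a (z + m)) := by
      refine measurable_clipLog.comp ?_
      simp only [hYadd]
      fun_prop
    refine Integrable.of_bound hmm.aestronglyMeasurable 2 (ae_of_all _ fun z => ?_)
    rw [Real.norm_eq_abs, abs_le]
    constructor <;> linarith [neg_one_le_clipLog (Y a (z + m)), clipLog_le_two (Y a (z + m))]
  have hvadd : ∀ z, v (z + m) = 48 * F + (48 * C * (∑ j, σ j ^ 2 * z j ^ 2)
      + 96 * C * (∑ j, (w j * σ j) * z j) + 48 * C * ∑ j, w j ^ 2) := by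
    intro z
    simp only [hv, hm, Pi.add_apply, mul_add, Finset.mul_sum]
    rw [← Finset.sum_add_distrib, ← Finset.sum_add_distrib]
    congr 1
    refine Finset.sum_congr rfl fun j _ => ?_
    have := (hσ j).ne'
    field_simp
    ring
  have hI1 : Integrable (fun z : Fin D → ℝ => 48 * C * (∑ j, σ j ^ 2 * z j ^ 2)) γ :=
    (integrable_finsetSum _ fun j _ => (integrable_coord_sq D j).const_mul _).const_mul _
  have hI2 : Integrable (fun z : Fin D → ℝ => 96 * C * (∑ j, (w j * σ j) * z j)) γ :=
    ((memLp_linear D fun j => w j * σ j).integrable (by norm_num)).const_mul _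
  have hI12 : Integrable (fun z : Fin D → ℝ => 48 * C * (∑ j, σ j ^ 2 * z j ^ 2)
      + 96 * C * (∑ j, (w j * σ j) * z j)) γ := hI1.add hI2
  have hI3 : Integrable (fun z : Fin D → ℝ => 48 * C * (∑ j, σ j ^ 2 * z j ^ 2)
      + 96 * C * (∑ j, (w j * σ j) * z j) + 48 * C * ∑ j, w j ^ 2) γ :=
    hI12.add (integrable_const _)
  have hvint : Integrable (fun z => v (z + m)) γ := by
    simp only [hvadd]
    exact (integrable_const _).add hI3
  have hvI : ∫ z, v (z + m) ∂γ = 48 * (F + C * (∑ j, w j ^ 2 + ∑ j, σ j ^ 2)) := by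
    simp only [hvadd]
    rw [integral_add (integrable_const _) hI3, integral_add hI12 (integrable_const _),
      integral_add hI1 hI2, integral_const_mul (48 * C), integral_const_mul (96 * C),
      integral_linear,
      integral_finsetSum _ fun j _ => (integrable_coord_sq D j).const_mul _]
    simp only [integral_const_mul, γ, integral_coord_sq]
    simp
    ring
  have hclsum : Integrable (fun z => ∑ i, clipLog (Y (x i) (z + m))) γ :=
    integrable_finsetSum _ fun i _ => hcl (x i)
  have hΦint : Integrable (fun z => Φ x (z + m)) γ := by
    simp only [hΦ]
    exact hclsum.sub (hvint.const_mul _)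
  have hJ := exp_integral_translate_le (Φ x) (hΦm.comp (measurable_const.prodMk measurable_id))
    (hΦle x) m hΦint
  have hJ' := Real.exp_lt_exp.1 (hJ.trans_lt hx1)
  have hΦI : ∫ z, Φ x (z + m) ∂γ = ∑ i, ∫ z, clipLog (Y (x i) (z + m)) ∂γ
      - N * (48 * (F + C * (∑ j, w j ^ 2 + ∑ j, σ j ^ 2))) := by
    simp only [hΦ]
    rw [integral_sub hclsum (hvint.const_mul _), integral_finsetSum _ fun i _ => hcl (x i),
      integral_const_mul, hvI]
  have hlow : ∑ i, min (-(f (x i) + ∑ j, w j * ψ j (x i))) 1 - 2 * ∑ i, min (g (x i)) 1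
      ≤ ∑ i, ∫ z, clipLog (Y (x i) (z + m)) ∂γ := by
    rw [Finset.mul_sum, ← Finset.sum_sub_distrib]
    refine Finset.sum_le_sum fun i _ => ?_
    simp only [hYadd]
    exact integral_clipLog_ge _ _
  have hN : 2 * (N : ℝ) * ∫ x, g x ∂Q ≤ 2 * N * (C * ∑ j, σ j ^ 2) := by gcongr
  change ∫ z, Φ x (z + m) ∂γ - 1 / 2 * ∑ i, m i ^ 2 < t at hJ'
  rw [hΦI] at hJ'
  simp only [hm] at hJ'
  linarith

/-! ### Simultaneous diagonalization -/

/-- A family of positive numbers with finite superlevel sets can be arranged in decreasing order. -/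
theorem exists_antitone_enumeration {ι : Type*} [Infinite ι] (t : ι → ℝ) (ht : ∀ i, 0 < t i)
    (hfin : ∀ ε : ℝ, 0 < ε → {i | ε ≤ t i}.Finite) :
    ∃ e : ℕ ≃ ι, Antitone (t ∘ e) ∧ Tendsto (t ∘ e) atTop (𝓝 0) := by
  classical
  have hcount : Countable ι := by
    have hU : (Set.univ : Set ι) = ⋃ n : ℕ, {i | 1 / ((n : ℝ) + 1) ≤ t i} := by
      ext i
      obtain ⟨n, hn⟩ := exists_nat_one_div_lt (ht i)
      simp only [Set.mem_univ, Set.mem_iUnion, true_iff]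
      exact ⟨n, hn.le⟩
    rw [← Set.countable_univ_iff, hU]
    exact Set.countable_iUnion fun n => (hfin _ (by positivity)).countable
  obtain ⟨c, hc⟩ := exists_injective_nat ι
  -- The rank of `i` counts the indices before it. Breaking ties by the injection `c` makes the
  -- ranks distinct, and their infinite set is order isomorphic to `ℕ`.
  let before : ι → Set ι := fun i => {j | t i < t j ∨ t j = t i ∧ c j < c i}
  have hbf : ∀ i, (before i).Finite := fun i => (hfin _ (ht i)).subset fun j hj => by
    rcases hj with h | h
    · exact h.le
    · exact h.1.ge
  let r : ι → ℕ := fun i => (hbf i).toFinset.card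
  have hlt : ∀ i j, j ∈ before i → r j < r i := by
    intro i j hj
    refine Finset.card_lt_card ⟨fun k hk => ?_, fun hsub => ?_⟩
    · rw [Set.Finite.mem_toFinset] at hk ⊢
      rcases hk with h | h <;> rcases hj with h' | h'
      · exact Or.inl (h'.trans h)
      · exact Or.inl (h'.1 ▸ h)
      · exact Or.inl (h.1.symm ▸ h')
      · exact Or.inr ⟨h.1.trans h'.1, h.2.trans h'.2⟩
    · have := hsub ((Set.Finite.mem_toFinset _).2 hj)
      rw [Set.Finite.mem_toFinset] at this
      rcases this with h | h
      · exact lt_irrefl _ h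
      · exact lt_irrefl _ h.2
  have htri : ∀ i j, i ≠ j → j ∈ before i ∨ i ∈ before j := by
    intro i j hij
    rcases lt_trichotomy (t i) (t j) with h | h | h
    · exact Or.inl (Or.inl h)
    · rcases lt_trichotomy (c i) (c j) with h' | h' | h'
      · exact Or.inr (Or.inr ⟨h, h'⟩)
      · exact absurd (hc h') hij
      · exact Or.inl (Or.inr ⟨h.symm, h'⟩)
    · exact Or.inr (Or.inl h)
  have hrinj : Function.Injective r := by
    intro i j hij
    by_contra hne
    rcases htri i j hne with h | h
    · exact absurd (hlt _ _ h) (by omega)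
    · exact absurd (hlt _ _ h) (by omega)
  have hmono : ∀ i j, r i ≤ r j → t j ≤ t i := by
    intro i j hij
    by_contra hne
    push Not at hne
    exact absurd (hlt i j (Or.inl hne)) (by omega)
  have : Infinite (Set.range r) := Set.infinite_coe_iff.2 (Set.infinite_range_of_injective hrinj)
  let e : ℕ ≃ ι := (Nat.Subtype.orderIsoOfNat (Set.range r)).toEquiv.trans
    (Equiv.ofInjective r hrinj).symm
  have hre : ∀ k, r (e k) = (Nat.Subtype.orderIsoOfNat (Set.range r) k : ℕ) := by
    intro k
    have := Equiv.apply_ofInjective_symm hrinj (Nat.Subtype.orderIsoOfNat (Set.range r) k)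
    exact this
  have hanti : Antitone (t ∘ e) := by
    intro a b hab
    refine hmono _ _ ?_
    rw [hre, hre]
    exact (Nat.Subtype.orderIsoOfNat (Set.range r)).monotone hab
  refine ⟨e, hanti, ?_⟩
  rw [Metric.tendsto_atTop]
  intro ε hε
  have hpre : (e ⁻¹' {i | ε ≤ t i}).Finite := (hfin ε hε).preimage e.injective.injOn
  obtain ⟨K, hK⟩ := hpre.bddAbove
  refine ⟨K + 1, fun k hk => ?_⟩
  rw [Real.dist_eq, sub_zero, Function.comp_apply, abs_of_pos (ht _)]
  by_contra hcon
  push Not at hcon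
  have := hK (show k ∈ e ⁻¹' {i | ε ≤ t i} from hcon)
  omega

section Diagonalization

variable {E : Type*} [NormedAddCommGroup E] [InnerProductSpace ℝ E] [CompleteSpace E]

local notation "⟪" x ", " y "⟫" => inner ℝ x y

/-- A positive form that is small on subspaces of finite codimension is given by a compact
operator. -/
theorem isCompactOperator_of_small_on_cofinite (T : E →L[ℝ] E)
    (hsymm : ∀ x y, ⟪T x, y⟫ = ⟪x, T y⟫) (hpos : ∀ x, 0 ≤ ⟪T x, x⟫)
    (hcc : ∀ ε : ℝ, 0 < ε → ∃ S : Submodule ℝ E, FiniteDimensional ℝ S ∧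
      ∀ x ∈ Sᗮ, ⟪T x, x⟫ ≤ ε * ‖x‖ ^ 2) : IsCompactOperator T := by
  have hmem : T ∈ closure {A : E →L[ℝ] E | IsCompactOperator A} := by
    rw [Metric.mem_closure_iff]
    intro ε hε
    -- A bound `δ` for the form on a subspace becomes a bound `√(δ ‖T‖)` for the norm of `T y`; this
    -- is at most `ε / 2`.
    set δ := (ε / 2) ^ 2 / (‖T‖ + 1) with hδ
    have hδ0 : 0 < δ := by positivity
    obtain ⟨S, hS, hS'⟩ := hcc δ hδ0
    refine ⟨T ∘L (S.subtypeL ∘L S.orthogonalProjectionOnto), ?_, ?_⟩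
    · have : ProperSpace S := FiniteDimensional.proper_real S
      have h0 : IsCompactOperator (id : S → S) := isCompactOperator_id
      have h1 := h0.clm_comp (T ∘L S.subtypeL)
      exact h1.comp_clm S.orthogonalProjectionOnto
    · rw [dist_eq_norm]
      refine lt_of_le_of_lt (ContinuousLinearMap.opNorm_le_bound _ (M := ε / 2) (by positivity)
        fun x => ?_) (by linarith)
      set y := x - (S.orthogonalProjectionOnto x : E) with hy
      have hyS : y ∈ Sᗮ := S.sub_starProjection_mem_orthogonal x
      have hyx : ‖y‖ ≤ ‖x‖ := by
        have h := S.norm_sq_eq_add_norm_sq_projection x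
        have h2 : (Sᗮ.orthogonalProjectionOnto x : E) = y := by
          have := S.starProjection_add_starProjection_orthogonal x
          rw [hy, eq_sub_iff_add_eq, add_comm]
          exact this
        have h3 : ‖y‖ = ‖Sᗮ.orthogonalProjectionOnto x‖ := by rw [← h2]; rfl
        rw [h3]
        exact le_of_sq_le_sq (by nlinarith [sq_nonneg ‖S.orthogonalProjectionOnto x‖]) (norm_nonneg _)
      have hTy : (T - T ∘L (S.subtypeL ∘L S.orthogonalProjectionOnto)) x = T y := by
        simp [hy]
      rw [hTy]
      -- Cauchy–Schwarz for the form of `T`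
      have hCS : ⟪T y, T y⟫ ^ 2 ≤ ⟪T y, y⟫ * ⟪T (T y), T y⟫ := by
        have h : ∀ s : ℝ, 0 ≤ ⟪T (T y), T y⟫ * (s * s) + (2 * ⟪T y, T y⟫) * s + ⟪T y, y⟫ := by
          intro s
          have := hpos (y + s • T y)
          have h5 : ⟪T (T y), y⟫ = ⟪T y, T y⟫ := hsymm _ _
          simp only [map_add, map_smul, inner_add_left, inner_add_right, inner_smul_left,
            inner_smul_right, h5] at this
          simp only [conj_trivial] at this
          linarith
        have := discrim_le_zero h
        unfold discrim at this
        nlinarith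
      have h1 := hS' y hyS
      have h2 : ⟪T (T y), T y⟫ ≤ ‖T‖ * ‖T y‖ ^ 2 := by
        calc ⟪T (T y), T y⟫ ≤ ‖T (T y)‖ * ‖T y‖ := real_inner_le_norm _ _
          _ ≤ (‖T‖ * ‖T y‖) * ‖T y‖ := by gcongr; exact T.le_opNorm _
          _ = _ := by ring
      rw [real_inner_self_eq_norm_sq] at hCS
      rcases (norm_nonneg (T y)).eq_or_lt with h0 | h0
      · rw [← h0]; positivity
      have h3 : ‖T y‖ ^ 2 ≤ δ * ‖T‖ * ‖y‖ ^ 2 := by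
        have h4 : (‖T y‖ ^ 2) * (‖T y‖ ^ 2) ≤ (δ * ‖T‖ * ‖y‖ ^ 2) * (‖T y‖ ^ 2) := by
          calc (‖T y‖ ^ 2) * (‖T y‖ ^ 2) = (‖T y‖ ^ 2) ^ 2 := by ring
            _ ≤ ⟪T y, y⟫ * ⟪T (T y), T y⟫ := hCS
            _ ≤ (δ * ‖y‖ ^ 2) * (‖T‖ * ‖T y‖ ^ 2) :=
              mul_le_mul h1 h2 (hpos _) (by positivity)
            _ = _ := by ring
        exact le_of_mul_le_mul_right h4 (by positivity)
      have h5 : δ * ‖T‖ ≤ (ε / 2) ^ 2 := by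
        rw [hδ, div_mul_eq_mul_div, div_le_iff₀ (by positivity)]
        nlinarith [sq_nonneg (ε / 2), norm_nonneg T]
      refine le_of_sq_le_sq ?_ (by positivity)
      calc ‖T y‖ ^ 2 ≤ δ * ‖T‖ * ‖y‖ ^ 2 := h3
        _ ≤ (ε / 2) ^ 2 * ‖x‖ ^ 2 := by gcongr
        _ = _ := by ring
  rwa [(isClosed_setOfPred_isCompactOperator (σ₁₂ := RingHom.id ℝ) (M₁ := E) (M₂ := E)).closure_eq]
    at hmem

/-- Spectral theorem for compact self-adjoint operators. Strict positivity excludes the eigenvalue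
zero, so all eigenspaces are finite-dimensional. Smallness on subspaces of finite codimension is
used twice: it gives compactness, and it leaves only finitely many eigenvalues above each positive
level, so that they can be listed in decreasing order. -/
theorem exists_hilbertBasis_eigenvectors (hinf : ¬ FiniteDimensional ℝ E) (T : E →L[ℝ] E)
    (hsymm : ∀ x y, ⟪T x, y⟫ = ⟪x, T y⟫) (hpos : ∀ x, x ≠ 0 → 0 < ⟪T x, x⟫)
    (hcc : ∀ ε : ℝ, 0 < ε → ∃ S : Submodule ℝ E, FiniteDimensional ℝ S ∧
      ∀ x ∈ Sᗮ, ⟪T x, x⟫ ≤ ε * ‖x‖ ^ 2) :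
    ∃ (b : HilbertBasis ℕ ℝ E) (t : ℕ → ℝ), (∀ i, 0 < t i) ∧ Antitone t ∧
      Tendsto t atTop (𝓝 0) ∧ ∀ i, T (b i) = t i • b i := by
  have hpos' : ∀ x, 0 ≤ ⟪T x, x⟫ := fun x => by
    by_cases hx : x = 0
    · simp [hx]
    · exact (hpos x hx).le
  have hT := isCompactOperator_of_small_on_cofinite T hsymm hpos' hcc
  have hTs : (T : E →ₗ[ℝ] E).IsSymmetric := fun x y => hsymm x y
  have hbot := ContinuousLinearMap.orthogonalComplement_iSup_eigenspaces_eq_bot hT hTs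
  have hfam := hTs.orthogonalFamily_eigenspaces
  have hfd : ∀ μ : ℝ, FiniteDimensional ℝ (Module.End.eigenspace (T : Module.End ℝ E) μ) := by
    intro μ
    by_cases hμ : μ = 0
    · have : Module.End.eigenspace (T : Module.End ℝ E) μ = ⊥ := by
        rw [Submodule.eq_bot_iff]
        intro x hx
        by_contra hx0
        have h := hpos x hx0
        rw [Module.End.mem_eigenspace_iff] at hx
        have hx' : T x = μ • x := hx
        rw [hx', hμ] at h
        simp at h
      rw [this]; infer_instance
    · exact ContinuousLinearMap.finite_dimensional_eigenspace hT μ hμ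
  let w : ∀ μ : ℝ, OrthonormalBasis _ ℝ (Module.End.eigenspace (T : Module.End ℝ E) μ) :=
    fun μ => stdOrthonormalBasis ℝ _
  let ι := Σ μ : ℝ, Fin (Module.finrank ℝ (Module.End.eigenspace (T : Module.End ℝ E) μ))
  let v : ι → E := fun i => w i.1 i.2
  have hv : Orthonormal ℝ v := hfam.orthonormal_sigma_orthonormal fun μ => (w μ).orthonormal
  have hspan : (Submodule.span ℝ (Set.range v))ᗮ = ⊥ := by
    rw [eq_bot_iff, ← hbot]
    refine Submodule.orthogonal_le (iSup_le fun μ x hx => ?_)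
    have h1 : (⟨x, hx⟩ : Module.End.eigenspace (T : Module.End ℝ E) μ)
        = ∑ i, (w μ).repr ⟨x, hx⟩ i • w μ i := ((w μ).sum_repr _).symm
    have h2 : x = ∑ i, (w μ).repr ⟨x, hx⟩ i • v ⟨μ, i⟩ := by
      have := congrArg Subtype.val h1
      simpa using this
    rw [h2]
    exact Submodule.sum_mem _ fun i _ => Submodule.smul_mem _ _ (Submodule.subset_span ⟨_, rfl⟩)
  have hTv : ∀ i, T (v i) = i.1 • v i := fun i =>
    Module.End.mem_eigenspace_iff.1 (w i.1 i.2).2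
  let b₀ := HilbertBasis.mkOfOrthogonalEqBot hv hspan
  have ht : ∀ i : ι, 0 < i.1 := by
    intro i
    have h := hpos (v i) (hv.ne_zero i)
    rw [hTv, inner_smul_left, real_inner_self_eq_norm_sq, hv.1 i] at h
    simpa using h
  have hinfι : Infinite ι := by
    by_contra hfinι
    rw [not_infinite_iff_finite] at hfinι
    apply hinf
    have hfr : FiniteDimensional ℝ (Submodule.span ℝ (Set.range v)) :=
      FiniteDimensional.span_of_finite ℝ (Set.finite_range v)
    have htop : Submodule.span ℝ (Set.range v) = ⊤ := by
      rwa [Submodule.orthogonal_eq_bot_iff] at hspan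
    rw [htop] at hfr
    exact Module.finite_def.2 (Module.finite_def.1 hfr |> fun h => by
      simpa using (Submodule.fg_top (⊤ : Submodule ℝ E)).1 h)
  have hfin : ∀ ε : ℝ, 0 < ε → {i : ι | ε ≤ i.1}.Finite := by
    intro ε hε
    obtain ⟨S, hS, hS'⟩ := hcc (ε / 2) (by positivity)
    by_contra hinfin
    have hinfin : {i : ι | ε ≤ i.1}.Infinite := hinfin
    -- With one eigenvector more than the dimension of `S`, some nonzero combination is orthogonal
    -- to `S`. There the form is at most `ε / 2` times the squared norm, while the eigenvalues are
    -- at least `ε`.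
    obtain ⟨s, hs, hcard⟩ := hinfin.exists_subset_card_eq (Module.finrank ℝ S + 1)
    let A : (s → ℝ) →ₗ[ℝ] S := S.orthogonalProjectionOnto.toLinearMap ∘ₗ
      Fintype.linearCombination ℝ (fun i : s => v i)
    have hker : LinearMap.ker A ≠ ⊥ := by
      apply LinearMap.ker_ne_bot_of_finrank_lt
      simp [hcard]
    obtain ⟨z, hz, hz0⟩ := (Submodule.ne_bot_iff _).1 hker
    set x := Fintype.linearCombination ℝ (fun i : s => v i) z with hx
    have hxS : x ∈ Sᗮ := by
      rw [← Submodule.orthogonalProjectionOnto_eq_zero_iff]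
      exact hz
    have hvs : Orthonormal ℝ fun i : s => v i := hv.comp _ Subtype.val_injective
    have hxe : x = ∑ i : s, z i • v i := by
      rw [hx, Fintype.linearCombination_apply]
    have hn : ‖x‖ ^ 2 = ∑ i : s, z i ^ 2 := by
      rw [← real_inner_self_eq_norm_sq, hxe, hvs.inner_sum]
      simp [sq]
    have hTx : ⟪T x, x⟫ = ∑ i : s, i.1.1 * z i ^ 2 := by
      have : T x = ∑ i : s, (i.1.1 * z i) • v i := by
        rw [hxe, map_sum]
        refine Finset.sum_congr rfl fun i _ => ?_
        rw [map_smul, hTv, smul_smul, mul_comm]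
      rw [this, hxe, hvs.inner_sum]
      simp only [conj_trivial]
      exact Finset.sum_congr rfl fun i _ => by ring
    have h1 := hS' x hxS
    rw [hTx, hn, Finset.mul_sum] at h1
    have h2 : ∑ i : s, ε * z i ^ 2 ≤ ∑ i : s, i.1.1 * z i ^ 2 :=
      Finset.sum_le_sum fun i _ => mul_le_mul_of_nonneg_right (hs i.2) (sq_nonneg _)
    have h3 : 0 < ∑ i : s, z i ^ 2 := by
      obtain ⟨i, hi⟩ := Function.ne_iff.1 hz0
      exact Finset.sum_pos' (fun i _ => sq_nonneg _) ⟨i, Finset.mem_univ _, by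
        have : z i ≠ 0 := hi
        positivity⟩
    rw [← Finset.mul_sum] at h1 h2
    nlinarith
  obtain ⟨e, he1, he2⟩ := exists_antitone_enumeration (fun i : ι => i.1) ht hfin
  have hve : Orthonormal ℝ (v ∘ e) := hv.comp _ e.injective
  have hrange : Set.range (v ∘ e) = Set.range v := e.surjective.range_comp v
  refine ⟨HilbertBasis.mkOfOrthogonalEqBot hve (by rw [hrange]; exact hspan), fun i => (e i).1,
    fun i => ht _, he1, he2, fun i => ?_⟩
  rw [HilbertBasis.coe_mkOfOrthogonalEqBot]
  exact hTv (e i)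

end Diagonalization

section Renorm

variable {H : Type*} [AddCommGroup H] [Module ℝ H]

/-- A copy of `H` that carries the inner product `c`. -/
def WithCore (_c : InnerProductSpace.Core ℝ H) : Type _ := H

instance (c : InnerProductSpace.Core ℝ H) : NormedAddCommGroup (WithCore c) :=
  @InnerProductSpace.Core.toNormedAddCommGroup ℝ H _ _ _ c

instance (c : InnerProductSpace.Core ℝ H) : InnerProductSpace ℝ (WithCore c) :=
  @InnerProductSpace.ofCore ℝ H _ _ _ c.toCore

/-- The identity as a linear equivalence onto the copy with inner product `c`. -/
def toWithCore (c : InnerProductSpace.Core ℝ H) : H ≃ₗ[ℝ] WithCore c where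
  toFun x := x
  invFun x := x
  map_add' _ _ := rfl
  map_smul' _ _ := rfl
  left_inv _ := rfl
  right_inv _ := rfl

end Renorm

/-- In the equivalent inner product `B + J` the form `B` is given by an operator `T`, which is
compact because `B ≤ ε J ≤ ε (B + J)` on common kernels. On its orthonormal eigenvectors with
eigenvalues `t i`, both forms are diagonal, with entries `t i` and `1 - t i`. Rescaling by `t i ^
(-1/2)` normalizes `B` and turns the entries of `J` into `(t i)⁻¹ - 1`, which increase to infinity.
-/
theorem exists_eigensystem_of_forms {H : Type*} [NormedAddCommGroup H] [InnerProductSpace ℝ H]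
    [CompleteSpace H] (hinf : ¬ FiniteDimensional ℝ H) (B J : H →ₗ[ℝ] H →ₗ[ℝ] ℝ)
    (hBs : ∀ x y, B x y = B y x) (hJs : ∀ x y, J x y = J y x)
    (hBpos : ∀ x, x ≠ 0 → 0 < B x x) (hJ0 : ∀ x, 0 ≤ J x x) {M₁ M₂ : ℝ} (hM₁ : 0 < M₁)
    (hM₂ : 0 < M₂)
    (hequiv : ∀ g, M₁ * ‖g‖ ^ 2 ≤ B g g + J g g ∧ B g g + J g g ≤ M₂ * ‖g‖ ^ 2)
    (hcc : ∀ ε : ℝ, 0 < ε → ∃ (N : ℕ) (φ : Fin N → H →L[ℝ] ℝ),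
      ∀ g : H, (∀ i, φ i g = 0) → B g g ≤ ε * J g g) :
    ∃ (φ : ℕ → H) (ρ : ℕ → ℝ), (∀ i j, B (φ i) (φ j) = if i = j then 1 else 0) ∧
      (∀ i j, J (φ i) (φ j) = if i = j then ρ i else 0) ∧ (∀ i, 0 ≤ ρ i) ∧ Monotone ρ ∧
      Tendsto ρ atTop atTop ∧ ∀ h : H, HasSum (fun i => B h (φ i) • φ i) h := by
  have hB0 : ∀ x, 0 ≤ B x x := fun x => by
    by_cases hx : x = 0
    · simp [hx]
    · exact (hBpos x hx).le
  let c : InnerProductSpace.Core ℝ H :=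
    { inner := fun x y => B x y + J x y
      conj_inner_symm := fun x y => by simp [hBs y x, hJs y x]
      re_inner_nonneg := fun x => by simpa using add_nonneg (hB0 x) (hJ0 x)
      add_left := fun x y z => by simp only [map_add, LinearMap.add_apply]; ring
      smul_left := fun x y r => by
        simp only [map_smul, LinearMap.smul_apply, smul_eq_mul, conj_trivial]; ring
      definite := fun x hx => by
        by_contra hne
        have := hBpos x hne
        have h2 := hJ0 x
        have h3 : B x x + J x x = 0 := hx
        linarith }
  let E := WithCore c
  have hin : ∀ x y : H, inner ℝ (toWithCore c x) (toWithCore c y) = B x y + J x y :=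
    fun x y => rfl
  have hnsq : ∀ x : H, ‖toWithCore c x‖ ^ 2 = B x x + J x x := fun x => by
    rw [← real_inner_self_eq_norm_sq, hin]
  let Φ : H ≃L[ℝ] E := (toWithCore c).toContinuousLinearEquivOfBounds (√M₂) (√M₁)⁻¹
    (fun x => by
      refine le_of_sq_le_sq ?_ (by positivity)
      rw [hnsq, mul_pow, Real.sq_sqrt hM₂.le]
      exact (hequiv x).2)
    (fun x => by
      obtain ⟨y, rfl⟩ := (toWithCore c).surjective x
      rw [LinearEquiv.symm_apply_apply, inv_mul_eq_div, le_div_iff₀ (by positivity)]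
      refine le_of_sq_le_sq ?_ (norm_nonneg _)
      rw [hnsq, mul_pow, Real.sq_sqrt hM₁.le, mul_comm]
      exact (hequiv y).1)
  have hΦ : ∀ x, Φ x = toWithCore c x := fun x => rfl
  have : CompleteSpace E := (completeSpace_congr (e := Φ.toEquiv) Φ.isUniformEmbedding).1 inferInstance
  have hEinf : ¬ FiniteDimensional ℝ E := fun h =>
    hinf (LinearEquiv.finiteDimensional (toWithCore c).symm)
  let Bs : LinearMap.BilinForm ℝ H := B
  have hCS : ∀ x y : H, |B x y| ≤ ‖Φ x‖ * ‖Φ y‖ := by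
    intro x y
    have h := LinearMap.BilinForm.apply_sq_le_of_symm Bs hB0 ⟨fun x y => by simpa using hBs x y⟩ x y
    refine abs_le_of_sq_le_sq ?_ (by positivity)
    calc B x y ^ 2 ≤ B x x * B y y := h
      _ ≤ ‖Φ x‖ ^ 2 * ‖Φ y‖ ^ 2 := by
        rw [hΦ, hΦ, hnsq, hnsq]
        exact mul_le_mul (by linarith [hJ0 x]) (by linarith [hJ0 y]) (hB0 y)
          (add_nonneg (hB0 x) (hJ0 x))
      _ = _ := by ring
  let B' : E →L[ℝ] E →L[ℝ] ℝ := LinearMap.mkContinuous₂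
    (B.compl₁₂ (toWithCore c).symm.toLinearMap (toWithCore c).symm.toLinearMap) 1 (by
      intro x y
      obtain ⟨x, rfl⟩ := (toWithCore c).surjective x
      obtain ⟨y, rfl⟩ := (toWithCore c).surjective y
      simpa [hΦ] using hCS x y)
  have hB' : ∀ x y : H, B' (Φ x) (Φ y) = B x y := fun x y => rfl
  let T : E →L[ℝ] E := InnerProductSpace.continuousLinearMapOfBilin B'
  have hT : ∀ x y : H, inner ℝ (T (Φ x)) (Φ y) = B x y := fun x y => by
    rw [← hB']
    exact InnerProductSpace.continuousLinearMapOfBilin_apply B' (Φ x) (Φ y)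
  obtain ⟨b, t, ht0, hanti, htend, hTb⟩ := exists_hilbertBasis_eigenvectors hEinf T
    (fun x y => by
      obtain ⟨x, rfl⟩ := Φ.surjective x
      obtain ⟨y, rfl⟩ := Φ.surjective y
      rw [hT, real_inner_comm, hT, hBs])
    (fun x hx => by
      obtain ⟨x, rfl⟩ := Φ.surjective x
      rw [hT]
      exact hBpos x fun h => hx (by rw [h, map_zero]))
    (fun ε hε => by
      obtain ⟨N, φ, hφ⟩ := hcc ε hε
      -- Riesz representatives for the new inner product, so that the common kernel is an orthogonal
      -- complement.
      let u : Fin N → E := fun i =>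
        (InnerProductSpace.toDual ℝ E).symm ((φ i).comp (Φ.symm : E →L[ℝ] H))
      refine ⟨Submodule.span ℝ (Set.range u),
        FiniteDimensional.span_of_finite ℝ (Set.finite_range u), fun x hx => ?_⟩
      obtain ⟨x, rfl⟩ := Φ.surjective x
      have h0 : ∀ i, φ i x = 0 := fun i => by
        have h := hx (u i) (Submodule.subset_span ⟨i, rfl⟩)
        simpa [u] using h
      rw [hT, hΦ, hnsq]
      have := hφ x h0
      nlinarith [hB0 x])
  -- transport back
  set e : ℕ → H := fun i => Φ.symm (b i) with he
  have hΦe : ∀ i, Φ (e i) = b i := fun i => Φ.apply_symm_apply _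
  have hBe : ∀ i x, B (e i) x = t i * inner ℝ (b i) (Φ x) := by
    intro i x
    rw [← hT, hΦe, hTb, inner_smul_left, conj_trivial]
  have hbb : ∀ i j, inner ℝ (b i) (b j) = if i = j then (1 : ℝ) else 0 :=
    orthonormal_iff_ite.1 b.orthonormal
  have hBee : ∀ i j, B (e i) (e j) = if i = j then t i else 0 := by
    intro i j
    rw [hBe, hΦe, hbb]
    split_ifs <;> simp
  have hJee : ∀ i j, J (e i) (e j) = if i = j then 1 - t i else 0 := by
    intro i j
    have h1 : B (e i) (e j) + J (e i) (e j) = if i = j then 1 else 0 := by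
      rw [← hin, ← hΦ, ← hΦ, hΦe, hΦe, hbb]
    rw [hBee] at h1
    split_ifs at h1 ⊢ <;> linarith
  have ht1 : ∀ i, t i ≤ 1 := fun i => by
    have h := hJ0 (e i)
    rw [hJee, if_pos rfl] at h
    linarith
  have hsq : ∀ i, (√(t i))⁻¹ * (√(t i))⁻¹ = (t i)⁻¹ := fun i => by
    rw [← mul_inv, Real.mul_self_sqrt (ht0 i).le]
  refine ⟨fun i => (√(t i))⁻¹ • e i, fun i => (t i)⁻¹ - 1, fun i j => ?_, fun i j => ?_,
    fun i => ?_, fun i j hij => ?_, ?_, fun h => ?_⟩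
  · simp only [map_smul, LinearMap.smul_apply, smul_eq_mul, hBee]
    split_ifs with hij
    · subst hij
      rw [← mul_assoc, hsq, inv_mul_cancel₀ (ht0 i).ne']
    · simp
  · simp only [map_smul, LinearMap.smul_apply, smul_eq_mul, hJee]
    split_ifs with hij
    · subst hij
      rw [← mul_assoc, hsq, mul_sub, inv_mul_cancel₀ (ht0 i).ne', mul_one]
    · simp
  · exact sub_nonneg.2 ((one_le_inv₀ (ht0 i)).2 (ht1 i))
  · exact sub_le_sub_right ((inv_le_inv₀ (ht0 i) (ht0 j)).2 (hanti hij)) _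
  · refine tendsto_atTop_add_const_right _ _ (Tendsto.inv_tendsto_nhdsGT_zero ?_)
    exact tendsto_nhdsWithin_iff.2 ⟨htend, Eventually.of_forall fun i => ht0 i⟩
  · have h1 := (b.hasSum_repr (Φ h)).mapL (Φ.symm : E →L[ℝ] H)
    convert h1 using 1
    · ext i
      have h2 : B h (e i) = t i * inner ℝ (b i) (Φ h) := by rw [hBs, hBe]
      simp only [map_smul, b.repr_apply_apply, smul_eq_mul, smul_smul, h2]
      have h3 : (Φ.symm : E →L[ℝ] H) (b i) = e i := rfl
      rw [h3]
      congr 1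
      calc (√(t i))⁻¹ * (t i * inner ℝ (b i) (Φ h)) * (√(t i))⁻¹
          = ((√(t i))⁻¹ * (√(t i))⁻¹) * t i * inner ℝ (b i) (Φ h) := by ring
        _ = _ := by rw [hsq, inv_mul_cancel₀ (ht0 i).ne', one_mul]
    · simp

/-! ### Mean-zero functions in `L²`: covariance as inner product -/

theorem integral_L20 {X : Type u} [MeasurableSpace X] (P : Measure X) [IsFiniteMeasure P]
    (f : L20 P) : ∫ x, ((f : Lp ℝ 2 P) : X → ℝ) x ∂P = 0 := by
  have h := f.2 (Lp.const 2 P (1 : ℝ)) (Submodule.mem_span_singleton_self _)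
  rw [L2.inner_def] at h
  rw [← h]
  refine integral_congr_ae ?_
  filter_upwards [Lp.coeFn_const (p := 2) (μ := P) (1 : ℝ)] with x hx
  rw [hx]
  simp

theorem memLp_L2 {X : Type u} [MeasurableSpace X] {P : Measure X} (f : Lp ℝ 2 P) :
    MemLp (f : X → ℝ) 2 P := Lp.memLp f

theorem inner_eq_integral_mul {X : Type u} [MeasurableSpace X] {P : Measure X} (f g : Lp ℝ 2 P) :
    inner ℝ f g = ∫ x, f x * g x ∂P := by
  rw [L2.inner_def]
  refine integral_congr_ae (ae_of_all _ fun x => ?_)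
  simp [mul_comm]

theorem norm_sq_eq_integral {X : Type u} [MeasurableSpace X] {P : Measure X} (f : Lp ℝ 2 P) :
    ‖f‖ ^ 2 = ∫ x, f x ^ 2 ∂P := by
  rw [← real_inner_self_eq_norm_sq, inner_eq_integral_mul]
  simp [sq]

theorem covariance_L20 {X : Type u} [MeasurableSpace X] (P : Measure X) [IsProbabilityMeasure P]
    {f g : Lp ℝ 2 P} (hf : f ∈ L20 P) (hg : g ∈ L20 P) :
    cov[f, g; P] = inner ℝ f g := by
  rw [covariance_eq_sub (memLp_L2 f) (memLp_L2 g), integral_L20 P ⟨f, hf⟩, integral_L20 P ⟨g, hg⟩,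
    inner_eq_integral_mul]
  simp

/-! ### The quadratic forms of the model -/

namespace Model

variable {p m : ℕ} {X : Fin m → Type u} [∀ l, MeasurableSpace (X l)]
  {H : Type v} [NormedAddCommGroup H] [InnerProductSpace ℝ H] {M : Model p m X H}

/-- `L_{l,θ} ζ + L_{l,h} g` as a bounded operator in `v = (ζ, g)`. -/
def Ops.map (L : M.Ops) (l : Fin m) : Param p H →L[ℝ] Lp ℝ 2 (M.law l M.τ₀) :=
  (L20 (M.law l M.τ₀)).subtypeL ∘L
    ((L.Lθ l) ∘L ContinuousLinearMap.fst ℝ _ _ + (L.Lh l) ∘L ContinuousLinearMap.snd ℝ _ _)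

theorem Ops.map_mem (L : M.Ops) (l : Fin m) (v : Param p H) : L.map l v ∈ L20 (M.law l M.τ₀) :=
  (L.Lθ l v.1 + L.Lh l v.2).2

/-- The quadratic form `∑_l V_{l,τ₀}(L_{l,θ} ζ + L_{l,h} g)`. -/
def Ops.q (L : M.Ops) (v : Param p H) : ℝ := ∑ l, ‖L.map l v‖ ^ 2

theorem V_eq_sum_inner [∀ l, IsProbabilityMeasure (M.law l M.τ₀)]
    {f g : ∀ l, Lp ℝ 2 (M.law l M.τ₀)} (hf : ∀ l, f l ∈ L20 (M.law l M.τ₀))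
    (hg : ∀ l, g l ∈ L20 (M.law l M.τ₀)) :
    M.V M.τ₀ (fun l => (f l : X l → ℝ)) (fun l => (g l : X l → ℝ)) = ∑ l, inner ℝ (f l) (g l) :=
  Finset.sum_congr rfl fun l _ => covariance_L20 _ (hf l) (hg l)

theorem Ops.q_nonneg (L : M.Ops) (v : Param p H) : 0 ≤ L.q v :=
  Finset.sum_nonneg fun _ _ => sq_nonneg _

theorem Ops.q_smul (L : M.Ops) (c : ℝ) (v : Param p H) : L.q (c • v) = c ^ 2 * L.q v := by
  simp only [Ops.q, map_smul, norm_smul, mul_pow, Finset.mul_sum, Real.norm_eq_abs, sq_abs]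

theorem Ops.q_add_le (L : M.Ops) (v w : Param p H) : L.q (v + w) ≤ 2 * L.q v + 2 * L.q w := by
  simp only [Ops.q, Finset.mul_sum, ← Finset.sum_add_distrib]
  refine Finset.sum_le_sum fun l _ => ?_
  rw [map_add]
  have h := norm_add_le (L.map l v) (L.map l w)
  nlinarith [sq_nonneg (‖L.map l v‖ - ‖L.map l w‖), norm_nonneg (L.map l v + L.map l w),
    norm_nonneg (L.map l v), norm_nonneg (L.map l w)]

section forms

variable [∀ l, IsProbabilityMeasure (M.law l M.τ₀)] (L : M.Ops)

theorem Ops.V_app (v w : Param p H) :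
    M.V M.τ₀ (L.app v) (L.app w) = ∑ l, inner ℝ (L.map l v) (L.map l w) :=
  V_eq_sum_inner (fun l => L.map_mem l v) (fun l => L.map_mem l w)

theorem Ops.V_app_self (v : Param p H) : M.V M.τ₀ (L.app v) (L.app v) = L.q v := by
  rw [Ops.V_app, Ops.q]
  simp only [real_inner_self_eq_norm_sq]

/-- `VH` as a bilinear form. -/
def Ops.formH : H →ₗ[ℝ] H →ₗ[ℝ] ℝ := LinearMap.mk₂ ℝ (fun g₁ g₂ => L.VH g₁ g₂)
  (fun a b c => by
    simp only [Ops.VH, Ops.V_app, ← Finset.sum_add_distrib, ← inner_add_left, ← map_add]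
    simp)
  (fun r a c => by
    simp only [Ops.VH, Ops.V_app, smul_eq_mul, Finset.mul_sum, ← real_inner_smul_left, ← map_smul]
    simp)
  (fun a b c => by
    simp only [Ops.VH, Ops.V_app, ← Finset.sum_add_distrib, ← inner_add_right, ← map_add]
    simp)
  (fun r a c => by
    simp only [Ops.VH, Ops.V_app, smul_eq_mul, Finset.mul_sum, ← real_inner_smul_right,
      ← map_smul]
    simp)

theorem Ops.formH_apply (a b : H) : L.formH a b = L.VH a b := rfl

theorem Ops.VH_comm (a b : H) : L.VH a b = L.VH b a := by
  simp only [Ops.VH, Ops.V_app]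
  exact Finset.sum_congr rfl fun l _ => real_inner_comm _ _

theorem Ops.VH_self (g : H) : L.VH g g = L.q (0, g) := L.V_app_self _

theorem Ops.VH_pos (hm : 1 ≤ m) (hL : M.NormAssumption L) {g : H} (hg : g ≠ 0) :
    0 < L.VH g g := by
  rw [Ops.VH_self]
  refine Finset.sum_pos' (fun _ _ => sq_nonneg _) ⟨⟨0, hm⟩, Finset.mem_univ _, ?_⟩
  have h : L.map ⟨0, hm⟩ (0, g) = (L.Lh ⟨0, hm⟩ g : Lp ℝ 2 (M.law ⟨0, hm⟩ M.τ₀)) := by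
    simp [Ops.map]
  rw [h]
  have h2 : L.Lh ⟨0, hm⟩ g ≠ 0 := fun h0 => hg (hL.injh _ (by rw [h0, map_zero]))
  have h3 : (L.Lh ⟨0, hm⟩ g : Lp ℝ 2 (M.law ⟨0, hm⟩ M.τ₀)) ≠ 0 := by simpa using h2
  positivity

/-- The growth assumption speaks about every eigensystem, so it carries information only once one
has been shown to exist. -/
theorem Ops.exists_isEigensystem [CompleteSpace H] (hm : 1 ≤ m) (hJ : M.PenaltyAssumption)
    (hL : M.NormAssumption L) (hcc : M.CompletelyContinuous L)
    (hinf : ¬ FiniteDimensional ℝ H) : ∃ φ ρ, M.IsEigensystem L φ ρ := by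
  obtain ⟨M₁, M₂, hM₁, hM₂, hequiv⟩ := hL.equiv 1 one_pos
  obtain ⟨φ, ρ, h1, h2, h3, h4, h5, h6⟩ := exists_eigensystem_of_forms hinf L.formH M.J
    L.VH_comm hJ.symm (fun x hx => L.VH_pos hm hL hx) hJ.nonneg hM₁ hM₂
    (fun g => by simpa [Ops.formH_apply] using hequiv g) hcc
  exact ⟨φ, ρ, h1, h2, h3, h4, h5, h6⟩

end forms

/-! ### Coordinates -/

/-- Coordinates on the parameter space in which both quadratic forms of the problem are, up to
constants, diagonal. -/
structure Coordinates (L : M.Ops) (r : ℝ) where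
  x : ℕ → Param p H →L[ℝ] ℝ
  e : ℕ → Param p H
  ρ : ℕ → ℝ
  c : ℝ
  C : ℝ
  c_pos : 0 < c
  C_pos : 0 < C
  ρ_nonneg : ∀ j, 0 ≤ ρ j
  ρ_mono : Monotone ρ
  biorthogonal : ∀ i j, x i (e j) = if i = j then 1 else 0
  hasSum : ∀ v, HasSum (fun j => x j v • e j) v
  summable : ∀ v, Summable fun j => x j v ^ 2
  lower : ∀ v, c * ∑' j, x j v ^ 2 ≤ L.q v
  upper : ∀ v, L.q v ≤ C * ∑' j, x j v ^ 2
  penalty : ∀ v : Param p H, HasSum (fun j => ρ j * x j v ^ 2) (M.J v.2 v.2)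
  trace_summable : ∀ lam : ℝ, 0 < lam → Summable fun j => (1 + lam * ρ j)⁻¹
  trace_le : ∀ lam : ℝ, 0 < lam → lam ≤ 1 → ∑' j, (1 + lam * ρ j)⁻¹ ≤ C * lam ^ (-(1 / r))

/-- `J h ·` as a bounded functional. -/
theorem exists_J_clm [∀ l, IsProbabilityMeasure (M.law l M.τ₀)] (L : M.Ops)
    (hJ : M.PenaltyAssumption) (hL : M.NormAssumption L) (h : H) :
    ∃ F : H →L[ℝ] ℝ, ∀ g, F g = M.J h g := by
  obtain ⟨M₁, M₂, hM₁, hM₂, hequiv⟩ := hL.equiv 1 one_pos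
  let B : LinearMap.BilinForm ℝ H := M.J
  refine ⟨(M.J h).mkContinuous (√(M.J h h * M₂)) fun g => ?_, fun g => rfl⟩
  have h1 := LinearMap.BilinForm.apply_sq_le_of_symm B hJ.nonneg
    ⟨fun x y => by simpa using hJ.symm x y⟩ h g
  have h2 : M.J g g ≤ M₂ * ‖g‖ ^ 2 := by
    have := (hequiv g).2
    rw [L.VH_self] at this
    linarith [L.q_nonneg (0, g)]
  rw [Real.norm_eq_abs]
  refine abs_le_of_sq_le_sq ?_ (by positivity)
  rw [mul_pow, Real.sq_sqrt (mul_nonneg (hJ.nonneg h) hM₂.le)]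
  calc (M.J h g) ^ 2 ≤ M.J h h * M.J g g := h1
    _ ≤ M.J h h * (M₂ * ‖g‖ ^ 2) := mul_le_mul_of_nonneg_left h2 (hJ.nonneg h)
    _ = _ := by ring

theorem exists_VH_clm [∀ l, IsProbabilityMeasure (M.law l M.τ₀)] (L : M.Ops) (h : H) :
    ∃ F : H →L[ℝ] ℝ, ∀ g, F g = L.VH h g := by
  refine ⟨∑ l, (innerSL ℝ (L.map l (0, h))) ∘L (L.map l) ∘L ContinuousLinearMap.inr ℝ _ _,
    fun g => ?_⟩
  rw [Ops.VH, Ops.V_app]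
  simp

section parseval

variable [∀ l, IsProbabilityMeasure (M.law l M.τ₀)] {L : M.Ops} {φ : ℕ → H} {ρ : ℕ → ℝ}

theorem IsEigensystem.hasSum_VH (hE : M.IsEigensystem L φ ρ) (g : H) :
    HasSum (fun i => L.VH g (φ i) ^ 2) (L.VH g g) := by
  obtain ⟨F, hF⟩ := exists_VH_clm L g
  have h := (hE.expansion g).mapL F
  have h2 : ∀ i, F (L.VH g (φ i) • φ i) = L.VH g (φ i) ^ 2 := fun i => by
    rw [map_smul, hF, smul_eq_mul, sq]
  simpa only [h2, hF] using h

/-- `J` is bounded for the norm of `H`, so it may be applied to the expansion term by term. Applied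
against `φ j` it gives `J(g, φ j) = ρ j * VH(g, φ j)`, and then against `g` the diagonal series. -/
theorem IsEigensystem.hasSum_J (hE : M.IsEigensystem L φ ρ) (hJ : M.PenaltyAssumption)
    (hL : M.NormAssumption L) (g : H) :
    HasSum (fun i => ρ i * L.VH g (φ i) ^ 2) (M.J g g) := by
  have h1 : ∀ j, M.J g (φ j) = ρ j * L.VH g (φ j) := by
    intro j
    obtain ⟨F, hF⟩ := exists_J_clm L hJ hL (φ j)
    have h := (hE.expansion g).mapL F
    simp only [map_smul, hF, smul_eq_mul, hE.diagonal] at h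
    have h2 := hasSum_ite_eq j (L.VH g (φ j) * ρ j)
    rw [hJ.symm, mul_comm]
    refine h.unique ?_
    convert h2 using 2 with i
    by_cases hij : i = j
    · subst hij; simp
    · rw [if_neg hij, if_neg (Ne.symm hij), mul_zero]
  obtain ⟨F, hF⟩ := exists_J_clm L hJ hL g
  have h := (hE.expansion g).mapL F
  simp only [map_smul, hF, smul_eq_mul, h1] at h
  convert h using 2 with i
  ring

end parseval

end Model

/-! ### The trace of the smoothing operator -/

/-- The right-hand side is the integral of `s ^ (-r)` over `[t, t + 1]`. The comparison reduces to
`1 - 1/x ≤ log x` and `1 + y ≤ exp y`. -/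
theorem rpow_neg_le_telescope {r t : ℝ} (hr : 1 < r) (ht : 0 < t) :
    (t + 1) ^ (-r) ≤ (t ^ (1 - r) - (t + 1) ^ (1 - r)) / (r - 1) := by
  have h1 : 1 + (r - 1) / (t + 1) ≤ ((t + 1) / t) ^ (r - 1) := by
    have hpos : 0 < (t + 1) / t := by positivity
    rw [Real.rpow_def_of_pos hpos]
    have h2 : 1 - ((t + 1) / t)⁻¹ ≤ Real.log ((t + 1) / t) := Real.one_sub_inv_le_log_of_pos hpos
    have h3 : 1 - ((t + 1) / t)⁻¹ = 1 / (t + 1) := by field_simp; ring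
    rw [h3] at h2
    have h4 : (r - 1) / (t + 1) ≤ Real.log ((t + 1) / t) * (r - 1) := by
      have := mul_le_mul_of_nonneg_right h2 (sub_nonneg.2 hr.le)
      calc (r - 1) / (t + 1) = 1 / (t + 1) * (r - 1) := by ring
        _ ≤ _ := this
    linarith [Real.add_one_le_exp (Real.log ((t + 1) / t) * (r - 1))]
  have h5 : t ^ (1 - r) = (t + 1) ^ (1 - r) * ((t + 1) / t) ^ (r - 1) := by
    rw [Real.div_rpow (by positivity) ht.le, show (1 - r) = -(r - 1) by ring,
      Real.rpow_neg ht.le, Real.rpow_neg (show (0 : ℝ) ≤ t + 1 by positivity)]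
    have : (t + 1) ^ (r - 1) ≠ 0 := (Real.rpow_pos_of_pos (by positivity) _).ne'
    field_simp
  have h6 : (t + 1) ^ (-r) = (t + 1) ^ (1 - r) / (t + 1) := by
    rw [show -r = (1 - r) - 1 by ring, Real.rpow_sub_one (by positivity)]
  rw [le_div_iff₀ (by linarith), h5, h6]
  have h7 : 0 < (t + 1) ^ (1 - r) := Real.rpow_pos_of_pos (by positivity) _
  have := mul_le_mul_of_nonneg_left h1 h7.le
  calc (t + 1) ^ (1 - r) / (t + 1) * (r - 1)
      = (t + 1) ^ (1 - r) * (1 + (r - 1) / (t + 1)) - (t + 1) ^ (1 - r) := by ring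
    _ ≤ _ := by linarith

theorem sum_rpow_neg_le {r : ℝ} (hr : 1 < r) {t : ℝ} (ht : 0 < t) (n : ℕ) :
    ∑ j ∈ Finset.range n, (t + j + 1) ^ (-r) ≤ t ^ (1 - r) / (r - 1) := by
  have h : ∑ j ∈ Finset.range n, (t + j + 1) ^ (-r)
      ≤ (t ^ (1 - r) - (t + n) ^ (1 - r)) / (r - 1) := by
    induction n with
    | zero => simp
    | succ n ih =>
      rw [Finset.sum_range_succ]
      have h1 := rpow_neg_le_telescope hr (t := t + n) (by positivity)
      push_cast
      rw [← add_assoc t]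
      calc _ ≤ (t ^ (1 - r) - (t + n) ^ (1 - r)) / (r - 1)
            + ((t + n) ^ (1 - r) - (t + n + 1) ^ (1 - r)) / (r - 1) := add_le_add ih h1
        _ = _ := by ring
  refine h.trans ?_
  have : 0 ≤ (t + n) ^ (1 - r) := (Real.rpow_pos_of_pos (by positivity) _).le
  have h0 : 0 < r - 1 := by linarith
  gcongr
  linarith

/-- The growth bound for `lam * ρ i` reaches order one near the index `d = lam ^ (-1/r)`. Up to
there each term is at most one. Beyond it the terms are at most `(lam β)⁻¹` times a power `-r` of
the index, with sum of order `lam⁻¹ d ^ (1 - r) = d`. -/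
theorem exists_trace_bound {ρ : ℕ → ℝ} (hρ : ∀ i, 0 ≤ ρ i) {β r : ℝ} (hβ : 0 < β) (hr : 1 < r)
    (hg : ∀ᶠ i : ℕ in atTop, β * ((i : ℝ) + 1) ^ r ≤ ρ i) :
    ∃ C : ℝ, 0 < C ∧ ∀ lam : ℝ, 0 < lam → lam ≤ 1 → ∀ n,
      ∑ i ∈ Finset.range n, (1 + lam * ρ i)⁻¹ ≤ C * lam ^ (-(1 / r)) := by
  obtain ⟨i₀, hi₀⟩ := eventually_atTop.1 hg
  have hr0 : 0 < r - 1 := by linarith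
  refine ⟨i₀ + 2 + 1 / (β * (r - 1)), by positivity, fun lam hlam hlam1 n => ?_⟩
  set d := lam ^ (-(1 / r)) with hd
  have hd1 : 1 ≤ d := Real.one_le_rpow_of_pos_of_le_one_of_nonpos hlam hlam1 (by
    have : 0 < 1 / r := by positivity
    linarith)
  have hd0 : 0 < d := by linarith
  set k := ⌈d⌉₊ with hk
  have hkd : d ≤ k := Nat.le_ceil d
  have hk2 : (k : ℝ) ≤ 2 * d := by
    have := Nat.ceil_lt_add_one hd0.le
    linarith
  have hterm : ∀ i, 0 ≤ (1 + lam * ρ i)⁻¹ := fun i => by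
    have := hρ i; positivity
  have hle1 : ∀ i, (1 + lam * ρ i)⁻¹ ≤ 1 := fun i => by
    refine inv_le_one_of_one_le₀ ?_
    have := mul_nonneg hlam.le (hρ i)
    linarith
  have htail : ∀ j, (1 + lam * ρ (i₀ + k + j))⁻¹ ≤ (lam * β)⁻¹ * (d + j + 1) ^ (-r) := by
    intro j
    have h1 := hi₀ (i₀ + k + j) (by omega)
    have h2 : (d + j + 1) ^ r ≤ (((i₀ + k + j : ℕ) : ℝ) + 1) ^ r := by
      refine Real.rpow_le_rpow (by positivity) ?_ (by linarith)
      push_cast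
      have : (0 : ℝ) ≤ i₀ := i₀.cast_nonneg
      linarith
    rw [Real.rpow_neg (by positivity), ← mul_inv]
    have h3 : 0 < (d + j + 1) ^ r := Real.rpow_pos_of_pos (by positivity) _
    refine inv_anti₀ (by positivity) ?_
    calc lam * β * (d + j + 1) ^ r = lam * (β * (d + j + 1) ^ r) := by ring
      _ ≤ lam * ρ (i₀ + k + j) := by gcongr; exact le_trans (by gcongr) h1
      _ ≤ _ := by linarith
  have hdr : (lam * β)⁻¹ * (d ^ (1 - r) / (r - 1)) = 1 / (β * (r - 1)) * d := by
    have h1 : d ^ (1 - r) = lam * d := by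
      rw [sub_eq_add_neg, Real.rpow_add hd0, Real.rpow_one, mul_comm]
      congr 1
      rw [hd, ← Real.rpow_mul hlam.le]
      have : -(1 / r) * -r = 1 := by field_simp
      rw [this, Real.rpow_one]
    rw [h1]
    field_simp
  calc ∑ i ∈ Finset.range n, (1 + lam * ρ i)⁻¹
      ≤ ∑ i ∈ Finset.range (i₀ + k + n), (1 + lam * ρ i)⁻¹ :=
        Finset.sum_le_sum_of_subset_of_nonneg (Finset.range_subset_range.2 (by omega))
          fun i _ _ => hterm i
    _ = ∑ i ∈ Finset.range (i₀ + k), (1 + lam * ρ i)⁻¹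
        + ∑ j ∈ Finset.range n, (1 + lam * ρ (i₀ + k + j))⁻¹ := Finset.sum_range_add _ _ _
    _ ≤ ∑ i ∈ Finset.range (i₀ + k), (1 : ℝ)
        + ∑ j ∈ Finset.range n, (lam * β)⁻¹ * (d + j + 1) ^ (-r) :=
        add_le_add (Finset.sum_le_sum fun i _ => hle1 i) (Finset.sum_le_sum fun j _ => htail j)
    _ ≤ (i₀ + k) + (lam * β)⁻¹ * (d ^ (1 - r) / (r - 1)) := by
        rw [← Finset.mul_sum]
        refine add_le_add (by simp) ?_
        exact mul_le_mul_of_nonneg_left (sum_rpow_neg_le hr hd0 n) (by positivity)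
    _ ≤ i₀ * d + 2 * d + 1 / (β * (r - 1)) * d := by
        rw [hdr]
        have : (i₀ : ℝ) ≤ i₀ * d := le_mul_of_one_le_right i₀.cast_nonneg hd1
        linarith
    _ = _ := by ring

/-! ### Existence of the coordinates -/

namespace Model

variable {p m : ℕ} {X : Fin m → Type u} [∀ l, MeasurableSpace (X l)]
  {H : Type v} [NormedAddCommGroup H] [InnerProductSpace ℝ H] {M : Model p m X H}

theorem Ops.le_q [∀ l, IsProbabilityMeasure (M.law l M.τ₀)] {L : M.Ops} {cδ : ℝ}
    (hsep : ∀ (ζ : EuclideanSpace ℝ (Fin p)) (g : H), ‖ζ‖ = 1 →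
      cδ < M.V M.τ₀ (L.app (ζ, -g)) (L.app (ζ, -g))) (v : Param p H) :
    cδ * ‖v.1‖ ^ 2 ≤ L.q v := by
  by_cases h0 : v.1 = 0
  · rw [h0]
    simpa using L.q_nonneg v
  · have hn : ‖v.1‖ ≠ 0 := norm_ne_zero_iff.2 h0
    have h := hsep (‖v.1‖⁻¹ • v.1) (-(‖v.1‖⁻¹ • v.2)) (by rw [norm_smul, norm_inv, norm_norm,
      inv_mul_cancel₀ hn])
    rw [Ops.V_app_self, neg_neg] at h
    have h2 : (‖v.1‖⁻¹ • v.1, ‖v.1‖⁻¹ • v.2) = ‖v.1‖⁻¹ • v := rfl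
    rw [h2, Ops.q_smul, inv_pow, inv_mul_eq_div, lt_div_iff₀ (by positivity)] at h
    exact h.le

theorem hasSum_shift {E : Type*} [AddCommGroup E] [TopologicalSpace E]
    [IsTopologicalAddGroup E] {f : ℕ → E} {p : ℕ} {a : E}
    (h : HasSum (fun j => f (j + p)) a) : HasSum f (∑ j : Fin p, f j + a) := by
  have := (hasSum_nat_add_iff p).1 h
  rwa [Finset.sum_range, add_comm] at this

/-- The `p` Euclidean coordinates come first, with `ρ = 0`, followed by the eigencoordinates of `H`.
The lower bound rests on separation: it controls the Euclidean part of `v` by `q v`, and then `(0,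
v.2) = v - (v.1, 0)` controls the other part. The finitely many extra coordinates add at most `p` to
the trace. -/
theorem Ops.exists_coordinates [CompleteSpace H] [∀ l, IsProbabilityMeasure (M.law l M.τ₀)]
    (L : M.Ops) (hm : 1 ≤ m) (hJ : M.PenaltyAssumption) (hL : M.NormAssumption L)
    (hcc : M.CompletelyContinuous L) {r : ℝ} (hρ : M.EigenvalueGrowth L r) :
    Nonempty (Coordinates L r) := by
  classical
  obtain ⟨φ, ρ, hE⟩ := L.exists_isEigensystem hm hJ hL hcc hρ.infinite
  obtain ⟨β₁, β₂, hβ₁, hgr⟩ := hρ.growth φ ρ hE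
  have hg : ∀ᶠ i : ℕ in atTop, β₁ * ((i : ℝ) + 1) ^ r ≤ ρ i := by
    filter_upwards [hgr] with i hi
    obtain ⟨κ, h1, -, h2⟩ := hi
    rw [h2]
    have : 0 ≤ ((i : ℝ) + 1) ^ r := by positivity
    exact mul_le_mul_of_nonneg_right h1.le this
  obtain ⟨C₀, hC₀, htr⟩ := exists_trace_bound hE.nonneg hβ₁ hρ.one_lt hg
  obtain ⟨cδ, hcδ, hsep⟩ := hL.separated
  choose F hF using fun i => exists_VH_clm L (φ i)
  let x : ℕ → Param p H →L[ℝ] ℝ := fun j =>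
    if h : j < p then (EuclideanSpace.proj ⟨j, h⟩ : EuclideanSpace ℝ (Fin p) →L[ℝ] ℝ) ∘L
      ContinuousLinearMap.fst ℝ _ _
    else F (j - p) ∘L ContinuousLinearMap.snd ℝ _ _
  let e : ℕ → Param p H := fun j =>
    if h : j < p then (EuclideanSpace.single ⟨j, h⟩ 1, 0) else (0, φ (j - p))
  let ρ' : ℕ → ℝ := fun j => if j < p then 0 else ρ (j - p)
  have hx1 : ∀ (j : Fin p) v, x j v = v.1 j := fun j v => by simp [x]
  have hx2 : ∀ j v, x (j + p) v = L.VH v.2 (φ j) := fun j v => by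
    simp [x, hF, L.VH_comm]
  have he1 : ∀ j : Fin p, e j = (EuclideanSpace.single j 1, 0) := fun j => by simp [e]
  have he2 : ∀ j, e (j + p) = (0, φ j) := fun j => by simp [e]
  have hr1 : ∀ j : Fin p, ρ' j = 0 := fun j => by simp [ρ']
  have hr2 : ∀ j, ρ' (j + p) = ρ j := fun j => by simp [ρ']
  have hρ'0 : ∀ j, 0 ≤ ρ' j := fun j => by
    simp only [ρ']; split_ifs
    · exact le_rfl
    · exact hE.nonneg _
  have hsq : ∀ v : Param p H, HasSum (fun j => x j v ^ 2) (‖v.1‖ ^ 2 + L.VH v.2 v.2) := by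
    intro v
    have h := hE.hasSum_VH v.2
    have h2 := hasSum_shift (f := fun j => x j v ^ 2) (p := p) (a := L.VH v.2 v.2)
      (by simpa only [hx2] using h)
    have h3 : ∑ j : Fin p, x j v ^ 2 = ‖v.1‖ ^ 2 := by
      rw [EuclideanSpace.norm_sq_eq]
      exact Finset.sum_congr rfl fun j _ => by rw [hx1, Real.norm_eq_abs, sq_abs]
    rw [h3] at h2
    exact h2
  -- upper bound for the parametric part
  have hθ : ∃ Cθ : ℝ, 0 ≤ Cθ ∧ ∀ ζ : EuclideanSpace ℝ (Fin p), L.q (ζ, 0) ≤ Cθ * ‖ζ‖ ^ 2 := by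
    refine ⟨∑ l, ‖L.map l‖ ^ 2, by positivity, fun ζ => ?_⟩
    rw [Ops.q, Finset.sum_mul]
    refine Finset.sum_le_sum fun l _ => ?_
    rw [← mul_pow]
    have h := (L.map l).le_opNorm (ζ, 0)
    have h2 : ‖((ζ, 0) : Param p H)‖ = ‖ζ‖ := by simp [Prod.norm_def]
    rw [h2] at h
    gcongr
  obtain ⟨Cθ, hCθ, hθ⟩ := hθ
  have hup : ∀ v : Param p H, L.q v ≤ (2 * Cθ + 2) * (‖v.1‖ ^ 2 + L.VH v.2 v.2) := by
    intro v
    have h1 : v = (v.1, 0) + (0, v.2) := by simp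
    have h2 : L.q v ≤ 2 * L.q (v.1, 0) + 2 * L.q (0, v.2) := by
      conv_lhs => rw [h1]
      exact L.q_add_le _ _
    have h3 := hθ v.1
    have h4 := L.q_nonneg (0, v.2)
    rw [← Ops.VH_self] at h2 h4
    have h5 : 0 ≤ Cθ * L.VH v.2 v.2 := mul_nonneg hCθ h4
    nlinarith [sq_nonneg ‖v.1‖]
  have hlow : ∀ v : Param p H, ‖v.1‖ ^ 2 + L.VH v.2 v.2
      ≤ ((1 + 2 * Cθ) / cδ + 2) * L.q v := by
    intro v
    have h1 : ((0, v.2) : Param p H) = v + (-v.1, 0) := by ext <;> simp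
    have h2 : L.q (0, v.2) ≤ 2 * L.q v + 2 * L.q (-v.1, 0) := by
      conv_lhs => rw [h1]
      exact L.q_add_le _ _
    have h3 := hθ (-v.1)
    rw [norm_neg] at h3
    rw [Ops.VH_self]
    have h4 : ‖v.1‖ ^ 2 ≤ L.q v / cδ := by
      rw [le_div_iff₀ hcδ, mul_comm]
      exact L.le_q hsep v
    calc ‖v.1‖ ^ 2 + L.q (0, v.2) ≤ (1 + 2 * Cθ) * ‖v.1‖ ^ 2 + 2 * L.q v := by linarith
      _ ≤ (1 + 2 * Cθ) * (L.q v / cδ) + 2 * L.q v := by gcongr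
      _ = _ := by ring
  set Cl := (1 + 2 * Cθ) / cδ + 2 with hCl
  have hCl0 : 0 < Cl := by positivity
  have htrace : ∀ lam : ℝ, 0 < lam → lam ≤ 1 → ∀ n,
      ∑ j ∈ Finset.range n, (1 + lam * ρ' j)⁻¹ ≤ (p + C₀) * lam ^ (-(1 / r)) := by
    intro lam hlam hlam1 n
    have hd1 : 1 ≤ lam ^ (-(1 / r)) := Real.one_le_rpow_of_pos_of_le_one_of_nonpos hlam hlam1 (by
      have : 0 < 1 / r := by have := hρ.one_lt; positivity
      linarith)
    have ht0 : ∀ j, 0 ≤ (1 + lam * ρ' j)⁻¹ := fun j => by have := hρ'0 j; positivity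
    calc ∑ j ∈ Finset.range n, (1 + lam * ρ' j)⁻¹
        ≤ ∑ j ∈ Finset.range (p + n), (1 + lam * ρ' j)⁻¹ :=
          Finset.sum_le_sum_of_subset_of_nonneg (Finset.range_subset_range.2 (by omega))
            fun i _ _ => ht0 i
      _ = ∑ j ∈ Finset.range p, (1 + lam * ρ' j)⁻¹
          + ∑ j ∈ Finset.range n, (1 + lam * ρ j)⁻¹ := by
          rw [Finset.sum_range_add]
          congr 1
          exact Finset.sum_congr rfl fun j _ => by rw [add_comm p j, hr2]
      _ ≤ p * lam ^ (-(1 / r)) + C₀ * lam ^ (-(1 / r)) := by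
          refine add_le_add ?_ (htr lam hlam hlam1 n)
          rw [Finset.sum_range]
          simp only [hr1]
          simpa using le_mul_of_one_le_right p.cast_nonneg hd1
      _ = _ := by ring
  have hts1 : ∀ lam : ℝ, 0 < lam → lam ≤ 1 → Summable fun j => (1 + lam * ρ' j)⁻¹ :=
    fun lam hlam hlam1 => summable_of_sum_range_le
      (fun j => by have := hρ'0 j; positivity) (htrace lam hlam hlam1)
  refine ⟨⟨x, e, ρ', Cl⁻¹, max (2 * Cθ + 2) (p + C₀), by positivity, by positivity, hρ'0, ?_, ?_,
    ?_, fun v => (hsq v).summable, ?_, ?_, ?_, ?_, ?_⟩⟩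
  · intro i j hij
    simp only [ρ']
    split_ifs with h1 h2
    · exact le_rfl
    · exact hE.nonneg _
    · omega
    · exact hE.mono (by omega)
  · intro i j
    by_cases hi : i < p
    · have h1 := hx1 ⟨i, hi⟩ (e j)
      simp only at h1
      rw [h1]
      by_cases hj : j < p
      · have h2 := he1 ⟨j, hj⟩
        simp only at h2
        rw [h2]
        simp
      · have h2 := he2 (j - p)
        rw [Nat.sub_add_cancel (by omega)] at h2
        rw [h2, if_neg (by omega)]
        simp
    · have h1 := hx2 (i - p) (e j)
      rw [Nat.sub_add_cancel (by omega)] at h1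
      rw [h1]
      by_cases hj : j < p
      · have h2 := he1 ⟨j, hj⟩
        simp only at h2
        rw [h2, if_neg (by omega), ← Ops.formH_apply]
        simp
      · have h2 := he2 (j - p)
        rw [Nat.sub_add_cancel (by omega)] at h2
        rw [h2, hE.orthonormal]
        congr 1
        exact propext ⟨fun h => by omega, fun h => by omega⟩
  · intro v
    have h1 : HasSum (fun j => x (j + p) v • e (j + p)) ((0 : EuclideanSpace ℝ (Fin p)), v.2) := by
      have h := (hE.expansion v.2).mapL (ContinuousLinearMap.inr ℝ (EuclideanSpace ℝ (Fin p)) H)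
      simpa [hx2, he2] using h
    have h2 := hasSum_shift (f := fun j => x j v • e j) h1
    have h3 : ∑ j : Fin p, x j v • e j = (v.1, 0) := by
      simp only [hx1, he1]
      ext k
      · rw [Prod.fst_sum]
        simp [Pi.single_apply]
      · rw [Prod.snd_sum]; simp
    rw [h3] at h2
    simpa using h2
  · intro v
    rw [(hsq v).tsum_eq, inv_mul_le_iff₀ hCl0]
    exact hlow v
  · intro v
    rw [(hsq v).tsum_eq]
    refine (hup v).trans (mul_le_mul_of_nonneg_right (le_max_left _ _) ?_)
    rw [Ops.VH_self]
    exact add_nonneg (sq_nonneg _) (L.q_nonneg _)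
  · intro v
    have h := hE.hasSum_J hJ hL v.2
    have h2 := hasSum_shift (f := fun j => ρ' j * x j v ^ 2) (p := p) (a := M.J v.2 v.2)
      (by simpa only [hx2, hr2] using h)
    simpa [hr1] using h2
  · intro lam hlam
    rcases le_total lam 1 with h | h
    · exact hts1 lam hlam h
    · refine (hts1 1 one_pos le_rfl).of_nonneg_of_le
        (fun j => by have := hρ'0 j; positivity) fun j => ?_
      have := hρ'0 j
      exact inv_anti₀ (by positivity) (by nlinarith)
  · intro lam hlam hlam1
    refine (Real.tsum_le_of_sum_range_le (fun j => by have := hρ'0 j; positivity)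
      (htrace lam hlam hlam1)).trans ?_
    exact mul_le_mul_of_nonneg_right (le_max_right _ _) (by positivity)

end Model

/-! ### Exponential tilting of a probability measure -/

/-- Taylor's formula gives `exp y - 1 - y ≥ min 1 (exp y) * y² / 2`. For `y = -z ≤ 0`,
multiplication by `exp z` turns this into `z² / 2 ≤ (z - 1) exp z + 1`. -/
theorem half_mul_sq_le_exp_sub {c y : ℝ} (hc1 : c ≤ 1) (hy : c ≤ Real.exp y) :
    c / 2 * y ^ 2 ≤ Real.exp y - 1 - y := by
  rcases le_total 0 y with h | h
  · have := Real.quadratic_le_exp_of_nonneg h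
    nlinarith [sq_nonneg y]
  · obtain ⟨z, rfl⟩ : ∃ z, y = -z := ⟨-y, by ring⟩
    have hz : 0 ≤ z := by linarith
    have key : z ^ 2 / 2 ≤ (z - 1) * Real.exp z + 1 := by
      rcases le_total 1 z with h1 | h1
      · have := Real.quadratic_le_exp_of_nonneg hz
        nlinarith [mul_le_mul_of_nonneg_left this (sub_nonneg.2 h1), mul_nonneg (sq_nonneg z)
          (sub_nonneg.2 h1)]
      · have := Real.exp_bound' hz h1 (n := 3) (by norm_num)
        simp only [Finset.sum_range_succ, Finset.sum_range_zero] at this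
        norm_num [Nat.factorial] at this
        have h3 : 0 ≤ z ^ 3 := by positivity
        nlinarith [mul_le_mul_of_nonneg_left this (sub_nonneg.2 h1), mul_nonneg h3
          (sub_nonneg.2 h1), mul_nonneg h3 hz]
    have hE : Real.exp (-z) * Real.exp z = 1 := by rw [← Real.exp_add]; simp
    have h2 : Real.exp (-z) * (z ^ 2 / 2) ≤ Real.exp (-z) - 1 + z := by
      have := mul_le_mul_of_nonneg_left key (Real.exp_pos (-z)).le
      nlinarith
    have h3 : c * (z ^ 2 / 2) ≤ Real.exp (-z) * (z ^ 2 / 2) :=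
      mul_le_mul_of_nonneg_right hy (by positivity)
    nlinarith

theorem abs_exp_sub_one_le {c y : ℝ} (hc1 : 1 ≤ c) (hy : Real.exp y ≤ c) :
    |Real.exp y - 1| ≤ c * |y| := by
  rcases le_total 0 y with h | h
  · rw [abs_of_nonneg (by linarith [Real.add_one_le_exp y]), abs_of_nonneg h]
    have h1 := Real.add_one_le_exp (-y)
    have hE : Real.exp (-y) * Real.exp y = 1 := by rw [← Real.exp_add]; simp
    nlinarith [Real.exp_pos y]
  · rw [abs_of_nonpos (by linarith [Real.exp_le_one_iff.2 h]), abs_of_nonpos h]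
    have h1 := Real.add_one_le_exp y
    nlinarith

section tilting

variable {X : Type u} [MeasurableSpace X] (P : Measure X) [IsProbabilityMeasure P]

/-- The logarithm of the normalizing constant of the density `exp δ`. -/
def logZ (δ : X → ℝ) : ℝ := Real.log (∫ x, Real.exp (δ x) ∂P)

variable {P}

theorem exp_div_integral_eq {δ : X → ℝ} (hδ : Integrable (fun x => Real.exp (δ x)) P) (x : X) :
    Real.exp (δ x) / ∫ x, Real.exp (δ x) ∂P = Real.exp (δ x - logZ P δ) := by
  rw [Real.exp_sub, logZ, Real.exp_log (integral_exp_pos hδ)]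

theorem integral_exp_sub_logZ {δ : X → ℝ} (hδ : Integrable (fun x => Real.exp (δ x)) P) :
    ∫ x, Real.exp (δ x - logZ P δ) ∂P = 1 := by
  simp only [← exp_div_integral_eq hδ]
  rw [integral_div, div_self (integral_exp_pos hδ).ne']

theorem integral_tilted_eq {δ : X → ℝ} (hδ : Integrable (fun x => Real.exp (δ x)) P) (g : X → ℝ) :
    ∫ x, g x ∂(P.tilted δ) = ∫ x, Real.exp (δ x - logZ P δ) * g x ∂P := by
  rw [integral_tilted]
  simp only [exp_div_integral_eq hδ, smul_eq_mul]

theorem tilted_real_le {δ : X → ℝ} (hδ : Integrable (fun x => Real.exp (δ x)) P) {B : Set X}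
    (hB : MeasurableSet B) {c : ℝ} (hc : 0 ≤ c)
    (h : ∀ᵐ x ∂P, x ∈ B → Real.exp (δ x - logZ P δ) ≤ c) :
    (P.tilted δ).real B ≤ c * P.real B := by
  have h1 : P.tilted δ B ≤ ENNReal.ofReal c * P B := by
    rw [tilted_apply' _ _ hB]
    calc _ ≤ ∫⁻ _ in B, ENNReal.ofReal c ∂P := by
          refine setLIntegral_mono_ae' hB ?_
          filter_upwards [h] with x hx hxB
          rw [exp_div_integral_eq hδ]
          exact ENNReal.ofReal_le_ofReal (hx hxB)
      _ = _ := by simp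
  have := ENNReal.toReal_mono (by finiteness) h1
  rwa [ENNReal.toReal_mul, ENNReal.toReal_ofReal hc] at this

theorem le_tilted_real {δ : X → ℝ} (hδ : Integrable (fun x => Real.exp (δ x)) P) {B : Set X}
    (hB : MeasurableSet B) {c : ℝ} (hc : 0 ≤ c)
    (h : ∀ᵐ x ∂P, x ∈ B → c ≤ Real.exp (δ x - logZ P δ)) :
    c * P.real B ≤ (P.tilted δ).real B := by
  have : IsProbabilityMeasure (P.tilted δ) := isProbabilityMeasure_tilted hδ
  have h1 : ENNReal.ofReal c * P B ≤ P.tilted δ B := by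
    rw [tilted_apply' _ _ hB]
    calc _ = ∫⁻ _ in B, ENNReal.ofReal c ∂P := by simp
      _ ≤ _ := by
          refine setLIntegral_mono_ae' hB ?_
          filter_upwards [h] with x hx hxB
          rw [exp_div_integral_eq hδ]
          exact ENNReal.ofReal_le_ofReal (hx hxB)
  have := ENNReal.toReal_mono (by finiteness) h1
  rwa [ENNReal.toReal_mul, ENNReal.toReal_ofReal hc] at this

/-- Comparing the variances of indicator functions bounds the density from above and below. -/
theorem density_bounds_of_indicator_variance {δ : X → ℝ} (hm : Measurable δ)
    (hδ : Integrable (fun x => Real.exp (δ x)) P) {C₃ C₄ κ : ℝ} (hC₃ : 0 < C₃) (hC₄ : 0 < C₄)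
    (hκ : 0 < κ) {S : Set X} (hS : MeasurableSet S) (hS1 : κ ≤ P.real S) (hS2 : κ ≤ P.real Sᶜ)
    (h : ∀ B, MeasurableSet B → C₃ * (P.real B * P.real Bᶜ) ≤
        (P.tilted δ).real B * (P.tilted δ).real Bᶜ ∧
      (P.tilted δ).real B * (P.tilted δ).real Bᶜ ≤ C₄ * (P.real B * P.real Bᶜ)) :
    ∀ᵐ x ∂P, C₃ * κ / 2 ≤ Real.exp (δ x - logZ P δ) ∧
      Real.exp (δ x - logZ P δ) ≤ 2 + 2 * C₄ / (C₃ * κ / 2) := by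
  have hQ : IsProbabilityMeasure (P.tilted δ) := isProbabilityMeasure_tilted hδ
  set w : X → ℝ := fun x => Real.exp (δ x - logZ P δ) with hw
  have hwm : Measurable w := (hm.sub_const _).exp
  set c₁ := C₃ * κ / 2 with hc₁
  have hc₁0 : 0 < c₁ := by positivity
  have hlow : ∀ᵐ x ∂P, c₁ ≤ w x := by
    have hB : MeasurableSet {x | w x < c₁} := measurableSet_lt hwm measurable_const
    -- Intersecting with `S` leaves mass at least `κ` outside `B`. Then `C₃ κ P(B)` is at most the
    -- tilted mass of `B`, hence at most `c₁ P(B)` with `c₁ = C₃ κ / 2`, so `B` is null. The set `S`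
    -- and its complement together exhaust the event.
    have key : ∀ S : Set X, MeasurableSet S → κ ≤ P.real Sᶜ → P ({x | w x < c₁} ∩ S) = 0 := by
      intro S hS hS2
      set B := {x | w x < c₁} ∩ S with hBdef
      have hBm : MeasurableSet B := hB.inter hS
      have h1 := (h B hBm).1
      have h2 : (P.tilted δ).real B ≤ c₁ * P.real B :=
        tilted_real_le hδ hBm hc₁0.le (ae_of_all _ fun x hx => le_of_lt hx.1)
      have h3 : κ ≤ P.real Bᶜ :=
        hS2.trans (measureReal_mono (Set.compl_subset_compl.2 Set.inter_subset_right))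
      have h4 : (P.tilted δ).real Bᶜ ≤ 1 := measureReal_le_one
      have h5 : (0 : ℝ) ≤ (P.tilted δ).real B := measureReal_nonneg
      have h6 : (0 : ℝ) ≤ P.real B := measureReal_nonneg
      have h7 : C₃ * (P.real B * κ) ≤ c₁ * P.real B :=
        calc C₃ * (P.real B * κ) ≤ C₃ * (P.real B * P.real Bᶜ) := by gcongr
          _ ≤ _ := h1
          _ ≤ (P.tilted δ).real B * 1 := by gcongr
          _ ≤ _ := by linarith
      have h8 : P.real B = 0 := by
        by_contra hne
        have : 0 < P.real B := lt_of_le_of_ne h6 (Ne.symm hne)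
        have := mul_pos (mul_pos hC₃ hκ) this
        rw [hc₁] at h7
        linarith
      rwa [measureReal_eq_zero_iff] at h8
    have h1 := key S hS hS2
    have h2 := key Sᶜ hS.compl (by rwa [compl_compl])
    have h3 : P {x | w x < c₁} = 0 := by
      rw [← Set.inter_union_compl {x | w x < c₁} S]
      exact measure_union_null h1 h2
    filter_upwards [measure_eq_zero_iff_ae_notMem.1 h3] with x hx
    exact not_lt.1 hx
  set c₂ := 2 + 2 * C₄ / c₁ with hc₂
  have hc₂0 : 0 < c₂ := by positivity
  have hup : ∀ᵐ x ∂P, w x ≤ c₂ := by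
    set B := {x | c₂ < w x} with hBdef
    have hBm : MeasurableSet B := measurableSet_lt measurable_const hwm
    have h1 : c₂ * P.real B ≤ (P.tilted δ).real B :=
      le_tilted_real hδ hBm hc₂0.le (ae_of_all _ fun x hx => le_of_lt hx)
    have h2 : c₁ * P.real Bᶜ ≤ (P.tilted δ).real Bᶜ :=
      le_tilted_real hδ hBm.compl hc₁0.le (hlow.mono fun x hx _ => hx)
    have h3 := (h B hBm).2
    have h4 : (P.tilted δ).real B ≤ 1 := measureReal_le_one
    have h5 : P.real Bᶜ = 1 - P.real B := probReal_compl_eq_one_sub hBm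
    have h6 : (0 : ℝ) ≤ P.real B := measureReal_nonneg
    have h7 : (0 : ℝ) ≤ 2 * C₄ / c₁ := by positivity
    -- This uses `c₂ ≥ 2`. The complement then has positive mass and can be cancelled, leaving `C₄
    -- P(B)` as an upper bound for `c₁` times the tilted mass of `B`. As that mass is at least `c₂
    -- P(B)` and `c₁ c₂ > C₄`, `B` is null.
    have h8 : P.real B ≤ 1 / 2 := by nlinarith
    have h9 : 0 < P.real Bᶜ := by linarith
    have h10 : c₁ * (P.tilted δ).real B ≤ C₄ * P.real B := by
      have : (c₁ * (P.tilted δ).real B) * P.real Bᶜ ≤ (C₄ * P.real B) * P.real Bᶜ := by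
        calc (c₁ * (P.tilted δ).real B) * P.real Bᶜ
            = (P.tilted δ).real B * (c₁ * P.real Bᶜ) := by ring
          _ ≤ (P.tilted δ).real B * (P.tilted δ).real Bᶜ :=
            mul_le_mul_of_nonneg_left h2 measureReal_nonneg
          _ ≤ _ := h3
          _ = _ := by ring
      exact le_of_mul_le_mul_right this h9
    have h11 : c₁ * c₂ = 2 * c₁ + 2 * C₄ := by rw [hc₂]; field_simp
    have h12 : P.real B = 0 := by
      by_contra hne
      have h13 : 0 < P.real B := lt_of_le_of_ne h6 (Ne.symm hne)
      have h14 := mul_le_mul_of_nonneg_left h1 hc₁0.le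
      have : c₁ * c₂ * P.real B ≤ C₄ * P.real B := by linarith
      rw [h11] at this
      nlinarith [mul_pos hC₄ h13, mul_pos hc₁0 h13]
    have h13 : P B = 0 := by rwa [measureReal_eq_zero_iff] at h12
    filter_upwards [measure_eq_zero_iff_ae_notMem.1 h13] with x hx
    exact not_lt.1 hx
  exact hlow.and hup

theorem logZ_nonneg {δ : X → ℝ} (hδ : Integrable (fun x => Real.exp (δ x)) P)
    (hi : Integrable δ P) (h0 : ∫ x, δ x ∂P = 0) : 0 ≤ logZ P δ := by
  refine Real.log_nonneg ?_
  calc (1 : ℝ) = ∫ x, (δ x + 1) ∂P := by rw [integral_add hi (integrable_const _), h0]; simp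
    _ ≤ _ := integral_mono (hi.add (integrable_const _)) hδ fun x => Real.add_one_le_exp _

theorem logZ_le_neg_log {δ : X → ℝ} (hi : Integrable δ P) (h0 : ∫ x, δ x ∂P = 0) {c₁ : ℝ}
    (hc₁ : 0 < c₁) (h1 : ∀ᵐ x ∂P, c₁ ≤ Real.exp (δ x - logZ P δ)) :
    logZ P δ ≤ -Real.log c₁ := by
  have h : ∫ _, Real.log c₁ ∂P ≤ ∫ x, (δ x - logZ P δ) ∂P := by
    refine integral_mono_ae (integrable_const _) (hi.sub (integrable_const _)) ?_
    filter_upwards [h1] with x hx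
    exact (Real.log_le_iff_le_exp hc₁).2 hx
  rw [integral_sub hi (integrable_const _), h0] at h
  simp at h
  linarith

/-- For mean-zero `δ`, `logZ P δ` is the relative entropy of `P` with respect to the tilted law. It
equals the integral of `exp y - 1 - y` with `y = δ - logZ P δ`, which a lower bound for the density
makes at least quadratic. -/
theorem mul_integral_sq_le_logZ {δ : X → ℝ} (hδ : Integrable (fun x => Real.exp (δ x)) P)
    (h2 : MemLp δ 2 P) (h0 : ∫ x, δ x ∂P = 0) {c₁ : ℝ} (hc₁ : 0 < c₁) (hc : c₁ ≤ 1)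
    (h1 : ∀ᵐ x ∂P, c₁ ≤ Real.exp (δ x - logZ P δ)) :
    c₁ / 2 * ∫ x, δ x ^ 2 ∂P ≤ logZ P δ := by
  have hi : Integrable δ P := h2.integrable (by norm_num)
  set a := logZ P δ with ha
  have hy : MemLp (fun x => δ x - a) 2 P := h2.sub (memLp_const a)
  have hexp : Integrable (fun x => Real.exp (δ x - a)) P := by
    simp only [Real.exp_sub]
    exact hδ.div_const _
  have h3 : ∫ x, c₁ / 2 * (δ x - a) ^ 2 ∂P ≤ ∫ x, (Real.exp (δ x - a) - 1 - (δ x - a)) ∂P := by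
    refine integral_mono_ae (hy.integrable_sq.const_mul _)
      ((hexp.sub (integrable_const 1)).sub (hi.sub (integrable_const a))) ?_
    filter_upwards [h1] with x hx
    exact half_mul_sq_le_exp_sub hc hx
  have h4 : ∫ x, (Real.exp (δ x - a) - 1 - (δ x - a)) ∂P = a := by
    have e1 : Integrable (fun x => Real.exp (δ x - a) - 1) P := hexp.sub (integrable_const 1)
    have e2 : Integrable (fun x => δ x - a) P := hi.sub (integrable_const a)
    rw [integral_sub e1 e2, integral_sub hexp (integrable_const _), integral_sub hi
      (integrable_const _), integral_exp_sub_logZ hδ, h0]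
    simp
  have h5 : ∫ x, (δ x - a) ^ 2 ∂P = ∫ x, δ x ^ 2 ∂P + a ^ 2 := by
    have e1 : Integrable (fun x => δ x ^ 2) P := h2.integrable_sq
    have e2 : Integrable (fun x => 2 * a * δ x) P := hi.const_mul _
    have e3 : Integrable (fun x => δ x ^ 2 - 2 * a * δ x) P := e1.sub e2
    have : ∀ x, (δ x - a) ^ 2 = δ x ^ 2 - 2 * a * δ x + a ^ 2 := fun x => by ring
    simp only [this]
    rw [integral_add e3 (integrable_const _), integral_sub e1 e2, integral_const_mul, h0]
    simp
  rw [h4, integral_const_mul, h5] at h3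
  nlinarith [sq_nonneg a]

/-- Gibbs' inequality for the log normalizing constants. -/
theorem integral_tilted_sub_le_logZ_sub {δ δ' : X → ℝ}
    (hδ : Integrable (fun x => Real.exp (δ x)) P) (hδ' : Integrable (fun x => Real.exp (δ' x)) P)
    (hi : Integrable (fun x => δ' x - δ x) (P.tilted δ)) :
    ∫ x, (δ' x - δ x) ∂(P.tilted δ) ≤ logZ P δ' - logZ P δ := by
  have hQ : IsProbabilityMeasure (P.tilted δ) := isProbabilityMeasure_tilted hδ
  set I := ∫ x, (δ' x - δ x) ∂(P.tilted δ) with hI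
  have h1 : ∫ x, Real.exp (δ' x - δ x) ∂(P.tilted δ) = Real.exp (logZ P δ' - logZ P δ) := by
    have := integral_exp_tilted (μ := P) δ (fun x => δ' x - δ x)
    rw [this, Real.exp_sub, logZ, logZ, Real.exp_log (integral_exp_pos hδ'),
      Real.exp_log (integral_exp_pos hδ)]
    simp
  have h2 : Integrable (fun x => Real.exp (δ' x - δ x)) (P.tilted δ) := by
    by_contra hn
    rw [integral_undef hn] at h1
    exact (Real.exp_pos _).ne h1
  have h3 : Real.exp I ≤ Real.exp (logZ P δ' - logZ P δ) := by
    rw [← h1]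
    have h4 : ∫ x, Real.exp I * (δ' x - δ x - I + 1) ∂(P.tilted δ)
        ≤ ∫ x, Real.exp (δ' x - δ x) ∂(P.tilted δ) := by
      refine integral_mono (((hi.sub (integrable_const _)).add (integrable_const _)).const_mul _) h2
        fun x => ?_
      have := mul_le_mul_of_nonneg_left (Real.add_one_le_exp (δ' x - δ x - I)) (Real.exp_pos I).le
      rwa [← Real.exp_add, add_sub_cancel] at this
    have e1 : Integrable (fun x => δ' x - δ x - I) (P.tilted δ) := hi.sub (integrable_const _)
    rw [integral_const_mul, integral_add e1 (integrable_const _),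
      integral_sub hi (integrable_const _), ← hI] at h4
    simpa using h4
  exact Real.exp_le_exp.1 h3

theorem integrable_tilted_of_bounded {δ g : X → ℝ}
    (hδ : Integrable (fun x => Real.exp (δ x)) P) {c₂ : ℝ}
    (h : ∀ᵐ x ∂P, Real.exp (δ x - logZ P δ) ≤ c₂) (hg : Integrable g P) :
    Integrable g (P.tilted δ) := by
  rw [integrable_tilted_iff hδ]
  refine hg.bdd_mul hδ.aestronglyMeasurable (c := c₂ * Real.exp (logZ P δ)) ?_
  filter_upwards [h] with x hx
  rw [Real.norm_eq_abs, abs_of_pos (Real.exp_pos _)]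
  rwa [Real.exp_sub, div_le_iff₀ (Real.exp_pos _)] at hx

theorem integral_abs_mul_abs_le {f g : X → ℝ} (hf : MemLp f 2 P) (hg : MemLp g 2 P) :
    ∫ x, |f x| * |g x| ∂P ≤ √(∫ x, f x ^ 2 ∂P) * √(∫ x, g x ^ 2 ∂P) := by
  have hf' : MemLp (fun x => |f x|) 2 P := hf.abs
  have hg' : MemLp (fun x => |g x|) 2 P := hg.abs
  have h := real_inner_le_norm (hf'.toLp _) (hg'.toLp _)
  have e1 : inner ℝ (hf'.toLp _) (hg'.toLp _) = ∫ x, |f x| * |g x| ∂P := by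
    rw [inner_eq_integral_mul]
    refine integral_congr_ae ?_
    filter_upwards [hf'.coeFn_toLp, hg'.coeFn_toLp] with x h1 h2
    rw [h1, h2]
  have e2 : ∀ {f : X → ℝ} (hf' : MemLp (fun x => |f x|) 2 P),
      ‖hf'.toLp _‖ = √(∫ x, f x ^ 2 ∂P) := by
    intro f hf'
    rw [← Real.sqrt_sq (norm_nonneg (hf'.toLp _)), norm_sq_eq_integral]
    congr 1
    refine integral_congr_ae ?_
    filter_upwards [hf'.coeFn_toLp] with x h1
    rw [h1, sq_abs]
  rwa [e1, e2 hf', e2 hg'] at h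

theorem integral_abs_le_sqrt {f : X → ℝ} (hf : MemLp f 2 P) :
    ∫ x, |f x| ∂P ≤ √(∫ x, f x ^ 2 ∂P) := by
  have h := integral_abs_mul_abs_le hf (memLp_const (1 : ℝ))
  simpa using h

theorem abs_integral_tilted_le {δ g : X → ℝ}
    (hδ : Integrable (fun x => Real.exp (δ x)) P) {c₂ : ℝ}
    (h : ∀ᵐ x ∂P, Real.exp (δ x - logZ P δ) ≤ c₂) (hg : Integrable g P) :
    |∫ x, g x ∂(P.tilted δ)| ≤ c₂ * ∫ x, |g x| ∂P := by
  rw [integral_tilted_eq hδ, ← integral_const_mul]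
  refine (abs_integral_le_integral_abs).trans (integral_mono_of_nonneg
    (ae_of_all _ fun x => abs_nonneg _) (hg.abs.const_mul _) ?_)
  filter_upwards [h] with x hx
  simp only [abs_mul, abs_of_pos (Real.exp_pos _)]
  exact mul_le_mul_of_nonneg_right hx (abs_nonneg _)

/-- Gibbs' inequality in both directions; the density bounds turn tilted means into means under `P`.
-/
theorem abs_logZ_sub_le {δ δ' : X → ℝ}
    (hδ : Integrable (fun x => Real.exp (δ x)) P) (hδ' : Integrable (fun x => Real.exp (δ' x)) P)
    {c₂ : ℝ} (h : ∀ᵐ x ∂P, Real.exp (δ x - logZ P δ) ≤ c₂)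
    (h' : ∀ᵐ x ∂P, Real.exp (δ' x - logZ P δ') ≤ c₂) (hd : MemLp (fun x => δ' x - δ x) 2 P) :
    |logZ P δ' - logZ P δ| ≤ c₂ * √(∫ x, (δ' x - δ x) ^ 2 ∂P) := by
  have hc₂ : 0 ≤ c₂ := by
    obtain ⟨x, hx⟩ := h.exists
    exact (Real.exp_pos _).le.trans hx
  have hi : Integrable (fun x => δ' x - δ x) P := hd.integrable (by norm_num)
  have hi' : Integrable (fun x => δ x - δ' x) P :=
    hi.neg.congr (ae_of_all _ fun x => by simp)
  have h1 := integral_tilted_sub_le_logZ_sub hδ hδ' (integrable_tilted_of_bounded hδ h hi)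
  have h2 := integral_tilted_sub_le_logZ_sub hδ' hδ (integrable_tilted_of_bounded hδ' h' hi')
  have h3 := neg_le_of_abs_le (abs_integral_tilted_le hδ h hi)
  have h4 := neg_le_of_abs_le (abs_integral_tilted_le hδ' h' hi')
  have h5 : ∫ x, |δ x - δ' x| ∂P = ∫ x, |δ' x - δ x| ∂P := by simp only [abs_sub_comm]
  have h6 := mul_le_mul_of_nonneg_left (integral_abs_le_sqrt hd) hc₂
  rw [h5] at h4
  rw [abs_le]
  constructor <;> linarith

/-- As `g` has mean zero under `P`, only `∫ (density - 1) g` remains. Here `|density - 1| ≤ c₂ (|δ|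
+ logZ P δ)`, and `logZ P δ` is itself at most `c₂` times the `L²` norm of `δ`. -/
theorem abs_integral_tilted_le_of_mean_zero {δ g : X → ℝ} (hm : Measurable δ)
    (hδ : Integrable (fun x => Real.exp (δ x)) P) (hδ2 : MemLp δ 2 P) (h0 : ∫ x, δ x ∂P = 0)
    (hg : MemLp g 2 P) (hg0 : ∫ x, g x ∂P = 0) {c₂ : ℝ} (hc₂ : 1 ≤ c₂)
    (h : ∀ᵐ x ∂P, Real.exp (δ x - logZ P δ) ≤ c₂) :
    |∫ x, g x ∂(P.tilted δ)| ≤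
      c₂ * (1 + c₂) * (√(∫ x, δ x ^ 2 ∂P) * √(∫ x, g x ^ 2 ∂P)) := by
  have hi : Integrable δ P := hδ2.integrable (by norm_num)
  have hgi : Integrable g P := hg.integrable (by norm_num)
  set a := logZ P δ with ha
  have ha0 : 0 ≤ a := logZ_nonneg hδ hi h0
  have hale : a ≤ c₂ * √(∫ x, δ x ^ 2 ∂P) := by
    have h1 := integral_tilted_sub_le_logZ_sub (P := P) (δ := δ) (δ' := fun _ => 0) hδ
      (by simp) (integrable_tilted_of_bounded hδ h (by simpa using hi.neg))
    have h2 : logZ P (fun _ : X => (0 : ℝ)) = 0 := by simp [logZ]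
    have h3 := abs_integral_tilted_le hδ h hi
    have h4 : ∫ x, (0 - δ x) ∂(P.tilted δ) = -∫ x, δ x ∂(P.tilted δ) := by
      rw [← integral_neg]; simp
    rw [h2, h4] at h1
    have h5 := mul_le_mul_of_nonneg_left (integral_abs_le_sqrt hδ2) (by linarith : 0 ≤ c₂)
    linarith [le_abs_self (∫ x, δ x ∂(P.tilted δ))]
  have hwg : Integrable (fun x => Real.exp (δ x - a) * g x) P := by
    refine hgi.bdd_mul (c := c₂) (hm.sub_const _).exp.aestronglyMeasurable ?_
    filter_upwards [h] with x hx
    rwa [Real.norm_eq_abs, abs_of_pos (Real.exp_pos _)]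
  have e1 : ∫ x, g x ∂(P.tilted δ) = ∫ x, (Real.exp (δ x - a) - 1) * g x ∂P := by
    rw [integral_tilted_eq hδ]
    simp only [sub_mul, one_mul]
    rw [integral_sub hwg hgi, hg0, sub_zero]
  have i1 : Integrable (fun x => |δ x| * |g x|) P := hδ2.abs.integrable_mul hg.abs
  have i2 : Integrable (fun x => a * |g x|) P := hgi.abs.const_mul a
  have i3 : Integrable (fun x => |δ x| * |g x| + a * |g x|) P := i1.add i2
  have e2 : |∫ x, (Real.exp (δ x - a) - 1) * g x ∂P| ≤
      ∫ x, c₂ * (|δ x| * |g x| + a * |g x|) ∂P := by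
    refine (abs_integral_le_integral_abs).trans (integral_mono_of_nonneg
      (ae_of_all _ fun x => abs_nonneg _) (i3.const_mul _) ?_)
    filter_upwards [h] with x hx
    have h1 := abs_exp_sub_one_le hc₂ hx
    have h2 : |δ x - a| ≤ |δ x| + a := by
      calc |δ x - a| ≤ |δ x| + |a| := abs_sub _ _
        _ = _ := by rw [abs_of_nonneg ha0]
    have h3 : |Real.exp (δ x - a) - 1| ≤ c₂ * (|δ x| + a) :=
      h1.trans (mul_le_mul_of_nonneg_left h2 (by linarith))
    simp only [abs_mul]
    calc _ ≤ c₂ * (|δ x| + a) * |g x| := mul_le_mul_of_nonneg_right h3 (abs_nonneg _)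
      _ = _ := by ring
  rw [e1]
  refine e2.trans ?_
  rw [integral_const_mul, integral_add i1 i2, integral_const_mul, mul_assoc]
  refine mul_le_mul_of_nonneg_left ?_ (by linarith)
  have h1 := integral_abs_mul_abs_le hδ2 hg
  have h2 := integral_abs_le_sqrt hg
  have h3 := mul_le_mul hale h2 (integral_nonneg fun x => abs_nonneg _) (by positivity)
  nlinarith

end tilting

/-! ### Pointwise and `L²` derivatives of the log densities -/

theorem integral_sq_eq_norm_sq {X : Type u} [MeasurableSpace X] {P : Measure X} {f : X → ℝ}
    {F : Lp ℝ 2 P} (h : f =ᵐ[P] F) : ∫ x, f x ^ 2 ∂P = ‖F‖ ^ 2 := by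
  rw [norm_sq_eq_integral]
  exact integral_congr_ae (h.mono fun x hx => by simp only [hx])

theorem exists_tendsto_ae_of_tendsto_Lp {X : Type u} [MeasurableSpace X] {P : Measure X}
    {F : ℕ → Lp ℝ 2 P} {G : Lp ℝ 2 P} (h : Tendsto F atTop (𝓝 G)) :
    ∃ s : ℕ → ℕ, StrictMono s ∧ ∀ᵐ x ∂P, Tendsto (fun k => F (s k) x) atTop (𝓝 (G x)) :=
  (tendstoInMeasure_of_tendsto_Lp h).exists_seq_tendsto_ae

theorem tendsto_seq_of_hasFDerivAt {E F : Type*} [NormedAddCommGroup E] [NormedSpace ℝ E]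
    [NormedAddCommGroup F] [NormedSpace ℝ F] {f : E → F} {f' : E →L[ℝ] F} {x : E}
    (h : HasFDerivAt f f' x) (v : E) :
    Tendsto (fun k : ℕ => ((k : ℝ) + 1) • (f (x + ((k : ℝ) + 1)⁻¹ • v) - f x)) atTop
      (𝓝 (f' v)) := by
  have h1 : Tendsto (fun k : ℕ => ((k : ℝ) + 1)) atTop atTop :=
    tendsto_atTop_add_const_right _ _ tendsto_natCast_atTop_atTop
  exact h.lim v (tendsto_norm_atTop_atTop.comp h1)

namespace Model

variable {p m : ℕ} {X : Fin m → Type u} [∀ l, MeasurableSpace (X l)]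
  {H : Type v} [NormedAddCommGroup H] [InnerProductSpace ℝ H] {M : Model p m X H}

/-- The log density of the law at `τ` relative to the true one, up to a constant. -/
def dev (M : Model p m X H) (l : Fin m) (τ : Param p H) : X l → ℝ :=
  fun x => M.η l τ x - M.η l M.τ₀ x

/-- The remainder of the first order expansion of `η l` at the true parameter. -/
def rem (M : Model p m X H) (l : Fin m) (v : Param p H) : X l → ℝ :=
  fun x => M.η l (M.τ₀ + v) x - M.η l M.τ₀ x - M.Dηpt l x M.τ₀ v

/-- The change of the derivative of `η l` from the true parameter to `τ₀ + v`. -/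
def gap (M : Model p m X H) (l : Fin m) (v w : Param p H) : X l → ℝ :=
  fun x => M.Dηpt l x M.τ₀ w - M.Dηpt l x (M.τ₀ + v) w

variable {Nθ : Set (EuclideanSpace ℝ (Fin p))} {Nh : Set H}

section basic

variable (hη : M.SmoothnessAssumption Nθ Nh)

include hη

theorem SmoothnessAssumption.isOpen : IsOpen (Nθ ×ˢ Nh) := hη.openθ.prod hη.openh

theorem SmoothnessAssumption.hasFDerivAt_ηL2 {τ : Param p H} (hτ : τ ∈ Nθ ×ˢ Nh) (l : Fin m) :
    HasFDerivAt (M.ηL2 l) (fderiv ℝ (M.ηL2 l) τ) τ :=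
  (((hη.contDiffOn l).differentiableOn (by norm_num)).differentiableAt
    (hη.isOpen.mem_nhds hτ)).hasFDerivAt

theorem SmoothnessAssumption.hasFDerivAt_η {τ : Param p H} (hτ : τ ∈ Nθ ×ˢ Nh) (l : Fin m)
    (x : X l) : HasFDerivAt (fun σ => M.η l σ x) (fderiv ℝ (fun σ => M.η l σ x) τ) τ :=
  ((hη.differentiableOn l x).differentiableAt (hη.isOpen.mem_nhds hτ)).hasFDerivAt

theorem SmoothnessAssumption.coeFn_ηL2 {τ : Param p H} (hτ : τ ∈ Nθ ×ˢ Nh) (l : Fin m) :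
    M.ηL2 l τ =ᵐ[M.law l M.τ₀] M.η l τ := by
  rw [ηL2, dif_pos (hη.memLp l τ hτ)]
  exact MemLp.coeFn_toLp _

theorem SmoothnessAssumption.eventually_mem {τ : Param p H} (hτ : τ ∈ Nθ ×ˢ Nh) (v : Param p H) :
    ∀ᶠ k : ℕ in atTop, τ + ((k : ℝ) + 1)⁻¹ • v ∈ Nθ ×ˢ Nh := by
  have h : Tendsto (fun k : ℕ => τ + ((k : ℝ) + 1)⁻¹ • v) atTop (𝓝 τ) := by
    have h1 : Tendsto (fun k : ℕ => ((k : ℝ) + 1)⁻¹) atTop (𝓝 0) := by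
      simpa using tendsto_one_div_add_atTop_nhds_zero_nat (𝕜 := ℝ)
    simpa using (h1.smul_const v).const_add τ
  exact h.eventually (hη.isOpen.mem_nhds hτ)

theorem SmoothnessAssumption.measurable_Dηpt {τ : Param p H} (hτ : τ ∈ Nθ ×ˢ Nh) (l : Fin m)
    (v : Param p H) : Measurable fun x => M.Dηpt l x τ v := by
  obtain ⟨k₀, hk₀⟩ := eventually_atTop.1 (hη.eventually_mem hτ v)
  refine measurable_of_tendsto_metrizable (f := fun (k : ℕ) x => (((k + k₀ : ℕ) : ℝ) + 1) •
    (M.η l (τ + (((k + k₀ : ℕ) : ℝ) + 1)⁻¹ • v) x - M.η l τ x)) (fun k => ?_) ?_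
  · exact ((hη.measurable l _ (hk₀ (k + k₀) (by omega))).sub
      (hη.measurable l _ hτ)).const_smul (((k + k₀ : ℕ) : ℝ) + 1)
  · rw [tendsto_pi_nhds]
    intro x
    exact (tendsto_add_atTop_iff_nat k₀).2
      (tendsto_seq_of_hasFDerivAt (hη.hasFDerivAt_η hτ l x) v)

/-- The likelihood involves the derivative at individual points, the assumptions the derivative in
`L²`. The same difference quotients converge pointwise to the former and, along a subsequence,
almost everywhere to the latter. -/
theorem SmoothnessAssumption.Dηpt_ae_eq {τ : Param p H} (hτ : τ ∈ Nθ ×ˢ Nh) (l : Fin m)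
    (v : Param p H) :
    (fun x => M.Dηpt l x τ v) =ᵐ[M.law l M.τ₀] (fderiv ℝ (M.ηL2 l) τ v : Lp ℝ 2 _) := by
  have h1 := tendsto_seq_of_hasFDerivAt (hη.hasFDerivAt_ηL2 hτ l) v
  obtain ⟨s, hs, hae⟩ := exists_tendsto_ae_of_tendsto_Lp h1
  obtain ⟨k₀, hk₀⟩ := eventually_atTop.1 (hη.eventually_mem hτ v)
  have h2 : ∀ᵐ x ∂(M.law l M.τ₀), ∀ k ≥ k₀,
      ((((k : ℝ) + 1) • (M.ηL2 l (τ + ((k : ℝ) + 1)⁻¹ • v) - M.ηL2 l τ) : Lp ℝ 2 _) : X l → ℝ) x =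
      ((k : ℝ) + 1) • (M.η l (τ + ((k : ℝ) + 1)⁻¹ • v) x - M.η l τ x) := by
    rw [ae_all_iff]
    intro k
    by_cases hk : k ≥ k₀
    · filter_upwards [Lp.coeFn_smul ((k : ℝ) + 1)
          (M.ηL2 l (τ + ((k : ℝ) + 1)⁻¹ • v) - M.ηL2 l τ),
        Lp.coeFn_sub (M.ηL2 l (τ + ((k : ℝ) + 1)⁻¹ • v)) (M.ηL2 l τ),
        hη.coeFn_ηL2 (hk₀ k hk) l, hη.coeFn_ηL2 hτ l] with x e1 e2 e3 e4 _
      rw [e1, Pi.smul_apply, e2, Pi.sub_apply, e3, e4]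
    · exact ae_of_all _ fun x h => absurd h hk
  filter_upwards [hae, h2] with x hx hx2
  have h3 := (tendsto_seq_of_hasFDerivAt (hη.hasFDerivAt_η hτ l x) v).comp
    hs.tendsto_atTop
  refine tendsto_nhds_unique h3 (hx.congr' ?_)
  filter_upwards [eventually_ge_atTop k₀] with k hk
  exact hx2 _ (hk.trans hs.le_apply)

theorem SmoothnessAssumption.fderiv_mem_L20 {τ : Param p H} (hτ : τ ∈ Nθ ×ˢ Nh) (l : Fin m)
    (v : Param p H) : fderiv ℝ (M.ηL2 l) τ v ∈ L20 (M.law l M.τ₀) := by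
  have h1 := tendsto_seq_of_hasFDerivAt (hη.hasFDerivAt_ηL2 hτ l) v
  refine (Submodule.isClosed_orthogonal _).mem_of_tendsto h1 ?_
  filter_upwards [hη.eventually_mem hτ v] with k hk
  exact Submodule.smul_mem _ _ (Submodule.sub_mem _ (hη.mem_L20 l _ hk) (hη.mem_L20 l _ hτ))

theorem SmoothnessAssumption.memLp_Dηpt {τ : Param p H} (hτ : τ ∈ Nθ ×ˢ Nh) (l : Fin m)
    (v : Param p H) : MemLp (fun x => M.Dηpt l x τ v) 2 (M.law l M.τ₀) :=
  (memLp_congr_ae (hη.Dηpt_ae_eq hτ l v)).2 (Lp.memLp _)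

theorem SmoothnessAssumption.integral_Dηpt {τ : Param p H} (hτ : τ ∈ Nθ ×ˢ Nh) (l : Fin m)
    (v : Param p H) : ∫ x, M.Dηpt l x τ v ∂(M.law l M.τ₀) = 0 := by
  rw [integral_congr_ae (hη.Dηpt_ae_eq hτ l v)]
  exact integral_L20 _ ⟨_, hη.fderiv_mem_L20 hτ l v⟩

theorem SmoothnessAssumption.measurable_dev {τ : Param p H} (hτ : τ ∈ Nθ ×ˢ Nh) (l : Fin m) :
    Measurable (M.dev l τ) := (hη.measurable l τ hτ).sub (hη.measurable l _ hη.mem)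

theorem SmoothnessAssumption.sub_ae_eq {τ τ' : Param p H} (hτ : τ ∈ Nθ ×ˢ Nh)
    (hτ' : τ' ∈ Nθ ×ˢ Nh) (l : Fin m) :
    (fun x => M.η l τ x - M.η l τ' x) =ᵐ[M.law l M.τ₀]
      (M.ηL2 l τ - M.ηL2 l τ' : Lp ℝ 2 _) := by
  filter_upwards [Lp.coeFn_sub (M.ηL2 l τ) (M.ηL2 l τ'), hη.coeFn_ηL2 hτ l,
    hη.coeFn_ηL2 hτ' l] with x e1 e2 e3
  rw [e1, Pi.sub_apply, e2, e3]

theorem SmoothnessAssumption.memLp_sub {τ τ' : Param p H} (hτ : τ ∈ Nθ ×ˢ Nh)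
    (hτ' : τ' ∈ Nθ ×ˢ Nh) (l : Fin m) :
    MemLp (fun x => M.η l τ x - M.η l τ' x) 2 (M.law l M.τ₀) :=
  (memLp_congr_ae (hη.sub_ae_eq hτ hτ' l)).2 (Lp.memLp _)

theorem SmoothnessAssumption.integral_sub {τ τ' : Param p H} (hτ : τ ∈ Nθ ×ˢ Nh)
    (hτ' : τ' ∈ Nθ ×ˢ Nh) (l : Fin m) :
    ∫ x, (M.η l τ x - M.η l τ' x) ∂(M.law l M.τ₀) = 0 := by
  rw [integral_congr_ae (hη.sub_ae_eq hτ hτ' l)]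
  exact integral_L20 _ ⟨_, Submodule.sub_mem _ (hη.mem_L20 l _ hτ) (hη.mem_L20 l _ hτ')⟩

theorem SmoothnessAssumption.integral_sub_sq {τ τ' : Param p H} (hτ : τ ∈ Nθ ×ˢ Nh)
    (hτ' : τ' ∈ Nθ ×ˢ Nh) (l : Fin m) :
    ∫ x, (M.η l τ x - M.η l τ' x) ^ 2 ∂(M.law l M.τ₀) = ‖M.ηL2 l τ - M.ηL2 l τ'‖ ^ 2 :=
  integral_sq_eq_norm_sq (hη.sub_ae_eq hτ hτ' l)

end basic

section tilting

variable (hη : M.SmoothnessAssumption Nθ Nh)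

theorem base_ne_zero [∀ l, IsProbabilityMeasure (M.law l M.τ₀)] (l : Fin m) : M.base l ≠ 0 := by
  intro h
  have h1 : M.law l M.τ₀ = 0 := by simp [law, h]
  exact IsProbabilityMeasure.ne_zero (M.law l M.τ₀) h1

include hη

theorem SmoothnessAssumption.law_eq_tilted {τ : Param p H} (l : Fin m) :
    M.law l τ = (M.law l M.τ₀).tilted (M.dev l τ) := by
  rw [law, law, tilted_tilted (hη.integrable l _ hη.mem)]
  congr 1
  ext x
  simp [dev]

theorem SmoothnessAssumption.integrable_exp_dev {τ : Param p H} (hτ : τ ∈ Nθ ×ˢ Nh) (l : Fin m) :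
    Integrable (fun x => Real.exp (M.dev l τ x)) (M.law l M.τ₀) := by
  rw [law, integrable_tilted_iff (hη.integrable l _ hη.mem)]
  refine (hη.integrable l τ hτ).congr (ae_of_all _ fun x => ?_)
  simp [dev, ← Real.exp_add]

theorem SmoothnessAssumption.log_integral_sub [∀ l, IsProbabilityMeasure (M.law l M.τ₀)] {τ : Param p H} (hτ : τ ∈ Nθ ×ˢ Nh) (l : Fin m) :
    Real.log (∫ x, Real.exp (M.η l τ x) ∂(M.base l))
      - Real.log (∫ x, Real.exp (M.η l M.τ₀ x) ∂(M.base l)) =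
    logZ (M.law l M.τ₀) (M.dev l τ) := by
  have : NeZero (M.base l) := ⟨base_ne_zero l⟩
  have h1 := integral_exp_pos (hη.integrable l τ hτ)
  have h2 := integral_exp_pos (hη.integrable l _ hη.mem)
  rw [logZ, law, integral_exp_tilted, ← Real.log_div h1.ne' h2.ne']
  congr 3
  ext x
  simp [dev]

end tilting

/-! ### Bounds for the densities -/

theorem variance_indicator {Y : Type*} [MeasurableSpace Y] (Q : Measure Y) [IsProbabilityMeasure Q]
    {B : Set Y} (hB : MeasurableSet B) :
    Var[B.indicator fun _ => (1 : ℝ); Q] = Q.real B * Q.real Bᶜ := by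
  have h2 : MemLp (B.indicator fun _ => (1 : ℝ)) 2 Q := memLp_indicator_const 2 hB 1 (by simp)
  have h3 : (B.indicator fun _ => (1 : ℝ)) ^ 2 = B.indicator fun _ => (1 : ℝ) := by
    ext x
    by_cases hx : x ∈ B <;> simp [hx]
  rw [variance_eq_sub h2, h3, integral_indicator_const _ hB, probReal_compl_eq_one_sub hB]
  simp
  ring

theorem V_self_eq_sum_variance {τ : Param p H} {F : ∀ l, X l → ℝ}
    (hF : ∀ l, Measurable (F l)) : M.V τ F F = ∑ l, Var[F l; M.law l τ] :=
  Finset.sum_congr rfl fun l _ => covariance_self (hF l).aemeasurable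

/-- The variance comparison is tested on the centred indicator of `B` in sample `l` and zero in the
others. `L²` classes fix functions only up to null sets of the true law, which suffices since the
law at `τ` is absolutely continuous with respect to it. -/
theorem indicator_variance_bounds [∀ l, IsProbabilityMeasure (M.law l M.τ₀)]
    (hη : M.SmoothnessAssumption Nθ Nh) {τ : Param p H} (hτ : τ ∈ Nθ ×ˢ Nh) {C₃ C₄ : ℝ}
    (h : ∀ f : ∀ l, L20 (M.law l M.τ₀),
      let F : ∀ l, X l → ℝ := fun l => ((f l : Lp ℝ 2 (M.law l M.τ₀)) : X l → ℝ)
      C₃ * M.V M.τ₀ F F ≤ M.V τ F F ∧ M.V τ F F ≤ C₄ * M.V M.τ₀ F F) (l : Fin m)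
    {B : Set (X l)} (hB : MeasurableSet B) :
    C₃ * ((M.law l M.τ₀).real B * (M.law l M.τ₀).real Bᶜ) ≤
      (M.law l τ).real B * (M.law l τ).real Bᶜ ∧
    (M.law l τ).real B * (M.law l τ).real Bᶜ ≤
      C₄ * ((M.law l M.τ₀).real B * (M.law l M.τ₀).real Bᶜ) := by
  have hQ : IsProbabilityMeasure (M.law l τ) := by
    rw [hη.law_eq_tilted]
    exact isProbabilityMeasure_tilted (hη.integrable_exp_dev hτ l)
  have hac : ∀ l, M.law l τ ≪ M.law l M.τ₀ := fun l => by
    rw [hη.law_eq_tilted]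
    exact tilted_absolutelyContinuous _ _
  set c := (M.law l M.τ₀).real B with hc
  set g : X l → ℝ := fun x => B.indicator (fun _ => (1 : ℝ)) x - c with hg
  have hgm : MemLp g 2 (M.law l M.τ₀) :=
    (memLp_indicator_const 2 hB (1 : ℝ) (by simp)).sub (memLp_const c)
  have hg0 : hgm.toLp g ∈ L20 (M.law l M.τ₀) := by
    rw [Submodule.mem_orthogonal_singleton_iff_inner_right, inner_eq_integral_mul]
    have e1 : ∫ x, (Lp.const 2 (M.law l M.τ₀) (1 : ℝ) : X l → ℝ) x * hgm.toLp g x ∂(M.law l M.τ₀)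
        = ∫ x, g x ∂(M.law l M.τ₀) := by
      refine integral_congr_ae ?_
      filter_upwards [Lp.coeFn_const (p := 2) (μ := M.law l M.τ₀) (1 : ℝ), hgm.coeFn_toLp]
        with x h1 h2
      rw [h1, h2]
      simp
    rw [e1, hg, MeasureTheory.integral_sub ((integrable_const _).indicator hB) (integrable_const _),
      integral_indicator_const _ hB]
    simp [hc]
  let f : ∀ l, L20 (M.law l M.τ₀) := Pi.single l ⟨_, hg0⟩
  have hfm : ∀ k, Measurable ((f k : Lp ℝ 2 (M.law k M.τ₀)) : X k → ℝ) := fun k =>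
    (Lp.stronglyMeasurable _).measurable
  have key : ∀ σ : Param p H, (∀ l, M.law l σ ≪ M.law l M.τ₀) → IsProbabilityMeasure (M.law l σ) →
      M.V σ (fun l => ((f l : Lp ℝ 2 (M.law l M.τ₀)) : X l → ℝ))
        (fun l => ((f l : Lp ℝ 2 (M.law l M.τ₀)) : X l → ℝ)) =
      (M.law l σ).real B * (M.law l σ).real Bᶜ := by
    intro σ hσ hp
    rw [V_self_eq_sum_variance hfm, Finset.sum_eq_single l]
    · have e1 : ((f l : Lp ℝ 2 (M.law l M.τ₀)) : X l → ℝ) =ᵐ[M.law l σ]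
          fun x => B.indicator (fun _ => (1 : ℝ)) x - c := by
        have : f l = ⟨_, hg0⟩ := Pi.single_eq_same _ _
        rw [this]
        exact (hσ l).ae_eq hgm.coeFn_toLp
      rw [variance_congr e1, variance_sub_const
        (stronglyMeasurable_const.indicator hB).aestronglyMeasurable, variance_indicator _ hB]
    · intro k _ hk
      have e1 : ((f k : Lp ℝ 2 (M.law k M.τ₀)) : X k → ℝ) =ᵐ[M.law k σ] 0 := by
        have : f k = 0 := Pi.single_eq_of_ne hk _
        rw [this]
        exact (hσ k).ae_eq (Lp.coeFn_zero _ _ _)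
      rw [variance_congr e1, variance_zero]
    · simp
  have h1 := h f
  simp only at h1
  rw [key τ hac hQ, key M.τ₀ (fun l => Measure.AbsolutelyContinuous.rfl) inferInstance] at h1
  exact h1

/-- Injectivity of `L_h` yields a nonzero function of mean zero, which can be neither nonpositive
nor positive almost everywhere. Such an event is what the lower density bound needs. -/
theorem exists_nontrivial_event [∀ l, IsProbabilityMeasure (M.law l M.τ₀)] {L : M.Ops}
    (hL : M.NormAssumption L) (hinf : ¬ FiniteDimensional ℝ H) (l : Fin m) :
    ∃ S : Set (X l), MeasurableSet S ∧ 0 < (M.law l M.τ₀).real S ∧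
      0 < (M.law l M.τ₀).real Sᶜ := by
  obtain ⟨h, hh⟩ : ∃ h : H, h ≠ 0 := by
    by_contra! hall
    have : Subsingleton H := ⟨fun a b => by rw [hall a, hall b]⟩
    exact hinf inferInstance
  set f := L.Lh l h with hf
  have hf0 : f ≠ 0 := fun h0 => hh (hL.injh l (by rw [← hf, h0, map_zero]))
  set F : X l → ℝ := ((f : Lp ℝ 2 (M.law l M.τ₀)) : X l → ℝ) with hF
  have hFm : Measurable F := (Lp.stronglyMeasurable _).measurable
  have hFi : Integrable F (M.law l M.τ₀) := (Lp.memLp _).integrable (by norm_num)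
  have hF0 : ∫ x, F x ∂(M.law l M.τ₀) = 0 := integral_L20 _ f
  have hne : ¬ F =ᵐ[M.law l M.τ₀] 0 := fun h0 =>
    hf0 (Subtype.ext ((Lp.eq_zero_iff_ae_eq_zero).2 h0))
  have hS : MeasurableSet {x | 0 < F x} := measurableSet_lt measurable_const hFm
  refine ⟨{x | 0 < F x}, hS, ?_, ?_⟩
  · refine lt_of_le_of_ne measureReal_nonneg fun h0 => hne ?_
    rw [eq_comm, measureReal_eq_zero_iff, measure_eq_zero_iff_ae_notMem] at h0
    have h1 : 0 ≤ᵐ[M.law l M.τ₀] fun x => -F x := by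
      filter_upwards [h0] with x hx
      have : F x ≤ 0 := not_lt.1 hx
      simpa using this
    have h2 := (integral_eq_zero_iff_of_nonneg_ae h1 hFi.neg).1 (by rw [integral_neg, hF0, neg_zero])
    filter_upwards [h2] with x hx
    simpa using hx
  · refine lt_of_le_of_ne measureReal_nonneg fun h0 => hne ?_
    rw [eq_comm, measureReal_eq_zero_iff, measure_eq_zero_iff_ae_notMem] at h0
    have h1 : 0 ≤ᵐ[M.law l M.τ₀] F := by
      filter_upwards [h0] with x hx
      have : 0 < F x := by simpa using hx
      exact this.le
    exact (integral_eq_zero_iff_of_nonneg_ae h1 hFi).1 hF0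

/-- The densities of the laws of the neighbourhood relative to the true law are uniformly bounded
from above and below. -/
theorem exists_density_bounds [∀ l, IsProbabilityMeasure (M.law l M.τ₀)]
    (hη : M.SmoothnessAssumption Nθ Nh) {L : M.Ops} (hL : M.NormAssumption L)
    (hinf : ¬ FiniteDimensional ℝ H) (hV : M.WeightAssumption Nθ Nh) :
    ∃ c₁ c₂ : ℝ, 0 < c₁ ∧ c₁ ≤ 1 ∧ 1 ≤ c₂ ∧ ∀ l, ∀ τ ∈ Nθ ×ˢ Nh, ∀ᵐ x ∂(M.law l M.τ₀),
      c₁ ≤ Real.exp (M.dev l τ x - logZ (M.law l M.τ₀) (M.dev l τ)) ∧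
      Real.exp (M.dev l τ x - logZ (M.law l M.τ₀) (M.dev l τ)) ≤ c₂ := by
  obtain ⟨C₃, C₄, hC₃, hC₄, h⟩ := hV
  choose S hS hS1 hS2 using fun l => exists_nontrivial_event hL hinf l
  let κ : Fin m → ℝ := fun l => min ((M.law l M.τ₀).real (S l)) ((M.law l M.τ₀).real (S l)ᶜ)
  have hκ : ∀ l, 0 < κ l := fun l => lt_min (hS1 l) (hS2 l)
  have key := fun l τ (hτ : τ ∈ Nθ ×ˢ Nh) => density_bounds_of_indicator_variance
    (hη.measurable_dev hτ l) (hη.integrable_exp_dev hτ l) hC₃ hC₄ (hκ l) (hS l) (min_le_left _ _)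
    (min_le_right _ _) (fun B hB => by
      rw [← hη.law_eq_tilted]
      exact indicator_variance_bounds hη hτ (h τ hτ) l hB)
  have hpos : ∀ l, 0 < C₃ * κ l / 2 := fun l => by have := hκ l; positivity
  have hsum : ∀ l, (C₃ * κ l / 2)⁻¹ ≤ 1 + ∑ k, (C₃ * κ k / 2)⁻¹ := fun l => by
    have := Finset.single_le_sum (f := fun k => (C₃ * κ k / 2)⁻¹)
      (fun k _ => (inv_pos.2 (hpos k)).le) (Finset.mem_univ l)
    linarith
  have hs0 : 0 ≤ ∑ k, (C₃ * κ k / 2)⁻¹ := Finset.sum_nonneg fun k _ => (inv_pos.2 (hpos k)).le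
  refine ⟨(1 + ∑ k, (C₃ * κ k / 2)⁻¹)⁻¹, 2 + 2 * C₄ * (1 + ∑ k, (C₃ * κ k / 2)⁻¹), by positivity,
    inv_le_one_of_one_le₀ (by linarith), by nlinarith, fun l τ hτ => ?_⟩
  filter_upwards [key l τ hτ] with x hx
  refine ⟨le_trans ?_ hx.1, hx.2.trans ?_⟩
  · exact inv_le_of_inv_le₀ (hpos l) (hsum l)
  · rw [div_eq_mul_inv]
    have := mul_le_mul_of_nonneg_left (hsum l) (by positivity : 0 ≤ 2 * C₄)
    linarith

/-! ### Geometry of the `L²`-valued map -/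

theorem V_self_eq_sum_norm_sq [∀ l, IsProbabilityMeasure (M.law l M.τ₀)] {F : ∀ l, X l → ℝ}
    {f : ∀ l, Lp ℝ 2 (M.law l M.τ₀)} (hf : ∀ l, f l ∈ L20 (M.law l M.τ₀))
    (h : ∀ l, F l =ᵐ[M.law l M.τ₀] f l) : M.V M.τ₀ F F = ∑ l, ‖f l‖ ^ 2 := by
  refine Finset.sum_congr rfl fun l _ => ?_
  have hm : Measurable (f l : X l → ℝ) := (Lp.stronglyMeasurable _).measurable
  rw [covariance_self (hm.aemeasurable.congr (h l).symm), variance_congr (h l),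
    ← covariance_self hm.aemeasurable, covariance_L20 _ (hf l) (hf l), real_inner_self_eq_norm_sq]

/-- The constants of the assumption on the derivatives, in terms of the `L²` norms. -/
theorem DerivativeAssumption.norm_bounds [∀ l, IsProbabilityMeasure (M.law l M.τ₀)]
    (hη : M.SmoothnessAssumption Nθ Nh) {L : M.Ops} (hD : M.DerivativeAssumption L Nθ Nh) :
    ∃ C₁ C₂ Cd : ℝ, 0 < C₁ ∧ 0 < C₂ ∧ 0 < Cd ∧ Cd < 2 * C₁ ∧
      (∀ τ ∈ Nθ ×ˢ Nh, ∀ v : Param p H, C₁ * L.q v ≤ ∑ l, ‖fderiv ℝ (M.ηL2 l) τ v‖ ^ 2 ∧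
        ∑ l, ‖fderiv ℝ (M.ηL2 l) τ v‖ ^ 2 ≤ C₂ * L.q v) ∧
      (∀ τ₁ ∈ Nθ ×ˢ Nh, ∀ τ₂ ∈ Nθ ×ˢ Nh, ∀ v : Param p H,
        ∑ l, ‖fderiv ℝ (M.ηL2 l) τ₁ v - fderiv ℝ (M.ηL2 l) τ₂ v‖ ^ 2 ≤ Cd * L.q v) := by
  obtain ⟨C₁, C₂, Cd, h1, h2, h3, h4, h5, h6⟩ := hD
  refine ⟨C₁, C₂, Cd, h1, h2, h3, h4, fun τ hτ v => ?_, fun τ₁ hτ₁ τ₂ hτ₂ v => ?_⟩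
  · have h := h5 τ hτ v
    rwa [Ops.V_app_self, V_self_eq_sum_norm_sq (F := M.Dη τ v) (fun l => hη.fderiv_mem_L20 hτ l v)
      (fun l => EventuallyEq.rfl)] at h
  · have h := h6 τ₁ hτ₁ τ₂ hτ₂ v
    rwa [Ops.V_app_self, V_self_eq_sum_norm_sq (F := M.Dη τ₁ v - M.Dη τ₂ v)
      (fun l => Submodule.sub_mem _ (hη.fderiv_mem_L20 hτ₁ l v) (hη.fderiv_mem_L20 hτ₂ l v))
      (fun l => (Lp.coeFn_sub _ _).symm)] at h

theorem sub_mem_Icc_of_hasDerivAt {f f' : ℝ → ℝ} {lo hi : ℝ}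
    (h : ∀ t ∈ Set.Icc (0 : ℝ) 1, HasDerivAt f (f' t) t)
    (hb : ∀ t ∈ Set.Icc (0 : ℝ) 1, lo ≤ f' t ∧ f' t ≤ hi) : lo ≤ f 1 - f 0 ∧ f 1 - f 0 ≤ hi := by
  obtain ⟨c, hc, he⟩ := exists_hasDerivAt_eq_slope f f' zero_lt_one
    (fun t ht => (h t ht).continuousAt.continuousWithinAt) fun t ht => h t ⟨ht.1.le, ht.2.le⟩
  have := hb c ⟨hc.1.le, hc.2.le⟩
  rw [he] at this
  simpa using this

/-- Two-sided bound for the increments of `η` from bounds on its derivatives. -/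
theorem SmoothnessAssumption.increment_bounds (hη : M.SmoothnessAssumption Nθ Nh) {L : M.Ops}
    {C₁ C₂ Cd : ℝ}
    (h1 : ∀ τ ∈ Nθ ×ˢ Nh, ∀ v : Param p H, C₁ * L.q v ≤ ∑ l, ‖fderiv ℝ (M.ηL2 l) τ v‖ ^ 2 ∧
        ∑ l, ‖fderiv ℝ (M.ηL2 l) τ v‖ ^ 2 ≤ C₂ * L.q v)
    (h2 : ∀ τ₁ ∈ Nθ ×ˢ Nh, ∀ τ₂ ∈ Nθ ×ˢ Nh, ∀ v : Param p H,
        ∑ l, ‖fderiv ℝ (M.ηL2 l) τ₁ v - fderiv ℝ (M.ηL2 l) τ₂ v‖ ^ 2 ≤ Cd * L.q v)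
    {v : Param p H} (hv : M.τ₀ + v ∈ Nθ ×ˢ Nh) :
    (C₁ - Cd / 2) * L.q v ≤ ∑ l, ‖M.ηL2 l (M.τ₀ + v) - M.ηL2 l M.τ₀‖ ^ 2 ∧
      ∑ l, ‖M.ηL2 l (M.τ₀ + v) - M.ηL2 l M.τ₀‖ ^ 2 ≤ C₂ * L.q v := by
  have hseg : ∀ t ∈ Set.Icc (0 : ℝ) 1, M.τ₀ + t • v ∈ Nθ ×ˢ Nh := fun t ht => by
    have := hη.convex.add_smul_sub_mem hη.mem hv ht
    simpa using this
  have hder : ∀ l, ∀ t ∈ Set.Icc (0 : ℝ) 1,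
      HasDerivAt (fun t : ℝ => M.ηL2 l (M.τ₀ + t • v)) (fderiv ℝ (M.ηL2 l) (M.τ₀ + t • v) v) t := by
    intro l t ht
    have e1 : HasDerivAt (fun t : ℝ => M.τ₀ + t • v) v t := by
      simpa using ((hasDerivAt_id t).smul_const v).const_add M.τ₀
    exact (hη.hasFDerivAt_ηL2 (hseg t ht) l).comp_hasDerivAt t e1
  -- Polarization: twice the inner product is the sum of the squared norms minus the squared norm of
  -- the difference, hence at least `(2 C₁ - Cd) q v`. The mean value theorem then replaces one
  -- derivative, and afterwards the other, by the increment of `η`.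
  have hin : ∀ s ∈ Set.Icc (0 : ℝ) 1, ∀ t ∈ Set.Icc (0 : ℝ) 1,
      (C₁ - Cd / 2) * L.q v ≤ ∑ l, inner ℝ (fderiv ℝ (M.ηL2 l) (M.τ₀ + t • v) v)
        (fderiv ℝ (M.ηL2 l) (M.τ₀ + s • v) v) ∧
      ∑ l, inner ℝ (fderiv ℝ (M.ηL2 l) (M.τ₀ + t • v) v)
        (fderiv ℝ (M.ηL2 l) (M.τ₀ + s • v) v) ≤ C₂ * L.q v := by
    intro s hs t ht
    have b1 := h1 _ (hseg s hs) v
    have b2 := h1 _ (hseg t ht) v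
    have b3 := h2 _ (hseg t ht) _ (hseg s hs) v
    have e1 : ∑ l, ‖fderiv ℝ (M.ηL2 l) (M.τ₀ + t • v) v - fderiv ℝ (M.ηL2 l) (M.τ₀ + s • v) v‖ ^ 2
        = ∑ l, ‖fderiv ℝ (M.ηL2 l) (M.τ₀ + t • v) v‖ ^ 2
          + ∑ l, ‖fderiv ℝ (M.ηL2 l) (M.τ₀ + s • v) v‖ ^ 2
          - 2 * ∑ l, inner ℝ (fderiv ℝ (M.ηL2 l) (M.τ₀ + t • v) v)
        (fderiv ℝ (M.ηL2 l) (M.τ₀ + s • v) v) := by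
      rw [Finset.mul_sum, ← Finset.sum_add_distrib, ← Finset.sum_sub_distrib]
      refine Finset.sum_congr rfl fun l _ => ?_
      rw [norm_sub_sq_real]
      ring
    have e2 : 0 ≤ ∑ l, ‖fderiv ℝ (M.ηL2 l) (M.τ₀ + t • v) v
        - fderiv ℝ (M.ηL2 l) (M.τ₀ + s • v) v‖ ^ 2 := by positivity
    constructor <;> linarith
  have hmid : ∀ t ∈ Set.Icc (0 : ℝ) 1,
      (C₁ - Cd / 2) * L.q v ≤ ∑ l, inner ℝ (M.ηL2 l (M.τ₀ + v) - M.ηL2 l M.τ₀)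
        (fderiv ℝ (M.ηL2 l) (M.τ₀ + t • v) v) ∧
      ∑ l, inner ℝ (M.ηL2 l (M.τ₀ + v) - M.ηL2 l M.τ₀)
        (fderiv ℝ (M.ηL2 l) (M.τ₀ + t • v) v) ≤ C₂ * L.q v := by
    intro t ht
    have := sub_mem_Icc_of_hasDerivAt
      (f := fun s => ∑ l, inner ℝ (fderiv ℝ (M.ηL2 l) (M.τ₀ + t • v) v) (M.ηL2 l (M.τ₀ + s • v)))
      (f' := fun s => ∑ l, inner ℝ (fderiv ℝ (M.ηL2 l) (M.τ₀ + t • v) v)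
        (fderiv ℝ (M.ηL2 l) (M.τ₀ + s • v) v)) (fun s hs => HasDerivAt.fun_sum fun l _ => by
          simpa using (hasDerivAt_const s _).inner ℝ (hder l s hs)) (fun s hs => hin s hs t ht)
    simp only [one_smul, zero_smul, add_zero, ← Finset.sum_sub_distrib, ← inner_sub_right] at this
    simpa only [real_inner_comm] using this
  have := sub_mem_Icc_of_hasDerivAt
      (f := fun s => ∑ l, inner ℝ (M.ηL2 l (M.τ₀ + v) - M.ηL2 l M.τ₀) (M.ηL2 l (M.τ₀ + s • v)))
      (f' := fun s => ∑ l, inner ℝ (M.ηL2 l (M.τ₀ + v) - M.ηL2 l M.τ₀)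
        (fderiv ℝ (M.ηL2 l) (M.τ₀ + s • v) v)) (fun s hs => HasDerivAt.fun_sum fun l _ => by
          simpa using (hasDerivAt_const s _).inner ℝ (hder l s hs)) (fun s hs => hmid s hs)
  simp only [one_smul, zero_smul, add_zero, ← Finset.sum_sub_distrib, ← inner_sub_right] at this
  simpa only [real_inner_self_eq_norm_sq] using this

end Model

/-! ### Uniform bounds near the true parameter -/

namespace Model

variable {p m : ℕ} {X : Fin m → Type u} [∀ l, MeasurableSpace (X l)]
  {H : Type v} [NormedAddCommGroup H] [InnerProductSpace ℝ H] {M : Model p m X H}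
  {Nθ : Set (EuclideanSpace ℝ (Fin p))} {Nh : Set H}

/-- The increment of the log normalizing constants from the true parameter to `τ₀ + v`. -/
def excess (M : Model p m X H) (v : Param p H) : ℝ :=
  ∑ l, logZ (M.law l M.τ₀) (M.dev l (M.τ₀ + v))

/-- Bounds on a convex neighbourhood of the true parameter, up to constants in terms of the
quadratic form `L.q`. -/
structure LocalBounds (M : Model p m X H) (L : M.Ops) (Nθ : Set (EuclideanSpace ℝ (Fin p)))
    (Nh : Set H) (c C b c₂ : ℝ) : Prop where
  c_pos : 0 < c
  C_pos : 0 < C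
  b_pos : 0 < b
  one_le : 1 ≤ c₂
  excess_ge : ∀ v, M.τ₀ + v ∈ Nθ ×ˢ Nh → c * L.q v ≤ M.excess v
  excess_le : ∀ v, M.τ₀ + v ∈ Nθ ×ˢ Nh → M.excess v ≤ b
  deriv_ge : ∀ w, c * L.q w ≤ ∑ l, ∫ x, M.Dηpt l x M.τ₀ w ^ 2 ∂(M.law l M.τ₀)
  deriv_le : ∀ w, ∑ l, ∫ x, M.Dηpt l x M.τ₀ w ^ 2 ∂(M.law l M.τ₀) ≤ C * L.q w
  rem_le : ∀ v, M.τ₀ + v ∈ Nθ ×ˢ Nh → ∑ l, ∫ x, M.rem l v x ^ 2 ∂(M.law l M.τ₀) ≤ C * L.q v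
  gap_le : ∀ v, M.τ₀ + v ∈ Nθ ×ˢ Nh → ∀ w,
    ∑ l, ∫ x, M.gap l v w x ^ 2 ∂(M.law l M.τ₀) ≤ C * L.q w
  density_le : ∀ l, ∀ τ ∈ Nθ ×ˢ Nh, ∀ᵐ x ∂(M.law l M.τ₀),
    Real.exp (M.dev l τ x - logZ (M.law l M.τ₀) (M.dev l τ)) ≤ c₂
  tilted_deriv_ge : ∀ v, M.τ₀ + v ∈ Nθ ×ˢ Nh → ∀ w,
    -(C * √(L.q v) * √(L.q w)) ≤
      ∑ l, ∫ x, M.Dηpt l x (M.τ₀ + v) w ∂((M.law l M.τ₀).tilted (M.dev l (M.τ₀ + v)))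

section

variable (hη : M.SmoothnessAssumption Nθ Nh)

include hη

theorem SmoothnessAssumption.gap_ae_eq {v : Param p H} (hv : M.τ₀ + v ∈ Nθ ×ˢ Nh) (l : Fin m)
    (w : Param p H) : M.gap l v w =ᵐ[M.law l M.τ₀]
      (fderiv ℝ (M.ηL2 l) M.τ₀ w - fderiv ℝ (M.ηL2 l) (M.τ₀ + v) w : Lp ℝ 2 _) := by
  filter_upwards [hη.Dηpt_ae_eq hη.mem l w, hη.Dηpt_ae_eq hv l w,
    Lp.coeFn_sub (fderiv ℝ (M.ηL2 l) M.τ₀ w) (fderiv ℝ (M.ηL2 l) (M.τ₀ + v) w)] with x h1 h2 h3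
  rw [h3, Pi.sub_apply, ← h1, ← h2, gap]

theorem SmoothnessAssumption.rem_ae_eq {v : Param p H} (hv : M.τ₀ + v ∈ Nθ ×ˢ Nh) (l : Fin m) :
    M.rem l v =ᵐ[M.law l M.τ₀]
      (M.ηL2 l (M.τ₀ + v) - M.ηL2 l M.τ₀ - fderiv ℝ (M.ηL2 l) M.τ₀ v : Lp ℝ 2 _) := by
  filter_upwards [hη.Dηpt_ae_eq hη.mem l v, hη.sub_ae_eq hv hη.mem l,
    Lp.coeFn_sub (M.ηL2 l (M.τ₀ + v) - M.ηL2 l M.τ₀) (fderiv ℝ (M.ηL2 l) M.τ₀ v)] with x h1 h2 h3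
  rw [h3, Pi.sub_apply, ← h1, ← h2, rem]

theorem SmoothnessAssumption.measurable_gap {v : Param p H} (hv : M.τ₀ + v ∈ Nθ ×ˢ Nh) (l : Fin m)
    (w : Param p H) : Measurable (M.gap l v w) :=
  (hη.measurable_Dηpt hη.mem l w).sub (hη.measurable_Dηpt hv l w)

theorem SmoothnessAssumption.measurable_rem {v : Param p H} (hv : M.τ₀ + v ∈ Nθ ×ˢ Nh)
    (l : Fin m) : Measurable (M.rem l v) :=
  (hη.measurable_dev hv l).sub (hη.measurable_Dηpt hη.mem l v)

theorem SmoothnessAssumption.memLp_gap {v : Param p H} (hv : M.τ₀ + v ∈ Nθ ×ˢ Nh) (l : Fin m)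
    (w : Param p H) : MemLp (M.gap l v w) 2 (M.law l M.τ₀) :=
  (hη.memLp_Dηpt hη.mem l w).sub (hη.memLp_Dηpt hv l w)

theorem SmoothnessAssumption.memLp_rem {v : Param p H} (hv : M.τ₀ + v ∈ Nθ ×ˢ Nh)
    (l : Fin m) : MemLp (M.rem l v) 2 (M.law l M.τ₀) :=
  (hη.memLp_sub hv hη.mem l).sub (hη.memLp_Dηpt hη.mem l v)

theorem SmoothnessAssumption.integral_gap {v : Param p H} (hv : M.τ₀ + v ∈ Nθ ×ˢ Nh) (l : Fin m)
    (w : Param p H) : ∫ x, M.gap l v w x ∂(M.law l M.τ₀) = 0 := by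
  simp only [gap]
  rw [MeasureTheory.integral_sub ((hη.memLp_Dηpt hη.mem l w).integrable (by norm_num))
    ((hη.memLp_Dηpt hv l w).integrable (by norm_num)), hη.integral_Dηpt hη.mem,
    hη.integral_Dηpt hv, sub_zero]

theorem SmoothnessAssumption.integral_rem {v : Param p H} (hv : M.τ₀ + v ∈ Nθ ×ˢ Nh)
    (l : Fin m) : ∫ x, M.rem l v x ∂(M.law l M.τ₀) = 0 := by
  simp only [rem]
  rw [MeasureTheory.integral_sub ((hη.memLp_sub hv hη.mem l).integrable (by norm_num))
    ((hη.memLp_Dηpt hη.mem l v).integrable (by norm_num)), hη.integral_Dηpt hη.mem,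
    hη.integral_sub hv hη.mem, sub_zero]

end

/-- The entropy bound compares the excess with the squared `L²` increment of `η`, which the
increment bounds compare with `q`. For the tilted derivative, the mean-zero estimate in each sample
is followed by Cauchy–Schwarz over the samples. The summand 1 in the bound for the excess only
ensures that it is positive. -/
theorem exists_localBounds [∀ l, IsProbabilityMeasure (M.law l M.τ₀)]
    (hη : M.SmoothnessAssumption Nθ Nh) {L : M.Ops} (hL : M.NormAssumption L)
    (hinf : ¬ FiniteDimensional ℝ H) (hD : M.DerivativeAssumption L Nθ Nh)
    (hV : M.WeightAssumption Nθ Nh) : ∃ c C b c₂, M.LocalBounds L Nθ Nh c C b c₂ := by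
  obtain ⟨C₁, C₂, Cd, hC₁, hC₂, hCd, hlt, hd1, hd2⟩ := hD.norm_bounds hη
  obtain ⟨c₁, c₂, hc₁, hc₁1, hc₂, hw⟩ := exists_density_bounds hη hL hinf hV
  have hinc := fun v (hv : M.τ₀ + v ∈ Nθ ×ˢ Nh) => hη.increment_bounds hd1 hd2 hv
  have hdev0 : ∀ v, M.τ₀ + v ∈ Nθ ×ˢ Nh → ∀ l,
      ∫ x, M.dev l (M.τ₀ + v) x ∂(M.law l M.τ₀) = 0 := fun v hv l => hη.integral_sub hv hη.mem l
  have hdev2 : ∀ v, M.τ₀ + v ∈ Nθ ×ˢ Nh → ∀ l, MemLp (M.dev l (M.τ₀ + v)) 2 (M.law l M.τ₀) :=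
    fun v hv l => hη.memLp_sub hv hη.mem l
  have hdevsq : ∀ v, M.τ₀ + v ∈ Nθ ×ˢ Nh → ∀ l, ∫ x, M.dev l (M.τ₀ + v) x ^ 2 ∂(M.law l M.τ₀) =
      ‖M.ηL2 l (M.τ₀ + v) - M.ηL2 l M.τ₀‖ ^ 2 := fun v hv l => hη.integral_sub_sq hv hη.mem l
  have hlog : 0 ≤ -Real.log c₁ := by have := Real.log_nonpos hc₁.le hc₁1; linarith
  have hDsq : ∀ τ ∈ Nθ ×ˢ Nh, ∀ l w, ∫ x, M.Dηpt l x τ w ^ 2 ∂(M.law l M.τ₀) =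
      ‖fderiv ℝ (M.ηL2 l) τ w‖ ^ 2 := fun τ hτ l w => integral_sq_eq_norm_sq (hη.Dηpt_ae_eq hτ l w)
  set c := min (c₁ / 2 * (C₁ - Cd / 2)) C₁ with hc
  set C := 4 * C₂ + Cd + c₂ * (1 + c₂) * C₂ with hC
  have hCC : C₂ ≤ C ∧ 4 * C₂ ≤ C ∧ Cd ≤ C ∧ c₂ * (1 + c₂) * C₂ ≤ C := by
    have : 0 < c₂ * (1 + c₂) * C₂ := by positivity
    refine ⟨?_, ?_, ?_, ?_⟩ <;> linarith
  refine ⟨c, C, m * (-Real.log c₁) + 1, c₂, ⟨?_, ?_, ?_, hc₂, fun v hv => ?_, fun v hv => ?_,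
    fun w => ?_, fun w => ?_, fun v hv => ?_, fun v hv w => ?_,
    fun l τ hτ => (hw l τ hτ).mono fun x hx => hx.2, fun v hv w => ?_⟩⟩
  · refine lt_min (mul_pos (by positivity) (by linarith)) hC₁
  · positivity
  · positivity
  · calc c * L.q v ≤ c₁ / 2 * (C₁ - Cd / 2) * L.q v :=
          mul_le_mul_of_nonneg_right (min_le_left _ _) (L.q_nonneg v)
      _ ≤ c₁ / 2 * ∑ l, ‖M.ηL2 l (M.τ₀ + v) - M.ηL2 l M.τ₀‖ ^ 2 := by
          rw [mul_assoc]
          exact mul_le_mul_of_nonneg_left (hinc v hv).1 (by positivity)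
      _ ≤ _ := by
          rw [Finset.mul_sum]
          refine Finset.sum_le_sum fun l _ => ?_
          rw [← hdevsq v hv l]
          exact mul_integral_sq_le_logZ (hη.integrable_exp_dev hv l) (hdev2 v hv l) (hdev0 v hv l)
            hc₁ hc₁1 ((hw l _ hv).mono fun x hx => hx.1)
  · calc M.excess v ≤ ∑ l : Fin m, (-Real.log c₁) := Finset.sum_le_sum fun l _ =>
          logZ_le_neg_log ((hdev2 v hv l).integrable (by norm_num)) (hdev0 v hv l) hc₁
            ((hw l _ hv).mono fun x hx => hx.1)
      _ = m * (-Real.log c₁) := by simp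
      _ ≤ _ := by linarith
  · simp only [hDsq M.τ₀ hη.mem]
    exact (mul_le_mul_of_nonneg_right (min_le_right _ _) (L.q_nonneg w)).trans (hd1 _ hη.mem w).1
  · simp only [hDsq M.τ₀ hη.mem]
    exact (hd1 _ hη.mem w).2.trans (mul_le_mul_of_nonneg_right hCC.1 (L.q_nonneg w))
  · have e1 : ∀ l, ∫ x, M.rem l v x ^ 2 ∂(M.law l M.τ₀) ≤
        2 * ‖M.ηL2 l (M.τ₀ + v) - M.ηL2 l M.τ₀‖ ^ 2 + 2 * ‖fderiv ℝ (M.ηL2 l) M.τ₀ v‖ ^ 2 := by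
      intro l
      rw [integral_sq_eq_norm_sq (hη.rem_ae_eq hv l)]
      have := parallelogram_law_with_norm ℝ (M.ηL2 l (M.τ₀ + v) - M.ηL2 l M.τ₀)
        (fderiv ℝ (M.ηL2 l) M.τ₀ v)
      nlinarith [sq_nonneg ‖M.ηL2 l (M.τ₀ + v) - M.ηL2 l M.τ₀ + fderiv ℝ (M.ηL2 l) M.τ₀ v‖]
    refine (Finset.sum_le_sum fun l _ => e1 l).trans ?_
    rw [Finset.sum_add_distrib, ← Finset.mul_sum, ← Finset.mul_sum]
    have h1 := (hinc v hv).2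
    have h2 := (hd1 _ hη.mem v).2
    have h3 := mul_le_mul_of_nonneg_right hCC.2.1 (L.q_nonneg v)
    linarith
  · have e1 : ∀ l, ∫ x, M.gap l v w x ^ 2 ∂(M.law l M.τ₀) =
        ‖fderiv ℝ (M.ηL2 l) M.τ₀ w - fderiv ℝ (M.ηL2 l) (M.τ₀ + v) w‖ ^ 2 := fun l =>
      integral_sq_eq_norm_sq (hη.gap_ae_eq hv l w)
    simp only [e1]
    exact (hd2 _ hη.mem _ hv w).trans (mul_le_mul_of_nonneg_right hCC.2.2.1 (L.q_nonneg w))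
  · have e1 : ∀ l, |∫ x, M.Dηpt l x (M.τ₀ + v) w ∂((M.law l M.τ₀).tilted (M.dev l (M.τ₀ + v)))| ≤
        c₂ * (1 + c₂) * (‖M.ηL2 l (M.τ₀ + v) - M.ηL2 l M.τ₀‖ * ‖fderiv ℝ (M.ηL2 l) (M.τ₀ + v) w‖) := by
      intro l
      have h := abs_integral_tilted_le_of_mean_zero (hη.measurable_dev hv l)
        (hη.integrable_exp_dev hv l) (hdev2 v hv l) (hdev0 v hv l) (hη.memLp_Dηpt hv l w)
        (hη.integral_Dηpt hv l w) hc₂ ((hw l _ hv).mono fun x hx => hx.2)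
      rwa [hdevsq v hv, hDsq _ hv, Real.sqrt_sq (norm_nonneg _), Real.sqrt_sq (norm_nonneg _)] at h
    have e2 := Finset.abs_sum_le_sum_abs
      (fun l => ∫ x, M.Dηpt l x (M.τ₀ + v) w ∂((M.law l M.τ₀).tilted (M.dev l (M.τ₀ + v))))
      Finset.univ
    have e3 := Finset.sum_le_sum fun l (_ : l ∈ Finset.univ) => e1 l
    rw [← Finset.mul_sum] at e3
    have e4 := Real.sum_mul_le_sqrt_mul_sqrt Finset.univ
      (fun l => ‖M.ηL2 l (M.τ₀ + v) - M.ηL2 l M.τ₀‖) fun l => ‖fderiv ℝ (M.ηL2 l) (M.τ₀ + v) w‖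
    have e5 : √(∑ l, ‖M.ηL2 l (M.τ₀ + v) - M.ηL2 l M.τ₀‖ ^ 2) *
        √(∑ l, ‖fderiv ℝ (M.ηL2 l) (M.τ₀ + v) w‖ ^ 2) ≤ C₂ * (√(L.q v) * √(L.q w)) := by
      calc _ ≤ √(C₂ * L.q v) * √(C₂ * L.q w) := by
            gcongr
            · exact (hinc v hv).2
            · exact (hd1 _ hv w).2
        _ = √C₂ * √C₂ * (√(L.q v) * √(L.q w)) := by
            rw [Real.sqrt_mul hC₂.le, Real.sqrt_mul hC₂.le]; ring
        _ = _ := by rw [Real.mul_self_sqrt hC₂.le]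
    have e6 : c₂ * (1 + c₂) * (C₂ * (√(L.q v) * √(L.q w))) ≤ C * √(L.q v) * √(L.q w) := by
      have := mul_le_mul_of_nonneg_right hCC.2.2.2 (by positivity : 0 ≤ √(L.q v) * √(L.q w))
      linarith
    have e7 := mul_le_mul_of_nonneg_left (e4.trans e5) (by positivity : 0 ≤ c₂ * (1 + c₂))
    exact neg_le_of_abs_le (e2.trans (e3.trans (e7.trans e6)))

end Model

/-! ### Empirical means -/

section emp

variable {m : ℕ} {X : Fin m → Type u} {Ω : Type w} (ξ : ∀ l, ℕ → Ω → X l) (n : Fin m → ℕ) (ω : Ω)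

/-- The empirical mean over the `l`-th sample. -/
def empMean (l : Fin m) (f : X l → ℝ) : ℝ :=
  (n l : ℝ)⁻¹ * ∑ i ∈ Finset.range (n l), f (ξ l i ω)

variable {ξ n ω} {l : Fin m}

theorem empMean_add (f g : X l → ℝ) :
    empMean ξ n ω l (fun x => f x + g x) = empMean ξ n ω l f + empMean ξ n ω l g := by
  simp only [empMean, Finset.sum_add_distrib, mul_add]

theorem empMean_sub (f g : X l → ℝ) :
    empMean ξ n ω l (fun x => f x - g x) = empMean ξ n ω l f - empMean ξ n ω l g := by
  simp only [empMean, Finset.sum_sub_distrib, mul_sub]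

theorem empMean_const_mul (c : ℝ) (f : X l → ℝ) :
    empMean ξ n ω l (fun x => c * f x) = c * empMean ξ n ω l f := by
  simp only [empMean, ← Finset.mul_sum]
  ring

theorem empMean_const (hn : 0 < n l) (c : ℝ) : empMean ξ n ω l (fun _ => c) = c := by
  have : (n l : ℝ) ≠ 0 := by positivity
  simp only [empMean, Finset.sum_const, Finset.card_range, nsmul_eq_mul]
  field_simp

theorem empMean_mono {f g : X l → ℝ} (h : ∀ i, f (ξ l i ω) ≤ g (ξ l i ω)) :
    empMean ξ n ω l f ≤ empMean ξ n ω l g :=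
  mul_le_mul_of_nonneg_left (Finset.sum_le_sum fun i _ => h i) (by positivity)

theorem tendsto_empMean {f : ℕ → X l → ℝ} {g : X l → ℝ}
    (h : ∀ x, Tendsto (fun k => f k x) atTop (𝓝 (g x))) :
    Tendsto (fun k => empMean ξ n ω l (f k)) atTop (𝓝 (empMean ξ n ω l g)) :=
  (tendsto_finsetSum _ fun i _ => h _).const_mul _

end emp

/-- If a sum of independent empirical means of centred functions is almost surely bounded, then the
functions are bounded from above, and the sum of the bounds is no larger. -/
theorem exists_ae_upper_bounds {m : ℕ} {X : Fin m → Type u} [∀ l, MeasurableSpace (X l)]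
    {Ω : Type w} [MeasurableSpace Ω] {P : Measure Ω} [IsProbabilityMeasure P]
    {Q : ∀ l, Measure (X l)} [∀ l, IsProbabilityMeasure (Q l)] {ξ : ∀ l, ℕ → Ω → X l}
    (hlaw : ∀ l i, HasLaw (ξ l i) (Q l) P) (hindep : iIndepFun (fun j : Fin m × ℕ => ξ j.1 j.2) P)
    {n : Fin m → ℕ} (hn : ∀ l, 0 < n l) {f : ∀ l, X l → ℝ} (hfm : ∀ l, Measurable (f l))
    (hfi : ∀ l, Integrable (f l) (Q l)) (hf0 : ∀ l, ∫ x, f l x ∂(Q l) = 0) {κ : ℝ}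
    (h : ∀ᵐ ω ∂P, ∑ l, empMean ξ n ω l (f l) ≤ κ) :
    ∃ t : Fin m → ℝ, (∀ l, 0 ≤ t l) ∧ (∀ l, ∀ᵐ x ∂(Q l), f l x ≤ t l) ∧ ∑ l, t l ≤ κ := by
  have claim : ∀ s : Fin m → ℝ, (∀ l, Q l {x | s l < f l x} ≠ 0) → ∑ l, s l ≤ κ := by
    intro s hs
    have hmeas : ∀ l, MeasurableSet {x | s l < f l x} := fun l =>
      measurableSet_lt measurable_const (hfm l)
    -- By independence all observations exceed their levels together with positive probability, so
    -- the levels inherit the almost sure inequality. The total sample size serves as a common bound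
    -- for the indices.
    set J : Finset (Fin m × ℕ) := Finset.univ ×ˢ Finset.range (∑ l, n l) with hJ
    have h1 := hindep.measure_inter_preimage_eq_mul J (sets := fun j => {x | s j.1 < f j.1 x})
      (fun j _ => hmeas j.1)
    have h2 : P (⋂ j ∈ J, ξ j.1 j.2 ⁻¹' {x | s j.1 < f j.1 x}) ≠ 0 := by
      rw [h1, Finset.prod_ne_zero_iff]
      intro j _
      rw [← Measure.map_apply_of_aemeasurable (hlaw j.1 j.2).aemeasurable (hmeas j.1),
        (hlaw j.1 j.2).map_eq]
      exact hs j.1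
    obtain ⟨ω, hω, hle⟩ := ((frequently_ae_mem_iff.2 h2).and_eventually h).exists
    refine le_trans (Finset.sum_le_sum fun l _ => ?_) hle
    rw [← empMean_const (ξ := ξ) (ω := ω) (hn l) (s l)]
    refine mul_le_mul_of_nonneg_left (Finset.sum_le_sum fun i hi => ?_) (by positivity)
    have hmem : (l, i) ∈ J := by
      rw [hJ, Finset.mem_product]
      refine ⟨Finset.mem_univ _, ?_⟩
      rw [Finset.mem_range] at hi ⊢
      exact hi.trans_le (Finset.single_le_sum (f := n) (fun _ _ => Nat.zero_le _)
        (Finset.mem_univ l))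
    have := Set.mem_iInter₂.1 hω (l, i) hmem
    exact le_of_lt this
  -- A centred function exceeds every negative level with positive probability. So the essential
  -- suprema are nonnegative, and the admissible level `-1` in the other samples shows that each is
  -- finite.
  have hneg : ∀ l, ∀ s < 0, Q l {x | s < f l x} ≠ 0 := by
    intro l s hs h0
    rw [measure_eq_zero_iff_ae_notMem] at h0
    have h1 : ∫ x, f l x ∂(Q l) ≤ ∫ _, s ∂(Q l) := by
      refine integral_mono_ae (hfi l) (integrable_const _) ?_
      filter_upwards [h0] with x hx
      exact not_lt.1 hx
    rw [hf0] at h1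
    simp at h1
    linarith
  set S : Fin m → Set ℝ := fun l => {s | Q l {x | s < f l x} ≠ 0} with hS
  have hSne : ∀ l, (S l).Nonempty := fun l => ⟨-1, hneg l (-1) (by norm_num)⟩
  have hSbdd : ∀ l, BddAbove (S l) := by
    intro l
    refine ⟨κ + m, fun s hs => ?_⟩
    have h1 := claim (Function.update (fun _ => -1) l s) (fun k => by
      by_cases hk : k = l
      · subst hk; simpa [hS] using hs
      · simpa [hk] using hneg k (-1) (by norm_num))
    have h2 : ∑ k, (Function.update (fun _ => (-1 : ℝ)) l s k + 1) = s + 1 := by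
      rw [Finset.sum_eq_single l]
      · simp
      · intro k _ hk; simp [hk]
      · simp
    rw [Finset.sum_add_distrib] at h2
    simp at h2
    linarith
  refine ⟨fun l => sSup (S l), fun l => ?_, fun l => ?_, ?_⟩
  · refine le_of_forall_lt fun s hs => ?_
    obtain ⟨s', h1, h2⟩ := exists_between hs
    exact h1.trans_le (le_csSup (hSbdd l) (hneg l s' h2))
  · have h1 : ∀ k : ℕ, ∀ᵐ x ∂(Q l), f l x ≤ sSup (S l) + 1 / ((k : ℝ) + 1) := by
      intro k
      have h2 : sSup (S l) + 1 / ((k : ℝ) + 1) ∉ S l := fun hmem => by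
        have := le_csSup (hSbdd l) hmem
        have h3 : 0 < 1 / ((k : ℝ) + 1) := by positivity
        linarith
      have h3 : Q l {x | sSup (S l) + 1 / ((k : ℝ) + 1) < f l x} = 0 := by
        by_contra hne
        exact h2 hne
      rw [measure_eq_zero_iff_ae_notMem] at h3
      filter_upwards [h3] with x hx
      exact not_lt.1 hx
    rw [← ae_all_iff] at h1
    filter_upwards [h1] with x hx
    have h2 : Tendsto (fun k : ℕ => sSup (S l) + 1 / ((k : ℝ) + 1)) atTop (𝓝 (sSup (S l) + 0)) :=
      tendsto_one_div_add_atTop_nhds_zero_nat.const_add _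
    rw [add_zero] at h2
    exact ge_of_tendsto' h2 hx
  · refine le_of_forall_pos_le_add fun ε hε => ?_
    have hδ : 0 < ε / (m + 1) := by positivity
    choose s hs1 hs2 using fun l => exists_lt_of_lt_csSup (hSne l) (sub_lt_self (sSup (S l)) hδ)
    have h1 := claim s hs1
    have h2 : ∑ l, (sSup (S l) - ε / (m + 1)) ≤ ∑ l, s l :=
      Finset.sum_le_sum fun l _ => (hs2 l).le
    rw [Finset.sum_sub_distrib] at h2
    have h3 : ∑ l : Fin m, ε / ((m : ℝ) + 1) ≤ ε := by
      simp only [Finset.sum_const, Finset.card_univ, Fintype.card_fin, nsmul_eq_mul]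
      rw [mul_div_assoc', div_le_iff₀ (by positivity)]
      nlinarith
    linarith

/-! ### Tangents of the convex likelihood -/

namespace Model

variable {p m : ℕ} {X : Fin m → Type u} [∀ l, MeasurableSpace (X l)]
  {H : Type v} [NormedAddCommGroup H] [InnerProductSpace ℝ H] {M : Model p m X H}
  {Nθ : Set (EuclideanSpace ℝ (Fin p))} {Nh : Set H} {L : M.Ops} {c C b c₂ : ℝ}

theorem Ops.continuous_q (L : M.Ops) : Continuous L.q := by
  unfold Ops.q
  fun_prop

theorem Dηpt_sub (l : Fin m) (x : X l) (τ v w : Param p H) :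
    M.Dηpt l x τ (v - w) = M.Dηpt l x τ v - M.Dηpt l x τ w := map_sub _ _ _

theorem continuous_Dηpt (l : Fin m) (x : X l) (τ : Param p H) : Continuous (M.Dηpt l x τ) :=
  (fderiv ℝ (fun σ => M.η l σ x) τ).continuous

section

variable [∀ l, IsProbabilityMeasure (M.law l M.τ₀)] (hη : M.SmoothnessAssumption Nθ Nh)
  (hB : M.LocalBounds L Nθ Nh c C b c₂)

include hη

theorem negLogLik_sub {Ω : Type w} (ξ : ∀ l, ℕ → Ω → X l) (n : Fin m → ℕ) (ω : Ω)
    {v v' : Param p H} (hv : M.τ₀ + v ∈ Nθ ×ˢ Nh) (hv' : M.τ₀ + v' ∈ Nθ ×ˢ Nh) :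
    M.negLogLik ξ n ω (M.τ₀ + v) - M.negLogLik ξ n ω (M.τ₀ + v') =
      M.excess v - M.excess v' -
        ∑ l, empMean ξ n ω l (fun x => M.η l (M.τ₀ + v) x - M.η l (M.τ₀ + v') x) := by
  simp only [negLogLik, excess, ← Finset.sum_sub_distrib, ← hη.log_integral_sub hv,
    ← hη.log_integral_sub hv', empMean_sub]
  refine Finset.sum_congr rfl fun l _ => ?_
  simp only [empMean]
  ring

include hB

theorem LocalBounds.tendsto_excess {v : ℕ → Param p H} {v₀ : Param p H}
    (hv : ∀ k, M.τ₀ + v k ∈ Nθ ×ˢ Nh) (hv₀ : M.τ₀ + v₀ ∈ Nθ ×ˢ Nh)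
    (h : Tendsto v atTop (𝓝 v₀)) :
    Tendsto (fun k => M.excess (v k)) atTop (𝓝 (M.excess v₀)) := by
  refine tendsto_finsetSum _ fun l _ => ?_
  rw [tendsto_iff_dist_tendsto_zero]
  have h1 : Tendsto (fun k => c₂ * ‖M.ηL2 l (M.τ₀ + v k) - M.ηL2 l (M.τ₀ + v₀)‖) atTop (𝓝 0) := by
    have h2 : Tendsto (fun k => M.ηL2 l (M.τ₀ + v k)) atTop (𝓝 (M.ηL2 l (M.τ₀ + v₀))) :=
      (hη.hasFDerivAt_ηL2 hv₀ l).continuousAt.tendsto.comp (h.const_add M.τ₀)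
    simpa using ((tendsto_iff_norm_sub_tendsto_zero).1 h2).const_mul c₂
  refine squeeze_zero (fun k => dist_nonneg) (fun k => ?_) h1
  have hsub : (fun x => M.dev l (M.τ₀ + v k) x - M.dev l (M.τ₀ + v₀) x) =
      fun x => M.η l (M.τ₀ + v k) x - M.η l (M.τ₀ + v₀) x := by ext x; simp [dev]
  have h3 := abs_logZ_sub_le (hη.integrable_exp_dev hv₀ l) (hη.integrable_exp_dev (hv k) l)
    (hB.density_le l _ hv₀) (hB.density_le l _ (hv k)) (by
      rw [hsub]; exact hη.memLp_sub (hv k) hv₀ l)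
  have h4 : ∫ x, (M.dev l (M.τ₀ + v k) x - M.dev l (M.τ₀ + v₀) x) ^ 2 ∂(M.law l M.τ₀) =
      ‖M.ηL2 l (M.τ₀ + v k) - M.ηL2 l (M.τ₀ + v₀)‖ ^ 2 := by
    rw [← hη.integral_sub_sq (hv k) hv₀]
    simp [dev]
  rwa [h4, Real.sqrt_sq (norm_nonneg _)] at h3

theorem LocalBounds.tendsto_tilted {v w : Param p H} (hv : M.τ₀ + v ∈ Nθ ×ˢ Nh) (l : Fin m) :
    Tendsto (fun k : ℕ => ∫ x, ((k : ℝ) + 1) * (M.η l (M.τ₀ + v + ((k : ℝ) + 1)⁻¹ • w) x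
        - M.η l (M.τ₀ + v) x) ∂((M.law l M.τ₀).tilted (M.dev l (M.τ₀ + v)))) atTop
      (𝓝 (∫ x, M.Dηpt l x (M.τ₀ + v) w ∂((M.law l M.τ₀).tilted (M.dev l (M.τ₀ + v))))) := by
  have h1 := tendsto_seq_of_hasFDerivAt (hη.hasFDerivAt_ηL2 hv l) w
  rw [tendsto_iff_dist_tendsto_zero]
  refine squeeze_zero' (Eventually.of_forall fun k => dist_nonneg) ?_
    (by simpa using ((tendsto_iff_norm_sub_tendsto_zero).1 h1).const_mul c₂)
  filter_upwards [hη.eventually_mem hv w] with k hk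
  have e1 : MemLp (fun x => ((k : ℝ) + 1) * (M.η l (M.τ₀ + v + ((k : ℝ) + 1)⁻¹ • w) x
        - M.η l (M.τ₀ + v) x)) 2 (M.law l M.τ₀) := (hη.memLp_sub hk hv l).const_mul _
  have e2 := hη.memLp_Dηpt hv l w
  have e3 := e1.sub e2
  have i1 := integrable_tilted_of_bounded (hη.integrable_exp_dev hv l) (hB.density_le l _ hv)
    (e1.integrable (by norm_num))
  have i2 := integrable_tilted_of_bounded (hη.integrable_exp_dev hv l) (hB.density_le l _ hv)
    (e2.integrable (by norm_num))
  rw [Real.dist_eq, ← MeasureTheory.integral_sub i1 i2]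
  refine (abs_integral_tilted_le (hη.integrable_exp_dev hv l) (hB.density_le l _ hv)
    (e3.integrable (by norm_num))).trans ?_
  refine mul_le_mul_of_nonneg_left ?_ (by linarith [hB.one_le])
  refine (integral_abs_le_sqrt e3).trans_eq ?_
  rw [integral_sq_eq_norm_sq (F := ((k : ℝ) + 1) • (M.ηL2 l (M.τ₀ + v + ((k : ℝ) + 1)⁻¹ • w)
    - M.ηL2 l (M.τ₀ + v)) - fderiv ℝ (M.ηL2 l) (M.τ₀ + v) w), Real.sqrt_sq (norm_nonneg _)]
  filter_upwards [Lp.coeFn_sub (((k : ℝ) + 1) • (M.ηL2 l (M.τ₀ + v + ((k : ℝ) + 1)⁻¹ • w)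
      - M.ηL2 l (M.τ₀ + v))) (fderiv ℝ (M.ηL2 l) (M.τ₀ + v) w),
    Lp.coeFn_smul ((k : ℝ) + 1) (M.ηL2 l (M.τ₀ + v + ((k : ℝ) + 1)⁻¹ • w) - M.ηL2 l (M.τ₀ + v)),
    hη.sub_ae_eq hk hv l, hη.Dηpt_ae_eq hv l w] with x a1 a2 a3 a4
  rw [a1, Pi.sub_apply, Pi.sub_apply, a2, Pi.smul_apply, smul_eq_mul, ← a3, a4]

variable {Ω : Type w} {ξ : ∀ l, ℕ → Ω → X l} {n : Fin m → ℕ}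

/-- A convex likelihood lies above its tangents. -/
theorem LocalBounds.tangent_le {ω : Ω} (hconv : ConvexOn ℝ (Nθ ×ˢ Nh) (M.negLogLik ξ n ω))
    {v v' : Param p H} (hv : M.τ₀ + v ∈ Nθ ×ˢ Nh) (hv' : M.τ₀ + v' ∈ Nθ ×ˢ Nh) :
    ∑ l, empMean ξ n ω l (fun x => M.η l (M.τ₀ + v) x - M.η l (M.τ₀ + v') x
        - M.Dηpt l x (M.τ₀ + v') (v - v')) ≤
      M.excess v - M.excess v' + C * √(L.q v') * √(L.q (v - v')) := by
  -- Convexity bounds each difference quotient at `v'` by the whole increment. For the normalizing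
  -- constants Gibbs' inequality gives the required one-sided bound, so they need not be
  -- differentiated.
  have key : ∑ l, ∫ x, M.Dηpt l x (M.τ₀ + v') (v - v')
        ∂((M.law l M.τ₀).tilted (M.dev l (M.τ₀ + v')))
      - ∑ l, empMean ξ n ω l (fun x => M.Dηpt l x (M.τ₀ + v') (v - v')) ≤
      M.negLogLik ξ n ω (M.τ₀ + v) - M.negLogLik ξ n ω (M.τ₀ + v') := by
    have t1 := (tendsto_finsetSum (Finset.univ : Finset (Fin m)) fun l _ =>
      hB.tendsto_tilted hη hv' (w := v - v') l).sub
      (tendsto_finsetSum (Finset.univ : Finset (Fin m)) fun l _ =>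
        tendsto_empMean (ξ := ξ) (n := n) (ω := ω) fun x =>
        tendsto_seq_of_hasFDerivAt (hη.hasFDerivAt_η hv' l x) (v - v'))
    refine le_of_tendsto t1 ?_
    filter_upwards [hη.eventually_mem hv' (v - v')] with k hk
    have hk' : M.τ₀ + (v' + ((k : ℝ) + 1)⁻¹ • (v - v')) ∈ Nθ ×ˢ Nh := by rwa [← add_assoc]
    set s := ((k : ℝ) + 1)⁻¹ with hs
    have hs0 : 0 < s := by positivity
    have hs1 : s ≤ 1 := inv_le_one_of_one_le₀ (by linarith [(k.cast_nonneg : (0 : ℝ) ≤ k)])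
    have hks : ((k : ℝ) + 1) = s⁻¹ := by rw [hs, inv_inv]
    have hc := hconv.2 hv' hv (show (0 : ℝ) ≤ 1 - s by linarith) hs0.le (by ring)
    have hpt : (1 - s) • (M.τ₀ + v') + s • (M.τ₀ + v) = M.τ₀ + (v' + s • (v - v')) := by
      module
    rw [hpt, smul_eq_mul, smul_eq_mul] at hc
    have hdiff := negLogLik_sub hη ξ n ω hk' hv'
    have hge : ∑ l, ∫ x, (M.η l (M.τ₀ + (v' + s • (v - v'))) x - M.η l (M.τ₀ + v') x)
        ∂((M.law l M.τ₀).tilted (M.dev l (M.τ₀ + v'))) ≤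
        M.excess (v' + s • (v - v')) - M.excess v' := by
      rw [excess, excess, ← Finset.sum_sub_distrib]
      refine Finset.sum_le_sum fun l _ => ?_
      have := integral_tilted_sub_le_logZ_sub (hη.integrable_exp_dev hv' l)
        (hη.integrable_exp_dev hk' l) (integrable_tilted_of_bounded (hη.integrable_exp_dev hv' l)
          (hB.density_le l _ hv') (by
            simpa [dev] using (hη.memLp_sub hk' hv' l).integrable (by norm_num)))
      simpa [dev] using this
    simp only [smul_eq_mul, integral_const_mul, empMean_const_mul, ← Finset.mul_sum, hks]
    rw [← mul_sub, inv_mul_le_iff₀ hs0]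
    simp only [add_assoc]
    linarith
  have h2 := hB.tilted_deriv_ge v' hv' (v - v')
  have h3 := negLogLik_sub hη ξ n ω hv hv'
  have h4 : ∀ l, empMean ξ n ω l (fun x => M.η l (M.τ₀ + v) x - M.η l (M.τ₀ + v') x
        - M.Dηpt l x (M.τ₀ + v') (v - v')) =
      empMean ξ n ω l (fun x => M.η l (M.τ₀ + v) x - M.η l (M.τ₀ + v') x) -
      empMean ξ n ω l (fun x => M.Dηpt l x (M.τ₀ + v') (v - v')) := fun l => empMean_sub _ _
  simp only [h4, Finset.sum_sub_distrib]
  linarith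

end

end Model

/-! ### Almost sure consequences of convexity -/

namespace Model

variable {p m : ℕ} {X : Fin m → Type u} [∀ l, MeasurableSpace (X l)]
  {H : Type v} [NormedAddCommGroup H] [InnerProductSpace ℝ H] {M : Model p m X H}
  {Nθ : Set (EuclideanSpace ℝ (Fin p))} {Nh : Set H} {L : M.Ops} {c C b c₂ : ℝ}
  [∀ l, IsProbabilityMeasure (M.law l M.τ₀)]
  {Ω : Type w} [MeasurableSpace Ω] {P : Measure Ω} [IsProbabilityMeasure P]
  {ξ : ∀ l, ℕ → Ω → X l} {n : Fin m → ℕ}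

theorem ae_sample {l : Fin m} (hlaw : ∀ l i, HasLaw (ξ l i) (M.law l M.τ₀) P) {q : X l → Prop}
    (h : ∀ᵐ x ∂(M.law l M.τ₀), q x) : ∀ᵐ ω ∂P, ∀ i, q (ξ l i ω) := by
  rw [ae_all_iff]
  intro i
  rw [← (hlaw l i).map_eq] at h
  exact ae_of_ae_map (hlaw l i).aemeasurable h

theorem Ops.q_zero (L : M.Ops) : L.q 0 = 0 := by simp [Ops.q]

variable (hη : M.SmoothnessAssumption Nθ Nh) (hB : M.LocalBounds L Nθ Nh c C b c₂)
  (hlaw : ∀ l i, HasLaw (ξ l i) (M.law l M.τ₀) P)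
  (hindep : iIndepFun (fun j : Fin m × ℕ => ξ j.1 j.2) P) (hn : ∀ l, 0 < n l)
  (hconv : ∀ᵐ ω ∂P, ConvexOn ℝ (Nθ ×ˢ Nh) (M.negLogLik ξ n ω))

include hη hB hlaw hindep hn hconv

/-- Almost sure convexity bounds the remainders of the tangents from above. -/
theorem LocalBounds.exists_tangent_bounds {v v' : Param p H} (hv : M.τ₀ + v ∈ Nθ ×ˢ Nh)
    (hv' : M.τ₀ + v' ∈ Nθ ×ˢ Nh) :
    ∃ t : Fin m → ℝ, (∀ l, 0 ≤ t l) ∧ (∀ l, ∀ᵐ x ∂(M.law l M.τ₀),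
      M.η l (M.τ₀ + v) x - M.η l (M.τ₀ + v') x - M.Dηpt l x (M.τ₀ + v') (v - v') ≤ t l) ∧
      ∑ l, t l ≤ M.excess v - M.excess v' + C * √(L.q v') * √(L.q (v - v')) := by
  have hs : ∀ l, MemLp (fun x => M.η l (M.τ₀ + v) x - M.η l (M.τ₀ + v') x) 2 (M.law l M.τ₀) :=
    fun l => hη.memLp_sub hv hv' l
  have hd : ∀ l, MemLp (fun x => M.Dηpt l x (M.τ₀ + v') (v - v')) 2 (M.law l M.τ₀) :=
    fun l => hη.memLp_Dηpt hv' l _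
  refine exists_ae_upper_bounds hlaw hindep hn (fun l => ?_) (fun l => ?_) (fun l => ?_)
    (hconv.mono fun ω hω => hB.tangent_le hη hω hv hv')
  · exact ((hη.measurable l _ hv).sub (hη.measurable l _ hv')).sub (hη.measurable_Dηpt hv' l _)
  · exact ((hs l).sub (hd l)).integrable (by norm_num)
  · rw [MeasureTheory.integral_sub ((hs l).integrable (by norm_num))
      ((hd l).integrable (by norm_num)), hη.integral_sub hv hv', hη.integral_Dηpt hv', sub_zero]

/-- The tangent at the true parameter: the bounds are nonnegative and their sum is at most the
excess at `v`, hence at most `b`. -/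
theorem LocalBounds.rem_le_ae {v : Param p H} (hv : M.τ₀ + v ∈ Nθ ×ˢ Nh) (l : Fin m) :
    ∀ᵐ x ∂(M.law l M.τ₀), M.rem l v x ≤ b := by
  have h0 : M.τ₀ + 0 ∈ Nθ ×ˢ Nh := by simpa using hη.mem
  obtain ⟨t, ht0, ht1, ht2⟩ := hB.exists_tangent_bounds hη hlaw hindep hn hconv hv h0
  have h1 : t l ≤ b := by
    have h2 := Finset.single_le_sum (fun k _ => ht0 k) (Finset.mem_univ l)
    have h3 := hB.excess_ge 0 h0
    have h4 := hB.excess_le v hv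
    rw [L.q_zero] at ht2 h3
    simp at ht2 h3
    linarith
  filter_upwards [ht1 l] with x hx
  simp only [add_zero, sub_zero] at hx
  exact hx.trans h1

/-- The tangent remainder at `v'` is `rem v - rem v' + gap`, so its bound `t l` gives `-rem v' + gap
≤ t l - rem v`. Also `-b ≤ t l - rem v`, which permits the truncation. Inside it, `v` enters only
through the linear map `v - v' ↦ gap`. -/
theorem LocalBounds.lower_bound_ae_of_pair {v v' : Param p H} (hv : M.τ₀ + v ∈ Nθ ×ˢ Nh)
    (hv' : M.τ₀ + v' ∈ Nθ ×ˢ Nh) :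
    ∀ᵐ ω ∂P, M.excess v' - C * √(L.q v') * √(L.q (v - v')) +
      ∑ l, empMean ξ n ω l (fun x => max (-b) (-M.rem l v' x + M.gap l v' (v - v') x)) ≤
      M.excess v - ∑ l, empMean ξ n ω l (M.rem l v) := by
  obtain ⟨t, ht0, ht1, ht2⟩ := hB.exists_tangent_bounds hη hlaw hindep hn hconv hv hv'
  have h1 : ∀ l, ∀ᵐ ω ∂P, ∀ i, M.η l (M.τ₀ + v) (ξ l i ω) - M.η l (M.τ₀ + v') (ξ l i ω)
      - M.Dηpt l (ξ l i ω) (M.τ₀ + v') (v - v') ≤ t l := fun l => ae_sample hlaw (ht1 l)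
  have h2 : ∀ l, ∀ᵐ ω ∂P, ∀ i, M.rem l v (ξ l i ω) ≤ b := fun l =>
    ae_sample hlaw (hB.rem_le_ae hη hlaw hindep hn hconv hv l)
  rw [← ae_all_iff] at h1 h2
  filter_upwards [h1, h2] with ω hω1 hω2
  have h3 : ∀ l, empMean ξ n ω l (fun x => max (-b) (-M.rem l v' x + M.gap l v' (v - v') x)) ≤
      t l - empMean ξ n ω l (M.rem l v) := by
    intro l
    rw [← empMean_const (ξ := ξ) (ω := ω) (hn l) (t l), ← empMean_sub]
    refine empMean_mono fun i => max_le ?_ ?_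
    · have := hω2 l i
      have := ht0 l
      linarith
    · have := hω1 l i
      simp only [rem, gap, Dηpt_sub] at this ⊢
      linarith
  have h4 := Finset.sum_le_sum fun l (_ : l ∈ Finset.univ) => h3 l
  rw [Finset.sum_sub_distrib] at h4
  linarith

/-- The likelihood lies above its truncated tangents, uniformly over the neighbourhood. -/
theorem LocalBounds.lower_bound_ae [TopologicalSpace.SeparableSpace (Param p H)] {v' : Param p H}
    (hv' : M.τ₀ + v' ∈ Nθ ×ˢ Nh) :
    ∀ᵐ ω ∂P, ∀ v, M.τ₀ + v ∈ Nθ ×ˢ Nh → M.excess v' - C * √(L.q v') * √(L.q (v - v')) +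
      ∑ l, empMean ξ n ω l (fun x => max (-b) (-M.rem l v' x + M.gap l v' (v - v') x)) ≤
      M.excess v - ∑ l, empMean ξ n ω l (M.rem l v) := by
  -- The exceptional null set depends on `v`. A countable dense set removes this dependence, since
  -- for a fixed sample both sides are continuous in `v`.
  obtain ⟨S, hSsub, hScount, hSdense⟩ := (TopologicalSpace.IsSeparable.of_separableSpace
    {v : Param p H | M.τ₀ + v ∈ Nθ ×ˢ Nh}).exists_countable_dense_subset
  have h1 : ∀ᵐ ω ∂P, ∀ v ∈ S, M.excess v' - C * √(L.q v') * √(L.q (v - v')) +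
      ∑ l, empMean ξ n ω l (fun x => max (-b) (-M.rem l v' x + M.gap l v' (v - v') x)) ≤
      M.excess v - ∑ l, empMean ξ n ω l (M.rem l v) :=
    (ae_ball_iff hScount).2 fun v hv =>
      hB.lower_bound_ae_of_pair hη hlaw hindep hn hconv (hSsub hv) hv'
  filter_upwards [h1] with ω hω v hv
  obtain ⟨u, huS, hu⟩ := mem_closure_iff_seq_limit.1 (hSdense hv)
  have hsub : Tendsto (fun k => u k - v') atTop (𝓝 (v - v')) := hu.sub_const v'
  have hdp : ∀ l (x : X l) τ {f : ℕ → Param p H} {f₀ : Param p H}, Tendsto f atTop (𝓝 f₀) →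
      Tendsto (fun k => M.Dηpt l x τ (f k)) atTop (𝓝 (M.Dηpt l x τ f₀)) :=
    fun l x τ f f₀ hf => ((continuous_Dηpt l x τ).tendsto f₀).comp hf
  refine le_of_tendsto_of_tendsto' (b := (atTop : Filter ℕ)) ?_ ?_ fun k => hω (u k) (huS k)
  · refine Tendsto.add (Tendsto.const_sub _ (Tendsto.const_mul _ ?_)) ?_
    · exact ((Real.continuous_sqrt.comp L.continuous_q).tendsto _).comp hsub
    · refine tendsto_finsetSum _ fun l _ => tendsto_empMean fun x => ?_
      refine tendsto_const_nhds.max (tendsto_const_nhds.add ?_)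
      exact (hdp l x _ hsub).sub (hdp l x _ hsub)
  · refine (hB.tendsto_excess hη (fun k => hSsub (huS k)) hv hu).sub ?_
    refine tendsto_finsetSum _ fun l _ => tendsto_empMean fun x => ?_
    refine Tendsto.sub (Tendsto.sub ?_ tendsto_const_nhds) (hdp l x _ hu)
    exact ((hη.hasFDerivAt_η hv l x).continuousAt.tendsto).comp (hu.const_add M.τ₀)

end Model

/-! ### Deviation bounds uniform over infinitely many coordinates -/

namespace Model

variable {p m : ℕ} {X : Fin m → Type u} [∀ l, MeasurableSpace (X l)]
  {H : Type v} [NormedAddCommGroup H] [InnerProductSpace ℝ H] {M : Model p m X H} {L : M.Ops}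

theorem Coordinates.separableSpace {r : ℝ} (K : Coordinates L r) :
    TopologicalSpace.SeparableSpace (Param p H) := by
  have h1 : TopologicalSpace.IsSeparable (Set.range K.e) :=
    (Set.countable_range _).isSeparable
  have h2 := (h1.span (R := ℝ)).closure
  rw [← TopologicalSpace.isSeparable_univ_iff]
  refine h2.mono fun v _ => ?_
  refine mem_closure_of_tendsto (K.hasSum v) (Eventually.of_forall fun s => ?_)
  exact Submodule.sum_mem _ fun j _ => Submodule.smul_mem _ _ (Submodule.subset_span ⟨j, rfl⟩)

end Model

/-- Partial sums converge at each observation, and each truncated threshold is at most the full one.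
A point of the event therefore lies in the `D`-dimensional events for all large `D`. The
intersections over `D ≥ D₀` increase with `D₀` and all obey the finite-dimensional bound. -/
theorem measure_pi_exists_clipped_tsum_gt {X : Type*} [MeasurableSpace X] (Q : Measure X)
    [IsProbabilityMeasure Q] (N : ℕ) {f : X → ℝ} {ψ : ℕ → X → ℝ}
    (hf : Measurable f) (hψ : ∀ j, Measurable (ψ j))
    (hf2 : MemLp f 2 Q) (hψ2 : ∀ j, MemLp (ψ j) 2 Q)
    (hf0 : ∫ x, f x ∂Q = 0) (hψ0 : ∀ j, ∫ x, ψ j x ∂Q = 0) {F C : ℝ} (hC0 : 0 ≤ C)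
    (hF : ∫ x, f x ^ 2 ∂Q ≤ F)
    (hC : ∀ D (z : Fin D → ℝ), ∫ x, (∑ j : Fin D, z j * ψ j x) ^ 2 ∂Q ≤ C * ∑ j, z j ^ 2)
    {σ : ℕ → ℝ} (hσ : ∀ j, 0 < σ j) (hσ2 : Summable fun j => σ j ^ 2)
    {ι : Type*} (y : ι → ℕ → ℝ) (G : ι → X → ℝ)
    (hG : ∀ w x, HasSum (fun j => y w j * ψ j x) (G w x))
    (hy : ∀ w, Summable fun j => y w j ^ 2) (hyσ : ∀ w, Summable fun j => (y w j / σ j) ^ 2)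
    (t : ℝ) :
    Measure.pi (fun _ : Fin N => Q) {x | ∃ w,
        48 * N * (F + C * (∑' j, y w j ^ 2 + ∑' j, σ j ^ 2)) + 1 / 2 * ∑' j, (y w j / σ j) ^ 2 + t
          + 2 * (2 * N * (C * ∑' j, σ j ^ 2) + t)
          < ∑ i, min (-(f (x i) + G w (x i))) 1}
      ≤ 2 * ENNReal.ofReal (Real.exp (-t)) := by
  let E : ℕ → Set (Fin N → X) := fun D => {x | ∃ w : Fin D → ℝ,
        48 * N * (F + C * (∑ j, w j ^ 2 + ∑ j : Fin D, σ j ^ 2))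
          + 1 / 2 * ∑ j, (w j / σ j) ^ 2 + t + 2 * (2 * N * (C * ∑ j : Fin D, σ j ^ 2) + t)
          < ∑ i, min (-(f (x i) + ∑ j, w j * ψ j (x i))) 1}
  have hE : ∀ D, Measure.pi (fun _ : Fin N => Q) (E D) ≤ 2 * ENNReal.ofReal (Real.exp (-t)) :=
    fun D => measure_exists_clipped_sum_gt Q N (ψ := fun j : Fin D => ψ j) hf (fun j => hψ j) hf2
      (fun j => hψ2 j) hf0 (fun j => hψ0 j) hF (hC D) (σ := fun j => σ j) (fun j => hσ j) t
  have hmono : Monotone fun D₀ => ⋂ D ≥ D₀, E D := fun D₀ D₁ h =>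
    Set.biInter_subset_biInter_left fun D hD => le_trans h hD
  refine (measure_mono (t := ⋃ D₀, ⋂ D ≥ D₀, E D) ?_).trans ?_
  · rintro x ⟨w, hw⟩
    have hlim : Tendsto (fun D : ℕ => ∑ i, min (-(f (x i) + ∑ j : Fin D, y w j * ψ j (x i))) 1) atTop
        (𝓝 (∑ i, min (-(f (x i) + G w (x i))) 1)) := by
      refine tendsto_finsetSum _ fun i _ => ?_
      refine Tendsto.min (Tendsto.neg (tendsto_const_nhds.add ?_)) tendsto_const_nhds
      have := (hG w (x i)).tendsto_sum_nat
      simpa only [Finset.sum_range] using this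
    obtain ⟨D₀, hD₀⟩ := eventually_atTop.1 (hlim.eventually (lt_mem_nhds hw))
    refine Set.mem_iUnion.2 ⟨D₀, Set.mem_iInter₂.2 fun D hD => ⟨fun j => y w j, ?_⟩⟩
    refine lt_of_le_of_lt ?_ (hD₀ D hD)
    have s1 : ∑ j : Fin D, y w j ^ 2 ≤ ∑' j, y w j ^ 2 := by
      rw [← Finset.sum_range fun j => y w j ^ 2]
      exact (hy w).sum_le_tsum _ fun _ _ => sq_nonneg _
    have s2 : ∑ j : Fin D, σ j ^ 2 ≤ ∑' j, σ j ^ 2 := by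
      rw [← Finset.sum_range fun j => σ j ^ 2]
      exact hσ2.sum_le_tsum _ fun _ _ => sq_nonneg _
    have s3 : ∑ j : Fin D, (y w j / σ j) ^ 2 ≤ ∑' j, (y w j / σ j) ^ 2 := by
      rw [← Finset.sum_range fun j => (y w j / σ j) ^ 2]
      exact (hyσ w).sum_le_tsum _ fun _ _ => sq_nonneg _
    gcongr
  · rw [hmono.measure_iUnion]
    refine iSup_le fun D₀ => ?_
    exact (measure_mono (Set.biInter_subset_of_mem (t := E) (show D₀ ≥ D₀ from le_rfl))).trans
      (hE D₀)

namespace Model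

variable {p m : ℕ} {X : Fin m → Type u} [∀ l, MeasurableSpace (X l)]
  {H : Type v} [NormedAddCommGroup H] [InnerProductSpace ℝ H] {M : Model p m X H}
  {Nθ : Set (EuclideanSpace ℝ (Fin p))} {Nh : Set H} {L : M.Ops} {c C b c₂ : ℝ}
  [∀ l, IsProbabilityMeasure (M.law l M.τ₀)]
  {Ω : Type w} [MeasurableSpace Ω] {P : Measure Ω} [IsProbabilityMeasure P]
  {ξ : ∀ l, ℕ → Ω → X l} {n : Fin m → ℕ} {r : ℝ}

/-- The squared `ℓ²` norm of the coordinates. -/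
def Coordinates.W (K : Coordinates L r) (v : Param p H) : ℝ := ∑' j, K.x j v ^ 2

theorem Coordinates.W_nonneg (K : Coordinates L r) (v : Param p H) : 0 ≤ K.W v :=
  tsum_nonneg fun _ => sq_nonneg _

theorem Coordinates.gap_hasSum (K : Coordinates L r) (l : Fin m) (v w : Param p H) (x : X l) :
    HasSum (fun j => K.x j w * M.gap l v (K.e j) x) (M.gap l v w x) := by
  have h1 := (K.hasSum w).mapL (fderiv ℝ (fun σ => M.η l σ x) M.τ₀)
  have h2 := (K.hasSum w).mapL (fderiv ℝ (fun σ => M.η l σ x) (M.τ₀ + v))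
  have h3 := h1.sub h2
  simp only [map_smul, smul_eq_mul, ← mul_sub] at h3
  exact h3

theorem Coordinates.q_sum_le (K : Coordinates L r) (D : ℕ) (z : Fin D → ℝ) :
    L.q (∑ j : Fin D, z j • K.e j) ≤ K.C * ∑ j, z j ^ 2 := by
  refine (K.upper _).trans (mul_le_mul_of_nonneg_left (le_of_eq ?_) K.C_pos.le)
  have h1 : ∀ i, K.x i (∑ j : Fin D, z j • K.e j) = ∑ j : Fin D, if i = (j : ℕ) then z j else 0 := by
    intro i
    rw [map_sum]
    refine Finset.sum_congr rfl fun j _ => ?_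
    rw [map_smul, K.biorthogonal, smul_eq_mul, mul_ite, mul_one, mul_zero]
  rw [tsum_eq_sum (s := Finset.range D), Finset.sum_range]
  · refine Finset.sum_congr rfl fun i _ => ?_
    rw [h1]
    congr 1
    rw [Finset.sum_eq_single i]
    · simp
    · intro j _ hj
      rw [if_neg]
      exact fun h => hj (Fin.ext h.symm)
    · simp
  · intro i hi
    rw [h1, Finset.sum_eq_zero]
    · simp
    · intro j _
      rw [if_neg]
      rintro rfl
      exact hi (Finset.mem_range.2 j.2)

/-- Uniformly over the directions `w`, the truncated empirical mean of the tangent at `τ₀ + v` is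
controlled, with exponentially small exceptional probability. -/
theorem LocalBounds.measure_exists_clipped_gt (hη : M.SmoothnessAssumption Nθ Nh)
    (hB : M.LocalBounds L Nθ Nh c C b c₂) (K : Coordinates L r)
    (hlaw : ∀ l i, HasLaw (ξ l i) (M.law l M.τ₀) P)
    (hindep : iIndepFun (fun j : Fin m × ℕ => ξ j.1 j.2) P) {l : Fin m} (hn : 0 < n l)
    {v : Param p H} (hv : M.τ₀ + v ∈ Nθ ×ˢ Nh) {s : ℝ} (hs : 0 < s) (hsb : s * b ≤ 1)
    {lam : ℝ} (hlam : 0 < lam) (hlam1 : lam ≤ 1) (t : ℝ) :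
    P {ω | ∃ w : Param p H, s * (48 * C * L.q v + (48 * (C * K.C) + 1 / 2) * K.W w
        + 1 / 2 * (lam * M.J w.2 w.2)) + (52 * (C * K.C * (K.C * lam ^ (-(1 / r)))) + 3 * t)
          / (n l * s) <
        empMean ξ n ω l (fun x => min (M.rem l v x - M.gap l v w x) b)}
      ≤ 2 * ENNReal.ofReal (Real.exp (-t)) := by
  set N := n l with hN
  have hN0 : (0 : ℝ) < N := by exact_mod_cast hn
  set Q := M.law l M.τ₀ with hQ
  set T := K.C * lam ^ (-(1 / r)) with hT
  let ψ : ℕ → X l → ℝ := fun j x => s * M.gap l v (K.e j) x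
  let f : X l → ℝ := fun x => -s * M.rem l v x
  -- Prior variances adapted to the norm: they sum to the effective dimension divided by `N s²`,
  -- while a translation to `w` costs `N s² / 2` times `W w + lam J`. The scale `s` brings the
  -- truncation level `b` below the clipping level 1.
  let σ : ℕ → ℝ := fun j => √(1 / (N * s ^ 2) * (1 + lam * K.ρ j)⁻¹)
  have hpos : ∀ j, 0 < 1 + lam * K.ρ j := fun j => by
    have := mul_nonneg hlam.le (K.ρ_nonneg j)
    linarith
  have hσsq : ∀ j, σ j ^ 2 = 1 / (N * s ^ 2) * (1 + lam * K.ρ j)⁻¹ := fun j =>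
    Real.sq_sqrt (by have := hpos j; positivity)
  have hσ : ∀ j, 0 < σ j := fun j => Real.sqrt_pos.2 (by have := hpos j; positivity)
  have hσ2 : Summable fun j => σ j ^ 2 := by
    simp only [hσsq]
    exact (K.trace_summable lam hlam).mul_left _
  have hσT : ∑' j, σ j ^ 2 ≤ T / (N * s ^ 2) := by
    simp only [hσsq]
    rw [tsum_mul_left, one_div, div_eq_inv_mul]
    exact mul_le_mul_of_nonneg_left (K.trace_le lam hlam hlam1) (by positivity)
  have hyσ : ∀ w : Param p H, HasSum (fun j => (K.x j w / σ j) ^ 2)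
      (N * s ^ 2 * (K.W w + lam * M.J w.2 w.2)) := by
    intro w
    have h1 := (((K.summable w).hasSum).add ((K.penalty w).mul_left lam)).mul_left (N * s ^ 2)
    have h2 : ∀ j, N * s ^ 2 * (K.x j w ^ 2 + lam * (K.ρ j * K.x j w ^ 2)) =
        (K.x j w / σ j) ^ 2 := fun j => by
      have := (hpos j).ne'
      rw [div_pow, hσsq]
      field_simp
    simp only [h2] at h1
    exact h1
  have hsum2 : ∀ g : Fin m → ℝ, (∀ k, 0 ≤ g k) → g l ≤ ∑ k, g k := fun g hg =>
    Finset.single_le_sum (fun k _ => hg k) (Finset.mem_univ l)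
  have hF : ∫ x, f x ^ 2 ∂Q ≤ s ^ 2 * (C * L.q v) := by
    have h1 : ∀ x, f x ^ 2 = s ^ 2 * M.rem l v x ^ 2 := fun x => by simp only [f]; ring
    simp only [h1]
    rw [integral_const_mul]
    refine mul_le_mul_of_nonneg_left (le_trans ?_ (hB.rem_le v hv)) (by positivity)
    exact hsum2 (fun k => ∫ x, M.rem k v x ^ 2 ∂(M.law k M.τ₀))
      fun k => integral_nonneg fun x => sq_nonneg _
  have hC : ∀ D (z : Fin D → ℝ), ∫ x, (∑ j : Fin D, z j * ψ j x) ^ 2 ∂Q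
      ≤ s ^ 2 * (C * K.C) * ∑ j, z j ^ 2 := by
    intro D z
    have h1 : ∀ x, (∑ j : Fin D, z j * ψ j x) ^ 2 =
        s ^ 2 * M.gap l v (∑ j : Fin D, z j • K.e j) x ^ 2 := by
      intro x
      rw [← mul_pow]
      congr 1
      simp only [ψ, gap, Dηpt, map_sum, map_smul, smul_eq_mul, mul_sub, Finset.mul_sum,
        ← Finset.sum_sub_distrib]
      exact Finset.sum_congr rfl fun j _ => by ring
    simp only [h1]
    rw [integral_const_mul, mul_assoc]
    refine mul_le_mul_of_nonneg_left ?_ (by positivity)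
    refine le_trans (hsum2 (fun k => ∫ x, M.gap k v (∑ j : Fin D, z j • K.e j) x ^ 2
      ∂(M.law k M.τ₀)) fun k => integral_nonneg fun x => sq_nonneg _) ?_
    refine (hB.gap_le v hv _).trans ?_
    rw [mul_assoc]
    exact mul_le_mul_of_nonneg_left (K.q_sum_le D z) hB.C_pos.le
  have hmain := measure_pi_exists_clipped_tsum_gt Q N (f := f) (ψ := ψ)
    ((hη.measurable_rem hv l).const_mul _) (fun j => (hη.measurable_gap hv l _).const_mul _)
    ((hη.memLp_rem hv l).const_mul _) (fun j => (hη.memLp_gap hv l _).const_mul _)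
    (by simp only [f]; rw [integral_const_mul, hη.integral_rem hv l, mul_zero])
    (fun j => by simp only [ψ]; rw [integral_const_mul, hη.integral_gap hv l, mul_zero])
    (by have := hB.C_pos; have := K.C_pos; positivity) hF hC hσ hσ2
    (fun w : Param p H => fun j => K.x j w) (fun w x => s * M.gap l v w x)
    (fun w x => by
      have := (K.gap_hasSum l v w x).mul_left s
      have h2 : ∀ j, s * (K.x j w * M.gap l v (K.e j) x) = K.x j w * ψ j x := fun j => by
        simp only [ψ]; ring
      simp only [h2] at this
      exact this) (fun w => K.summable w) (fun w => (hyσ w).summable) t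
  have hmap : P.map (fun ω (i : Fin N) => ξ l i ω) = Measure.pi (fun _ : Fin N => Q) := by
    have hind : iIndepFun (fun i : Fin N => ξ l i) P :=
      hindep.precomp (g := fun i : Fin N => (l, (i : ℕ))) (fun i j h => by
        simpa [Fin.ext_iff] using h)
    rw [(iIndepFun_iff_map_fun_eq_pi_map fun i : Fin N => (hlaw l i).aemeasurable).1 hind]
    simp only [(hlaw l _).map_eq]
    rfl
  rw [← hmap] at hmain
  refine le_trans (measure_mono ?_) ((Measure.le_map_apply
    (aemeasurable_pi_lambda _ fun i : Fin N => (hlaw l i).aemeasurable) _).trans hmain)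
  rintro ω ⟨w, hw⟩
  refine ⟨w, ?_⟩
  simp only
  have hKC : 0 ≤ C * K.C := mul_nonneg hB.C_pos.le K.C_pos.le
  have e1 : s * (N * empMean ξ n ω l (fun x => min (M.rem l v x - M.gap l v w x) b)) ≤
      ∑ i : Fin N, min (-(f (ξ l i ω) + s * M.gap l v w (ξ l i ω))) 1 := by
    have : N * empMean ξ n ω l (fun x => min (M.rem l v x - M.gap l v w x) b) =
        ∑ i : Fin N, min (M.rem l v (ξ l i ω) - M.gap l v w (ξ l i ω)) b := by
      rw [empMean, ← hN, mul_inv_cancel_left₀ hN0.ne', Finset.sum_range]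
    rw [this, Finset.mul_sum]
    refine Finset.sum_le_sum fun i _ => ?_
    rw [mul_min_of_nonneg _ _ hs.le]
    refine min_le_min (le_of_eq ?_) hsb
    simp only [f]
    ring
  refine lt_of_le_of_lt ?_ (lt_of_lt_of_le (mul_lt_mul_of_pos_left
    (mul_lt_mul_of_pos_left hw hN0) hs) e1)
  rw [(hyσ w).tsum_eq, ← Coordinates.W]
  have e2 : s ^ 2 * (C * K.C) * ∑' j, σ j ^ 2 ≤ C * K.C * T / N := by
    calc _ ≤ s ^ 2 * (C * K.C) * (T / (N * s ^ 2)) :=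
          mul_le_mul_of_nonneg_left hσT (by positivity)
      _ = _ := by field_simp
  have e3 : (N : ℝ) * (C * K.C * T / N) = C * K.C * T := by field_simp
  -- The general bound contributes `48 + 2 * 2` times the trace and `t + 2 * t`.
  have e4 : s * (N * ((52 * (C * K.C * T) + 3 * t) / (N * s))) = 52 * (C * K.C * T) + 3 * t := by
    field_simp
  have e5 := mul_le_mul_of_nonneg_left e2 hN0.le
  rw [e3] at e5
  rw [mul_add (N : ℝ), mul_add s, e4]
  nlinarith [e5]

end Model

/-! ### The score at the true parameter -/

/-- Second moment of an empirical mean of a centred function. -/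
theorem memLp_empMean_and_integral_sq {m : ℕ} {X : Fin m → Type u} [∀ l, MeasurableSpace (X l)]
    {Ω : Type w} [MeasurableSpace Ω] {P : Measure Ω} [IsProbabilityMeasure P]
    {Q : ∀ l, Measure (X l)} {ξ : ∀ l, ℕ → Ω → X l}
    (hlaw : ∀ l i, HasLaw (ξ l i) (Q l) P) (hindep : iIndepFun (fun j : Fin m × ℕ => ξ j.1 j.2) P)
    {n : Fin m → ℕ} {l : Fin m} (hn : 0 < n l) {g : X l → ℝ} (hg : Measurable g)
    (hg2 : MemLp g 2 (Q l)) (hg0 : ∫ x, g x ∂(Q l) = 0) :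
    MemLp (fun ω => empMean ξ n ω l g) 2 P ∧
      ∫ ω, empMean ξ n ω l g ^ 2 ∂P = (n l : ℝ)⁻¹ * ∫ x, g x ^ 2 ∂(Q l) := by
  have h1 : ∀ i, MemLp (fun ω => g (ξ l i ω)) 2 P := by
    intro i
    have h := hg2
    rw [← (hlaw l i).map_eq] at h
    exact (memLp_map_measure_iff h.1 (hlaw l i).aemeasurable).1 h
  have h2 : ∀ i, ∫ ω, g (ξ l i ω) ∂P = 0 := fun i => by
    rw [← hg0]
    exact (hlaw l i).integral_comp hg2.1
  have h3 : ∀ i, ∫ ω, g (ξ l i ω) ^ 2 ∂P = ∫ x, g x ^ 2 ∂(Q l) := fun i =>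
    (hlaw l i).integral_comp (f := fun x => g x ^ 2) (hg2.1.pow 2)
  have hvar : ∀ i, Var[fun ω => g (ξ l i ω); P] = ∫ x, g x ^ 2 ∂(Q l) := fun i => by
    rw [variance_of_integral_eq_zero (h1 i).aestronglyMeasurable.aemeasurable (h2 i), h3]
  have h4 : MemLp (∑ i ∈ Finset.range (n l), fun ω => g (ξ l i ω)) 2 P :=
    memLp_finsetSum' _ fun i _ => h1 i
  have h5 : (fun ω => empMean ξ n ω l g) =
      fun ω => (n l : ℝ)⁻¹ * (∑ i ∈ Finset.range (n l), fun ω => g (ξ l i ω)) ω := by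
    ext ω
    simp [empMean, Finset.sum_apply]
  have h6 : MemLp (fun ω => empMean ξ n ω l g) 2 P := by
    rw [h5]; exact h4.const_mul _
  refine ⟨h6, ?_⟩
  have h7 : ∫ ω, empMean ξ n ω l g ∂P = 0 := by
    simp only [empMean]
    rw [integral_const_mul, integral_finsetSum _ fun i _ => (h1 i).integrable (by norm_num)]
    simp [h2]
  have hind : Set.Pairwise (Finset.range (n l) : Set ℕ)
      fun i j => IndepFun (fun ω => g (ξ l i ω)) (fun ω => g (ξ l j ω)) P := by
    intro i _ j _ hij
    have hne : ((l, i) : Fin m × ℕ) ≠ (l, j) := fun h => hij (by simpa using h)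
    exact (hindep.indepFun hne).comp hg hg
  rw [← variance_of_integral_eq_zero h6.aestronglyMeasurable.aemeasurable h7, h5,
    variance_const_mul, IndepFun.variance_sum (fun i _ => h1 i) hind]
  simp only [hvar, Finset.sum_const, Finset.card_range, nsmul_eq_mul]
  have : (n l : ℝ) ≠ 0 := by positivity
  field_simp

namespace Model

variable {p m : ℕ} {X : Fin m → Type u} [∀ l, MeasurableSpace (X l)]
  {H : Type v} [NormedAddCommGroup H] [InnerProductSpace ℝ H] {M : Model p m X H}
  {Nθ : Set (EuclideanSpace ℝ (Fin p))} {Nh : Set H} {L : M.Ops} {c C b c₂ : ℝ}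
  {Ω : Type w} [MeasurableSpace Ω] {P : Measure Ω} [IsProbabilityMeasure P]
  {ξ : ∀ l, ℕ → Ω → X l} {n : Fin m → ℕ} {r : ℝ}

/-- The empirical mean of the derivative of the log density at the true parameter. -/
def score (M : Model p m X H) {Ω : Type w} (ξ : ∀ l, ℕ → Ω → X l) (n : Fin m → ℕ) (ω : Ω)
    (v : Param p H) : ℝ :=
  ∑ l, empMean ξ n ω l (fun x => M.Dηpt l x M.τ₀ v)

/-- The squared norm `∑ x_j² + lam J` in terms of the coordinates. -/
def Coordinates.sq (K : Coordinates L r) (lam : ℝ) (v : Param p H) : ℝ :=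
  K.W v + lam * M.J v.2 v.2

theorem Coordinates.hasSum_sq (K : Coordinates L r) (lam : ℝ) (v : Param p H) :
    HasSum (fun j => (1 + lam * K.ρ j) * K.x j v ^ 2) (K.sq lam v) := by
  have h := (K.summable v).hasSum.add ((K.penalty v).mul_left lam)
  have e : ∀ j, K.x j v ^ 2 + lam * (K.ρ j * K.x j v ^ 2) = (1 + lam * K.ρ j) * K.x j v ^ 2 :=
    fun j => by ring
  simp only [e] at h
  exact h

theorem Coordinates.score_hasSum (K : Coordinates L r) (ω : Ω) (v : Param p H) :
    HasSum (fun j => K.x j v * M.score ξ n ω (K.e j)) (M.score ξ n ω v) := by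
  let F : Param p H →L[ℝ] ℝ := ∑ l, (n l : ℝ)⁻¹ • ∑ i ∈ Finset.range (n l),
    fderiv ℝ (fun σ => M.η l σ (ξ l i ω)) M.τ₀
  have hF : ∀ v, F v = M.score ξ n ω v := fun v => by
    simp [F, score, empMean, Dηpt]
  have h := (K.hasSum v).mapL F
  have e : ∀ j, F (K.x j v • K.e j) = K.x j v * M.score ξ n ω (K.e j) := fun j => by
    rw [map_smul, hF, smul_eq_mul]
  simpa only [e, hF] using h

/-- Cauchy–Schwarz with weights `1 + lam ρ_j`: the weighted sums of squared score coordinates bound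
the squared dual norm. -/
theorem Coordinates.score_sq_le (K : Coordinates L r) {lam : ℝ} (hlam : 0 ≤ lam) {ω : Ω} {B : ℝ}
    (hB : ∀ D, ∑ j ∈ Finset.range D, M.score ξ n ω (K.e j) ^ 2 * (1 + lam * K.ρ j)⁻¹ ≤ B)
    (v : Param p H) : M.score ξ n ω v ^ 2 ≤ B * K.sq lam v := by
  have hpos : ∀ j, 0 < 1 + lam * K.ρ j := fun j => by
    have := mul_nonneg hlam (K.ρ_nonneg j)
    linarith
  have hB0 : 0 ≤ B := by simpa using hB 0
  refine le_of_tendsto' ((K.score_hasSum ω v).tendsto_sum_nat.pow 2) fun D => ?_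
  have h1 := Finset.sum_mul_sq_le_sq_mul_sq (Finset.range D)
    (fun j => M.score ξ n ω (K.e j) * √((1 + lam * K.ρ j)⁻¹))
    (fun j => √(1 + lam * K.ρ j) * K.x j v)
  have e1 : ∀ j, M.score ξ n ω (K.e j) * √((1 + lam * K.ρ j)⁻¹) * (√(1 + lam * K.ρ j) * K.x j v)
      = K.x j v * M.score ξ n ω (K.e j) := fun j => by
    have : √((1 + lam * K.ρ j)⁻¹) * √(1 + lam * K.ρ j) = 1 := by
      rw [← Real.sqrt_mul (inv_nonneg.2 (hpos j).le), inv_mul_cancel₀ (hpos j).ne', Real.sqrt_one]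
    calc _ = (√((1 + lam * K.ρ j)⁻¹) * √(1 + lam * K.ρ j)) *
          (K.x j v * M.score ξ n ω (K.e j)) := by ring
      _ = _ := by rw [this, one_mul]
  simp only [e1, mul_pow, Real.sq_sqrt (hpos _).le, Real.sq_sqrt (inv_nonneg.2 (hpos _).le)] at h1
  refine h1.trans (mul_le_mul (hB D) ?_ (Finset.sum_nonneg fun j _ => ?_) hB0)
  · refine sum_le_hasSum _ (fun j _ => ?_) (K.hasSum_sq lam v)
    have := hpos j
    positivity
  · have := hpos j
    positivity

variable [∀ l, IsProbabilityMeasure (M.law l M.τ₀)]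

theorem Coordinates.q_e_le (K : Coordinates L r) (j : ℕ) : L.q (K.e j) ≤ K.C := by
  refine (K.upper _).trans_eq ?_
  simp [K.biorthogonal]

theorem LocalBounds.score_second_moment (hη : M.SmoothnessAssumption Nθ Nh)
    (hB : M.LocalBounds L Nθ Nh c C b c₂)
    (hlaw : ∀ l i, HasLaw (ξ l i) (M.law l M.τ₀) P)
    (hindep : iIndepFun (fun j : Fin m × ℕ => ξ j.1 j.2) P) {N : ℕ} (hN : 0 < N)
    (hn : ∀ l, N ≤ n l) (v : Param p H) :
    MemLp (fun ω => M.score ξ n ω v) 2 P ∧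
      ∫ ω, M.score ξ n ω v ^ 2 ∂P ≤ m * C * L.q v * (N : ℝ)⁻¹ := by
  have h := fun l => memLp_empMean_and_integral_sq (l := l) hlaw hindep (hN.trans_le (hn l))
    (hη.measurable_Dηpt hη.mem l v) (hη.memLp_Dηpt hη.mem l v) (hη.integral_Dηpt hη.mem l v)
  have h1 : MemLp (fun ω => M.score ξ n ω v) 2 P := memLp_finsetSum _ fun l _ => (h l).1
  refine ⟨h1, ?_⟩
  calc ∫ ω, M.score ξ n ω v ^ 2 ∂P
      ≤ ∫ ω, m * ∑ l, empMean ξ n ω l (fun x => M.Dηpt l x M.τ₀ v) ^ 2 ∂P := by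
        refine integral_mono h1.integrable_sq
          ((integrable_finsetSum _ fun l _ => (h l).1.integrable_sq).const_mul _) fun ω => ?_
        have := sq_sum_le_card_mul_sum_sq (s := (Finset.univ : Finset (Fin m)))
          (f := fun l => empMean ξ n ω l (fun x => M.Dηpt l x M.τ₀ v))
        simpa [score] using this
    _ = m * ∑ l, (n l : ℝ)⁻¹ * ∫ x, M.Dηpt l x M.τ₀ v ^ 2 ∂(M.law l M.τ₀) := by
        rw [integral_const_mul, integral_finsetSum _ fun l _ => (h l).1.integrable_sq]
        simp only [(h _).2]
    _ ≤ m * ∑ l, (N : ℝ)⁻¹ * ∫ x, M.Dηpt l x M.τ₀ v ^ 2 ∂(M.law l M.τ₀) := by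
        refine mul_le_mul_of_nonneg_left (Finset.sum_le_sum fun l _ =>
          mul_le_mul_of_nonneg_right (inv_anti₀ (by positivity) ?_)
            (integral_nonneg fun x => sq_nonneg _)) (by positivity)
        exact_mod_cast hn l
    _ ≤ m * ((N : ℝ)⁻¹ * (C * L.q v)) := by
        rw [← Finset.mul_sum]
        gcongr
        exact hB.deriv_le v
    _ = _ := by ring

/-- The series `S` dominates the squared dual norm of the score, hence handles all `v` at once. Each
score coordinate has second moment of order `1 / N`, so the expectation of `S` is at most of the
order of the effective dimension over `N`, and Markov's inequality applies. -/
theorem LocalBounds.measure_score_gt (hη : M.SmoothnessAssumption Nθ Nh)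
    (hB : M.LocalBounds L Nθ Nh c C b c₂) (K : Coordinates L r)
    (hlaw : ∀ l i, HasLaw (ξ l i) (M.law l M.τ₀) P)
    (hindep : iIndepFun (fun j : Fin m × ℕ => ξ j.1 j.2) P) {N : ℕ} (hN : 0 < N)
    (hn : ∀ l, N ≤ n l) {lam : ℝ} (hlam : 0 < lam) (hlam1 : lam ≤ 1) {B : ℝ} (hB0 : 0 < B) :
    P {ω | ∃ v, B * √(K.sq lam v) < |M.score ξ n ω v|} ≤
      ENNReal.ofReal (m * C * K.C * K.C * ((N : ℝ)⁻¹ * lam ^ (-(1 / r))) / B ^ 2) := by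
  have hpos : ∀ j, 0 < 1 + lam * K.ρ j := fun j => by
    have := mul_nonneg hlam.le (K.ρ_nonneg j)
    linarith
  have hC := hB.C_pos
  have hKC := K.C_pos
  set S : Ω → ℝ≥0∞ := fun ω =>
    ∑' j, ENNReal.ofReal (M.score ξ n ω (K.e j) ^ 2 * (1 + lam * K.ρ j)⁻¹) with hS
  have hmem := fun j => hB.score_second_moment hη hlaw hindep hN hn (K.e j)
  have hae : ∀ j, AEMeasurable
      (fun ω => ENNReal.ofReal (M.score ξ n ω (K.e j) ^ 2 * (1 + lam * K.ρ j)⁻¹)) P := fun j =>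
    (((hmem j).1.aestronglyMeasurable.aemeasurable.pow_const 2).mul_const _).ennreal_ofReal
  have hterm : ∀ j, ∫⁻ ω, ENNReal.ofReal (M.score ξ n ω (K.e j) ^ 2 * (1 + lam * K.ρ j)⁻¹) ∂P ≤
      ENNReal.ofReal (m * C * K.C * (N : ℝ)⁻¹ * (1 + lam * K.ρ j)⁻¹) := by
    intro j
    rw [← ofReal_integral_eq_lintegral_ofReal ((hmem j).1.integrable_sq.mul_const _)
      (ae_of_all _ fun ω => by have := hpos j; positivity), integral_mul_const]
    refine ENNReal.ofReal_le_ofReal (mul_le_mul_of_nonneg_right ((hmem j).2.trans ?_)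
      (inv_nonneg.2 (hpos j).le))
    have := K.q_e_le j
    gcongr
  have hint : ∫⁻ ω, S ω ∂P ≤
      ENNReal.ofReal (m * C * K.C * K.C * ((N : ℝ)⁻¹ * lam ^ (-(1 / r)))) := by
    rw [hS, lintegral_tsum hae]
    refine (ENNReal.tsum_le_tsum hterm).trans ?_
    rw [← ENNReal.ofReal_tsum_of_nonneg (fun j => by have := hpos j; positivity)
      ((K.trace_summable lam hlam).mul_left _), tsum_mul_left]
    refine ENNReal.ofReal_le_ofReal ?_
    calc m * C * K.C * (N : ℝ)⁻¹ * ∑' j, (1 + lam * K.ρ j)⁻¹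
        ≤ m * C * K.C * (N : ℝ)⁻¹ * (K.C * lam ^ (-(1 / r))) := by
          have := K.trace_le lam hlam hlam1
          gcongr
      _ = _ := by ring
  have hB2 : 0 < B ^ 2 := by positivity
  refine (measure_mono (t := {ω | ENNReal.ofReal (B ^ 2) ≤ S ω}) ?_).trans
    ((meas_ge_le_lintegral_div (AEMeasurable.tsum hae)
      (ENNReal.ofReal_pos.2 hB2).ne' ENNReal.ofReal_ne_top).trans ?_)
  · rintro ω ⟨v, hv⟩
    by_contra hlt
    have hlt' : S ω < ENNReal.ofReal (B ^ 2) := not_le.1 hlt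
    have h1 : ∀ D, ∑ j ∈ Finset.range D, M.score ξ n ω (K.e j) ^ 2 * (1 + lam * K.ρ j)⁻¹
        ≤ B ^ 2 := by
      intro D
      have h2 : ENNReal.ofReal
          (∑ j ∈ Finset.range D, M.score ξ n ω (K.e j) ^ 2 * (1 + lam * K.ρ j)⁻¹)
          ≤ ENNReal.ofReal (B ^ 2) := by
        rw [ENNReal.ofReal_sum_of_nonneg fun j _ => by have := hpos j; positivity]
        exact (ENNReal.sum_le_tsum _).trans hlt'.le
      exact (ENNReal.ofReal_le_ofReal_iff hB2.le).1 h2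
    have h3 := K.score_sq_le hlam.le h1 v
    have h4 : |M.score ξ n ω v| ≤ B * √(K.sq lam v) := by
      refine Real.abs_le_sqrt h3 |>.trans_eq ?_
      rw [Real.sqrt_mul hB2.le, Real.sqrt_sq hB0.le]
    exact absurd hv (not_lt.2 h4)
  · rw [ENNReal.ofReal_div_of_pos hB2]
    gcongr

end Model

/-! ### Covering by cells -/

/-- The number of integer points in a ball is at most exponential in the squared radius and the
dimension. -/
theorem exists_card_int_points_le : ∃ A : ℝ, 0 < A ∧ ∀ (D : ℕ) (Λ : ℝ),
    ∃ T : Finset (Fin D → ℤ), (∀ k : Fin D → ℤ, ∑ j, (k j : ℝ) ^ 2 ≤ Λ → k ∈ T) ∧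
      (T.card : ℝ) ≤ Real.exp (Λ + A * D) := by
  have hsum : Summable fun k : ℤ => Real.exp (-|(k : ℝ)|) := by
    refine Summable.of_nat_of_neg ?_ ?_
    · simpa using Real.summable_exp_neg_nat
    · simpa using Real.summable_exp_neg_nat
  set S := ∑' k : ℤ, Real.exp (-|(k : ℝ)|) with hS
  have hS0 : 0 < S := hsum.tsum_pos (fun _ => (Real.exp_pos _).le) 0 (Real.exp_pos _)
  refine ⟨S, hS0, fun D Λ => ?_⟩
  set B : ℤ := ⌈Λ⌉ with hB
  set T : Finset (Fin D → ℤ) := (Fintype.piFinset fun _ => Finset.Icc (-B) B).filter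
    fun k => ∑ j, (k j : ℝ) ^ 2 ≤ Λ with hT
  have habs : ∀ k : ℤ, |(k : ℝ)| ≤ (k : ℝ) ^ 2 := fun k => by
    have h : |k| ≤ k ^ 2 := by
      rw [← sq_abs]
      exact Int.le_self_sq _
    exact_mod_cast h
  refine ⟨T, fun k hk => ?_, ?_⟩
  · rw [hT, Finset.mem_filter, Fintype.mem_piFinset]
    refine ⟨fun j => ?_, hk⟩
    rw [Finset.mem_Icc, ← abs_le]
    have h1 : |(k j : ℝ)| ≤ Λ := (habs _).trans ((Finset.single_le_sum
      (f := fun j => (k j : ℝ) ^ 2) (fun _ _ => sq_nonneg _) (Finset.mem_univ j)).trans hk)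
    have h2 : ((|k j| : ℤ) : ℝ) ≤ (B : ℝ) := by
      push_cast
      exact h1.trans (Int.le_ceil _)
    exact_mod_cast h2
  -- Each point gets the weight `∏ exp (-|k j|)`, at least `exp (-Λ)` because `|k| ≤ k²` for
  -- integers. The weights of all integer points sum to `S ^ D`.
  · have h1 : ∑ k ∈ T, Real.exp (-Λ) ≤ S ^ D := by
      calc ∑ k ∈ T, Real.exp (-Λ) ≤ ∑ k ∈ T, ∏ j, Real.exp (-|(k j : ℝ)|) := by
            refine Finset.sum_le_sum fun k hk => ?_
            rw [← Real.exp_sum]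
            refine Real.exp_le_exp.2 ?_
            rw [Finset.sum_neg_distrib]
            have h2 := (Finset.mem_filter.1 hk).2
            have h3 := Finset.sum_le_sum fun j (_ : j ∈ Finset.univ) => habs (k j)
            linarith
        _ ≤ ∑ k ∈ Fintype.piFinset fun _ : Fin D => Finset.Icc (-B) B,
              ∏ j, Real.exp (-|(k j : ℝ)|) :=
            Finset.sum_le_sum_of_subset_of_nonneg (Finset.filter_subset _ _)
              fun k _ _ => Finset.prod_nonneg fun j _ => (Real.exp_pos _).le
        _ = ∏ _j : Fin D, ∑ k ∈ Finset.Icc (-B) B, Real.exp (-|(k : ℝ)|) :=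
            (Finset.prod_univ_sum (fun _ => Finset.Icc (-B) B)
              fun (_ : Fin D) (k : ℤ) => Real.exp (-|(k : ℝ)|)).symm
        _ ≤ ∏ _j : Fin D, S := Finset.prod_le_prod
            (fun _ _ => Finset.sum_nonneg fun k _ => (Real.exp_pos _).le)
            fun _ _ => hsum.sum_le_tsum _ fun k _ => (Real.exp_pos _).le
        _ = S ^ D := by simp
    have h2 : S ^ D ≤ Real.exp (S * D) := by
      rw [mul_comm, Real.exp_nat_mul]
      exact pow_le_pow_left₀ hS0.le (by linarith [Real.add_one_le_exp S]) _
    rw [Finset.sum_const, nsmul_eq_mul, Real.exp_neg, ← div_eq_mul_inv,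
      div_le_iff₀ (Real.exp_pos _)] at h1
    rw [Real.exp_add]
    calc (T.card : ℝ) ≤ S ^ D * Real.exp Λ := h1
      _ ≤ Real.exp (S * D) * Real.exp Λ := by gcongr
      _ = _ := mul_comm _ _

namespace Model

variable {p m : ℕ} {X : Fin m → Type u} [∀ l, MeasurableSpace (X l)]
  {H : Type v} [NormedAddCommGroup H] [InnerProductSpace ℝ H] {M : Model p m X H}
  {Nθ : Set (EuclideanSpace ℝ (Fin p))} {Nh : Set H} {L : M.Ops} {c C b c₂ : ℝ}
  {r : ℝ}

theorem Coordinates.penalty_sub_le (K : Coordinates L r) (v w : Param p H) :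
    M.J (v - w).2 (v - w).2 ≤ 2 * M.J v.2 v.2 + 2 * M.J w.2 w.2 := by
  refine hasSum_le (fun j => ?_) (K.penalty (v - w))
    (((K.penalty v).mul_left 2).add ((K.penalty w).mul_left 2))
  rw [map_sub]
  have h1 : (K.x j v - K.x j w) ^ 2 ≤ 2 * K.x j v ^ 2 + 2 * K.x j w ^ 2 := by
    nlinarith [sq_nonneg (K.x j v + K.x j w)]
  have := mul_le_mul_of_nonneg_left h1 (K.ρ_nonneg j)
  linarith

/-- Only of the order of `lam ^ (-1 / r)` coordinates are not controlled by the penalty. -/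
theorem Coordinates.exists_cutoff (K : Coordinates L r) {lam : ℝ} (hlam : 0 < lam)
    (hlam1 : lam ≤ 1) : ∃ D : ℕ, (∀ j, D ≤ j → 1 ≤ lam * K.ρ j) ∧
      (D : ℝ) ≤ 2 * (K.C * lam ^ (-(1 / r))) := by
  have hex : ∃ j, 1 ≤ lam * K.ρ j := by
    by_contra! h
    have h1 := (K.trace_summable lam hlam).tendsto_atTop_zero
    obtain ⟨j, hj⟩ := (h1.eventually (gt_mem_nhds (by norm_num : (0 : ℝ) < 1 / 2))).exists
    have h2 := mul_nonneg hlam.le (K.ρ_nonneg j)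
    rw [inv_lt_comm₀ (by linarith) (by norm_num)] at hj
    have := h j
    norm_num at hj
    linarith
  classical
  refine ⟨Nat.find hex, fun j hj => ?_, ?_⟩
  · exact (Nat.find_spec hex).trans (mul_le_mul_of_nonneg_left (K.ρ_mono hj) hlam.le)
  · have h1 : ∑ j ∈ Finset.range (Nat.find hex), (1 / 2 : ℝ) ≤
        ∑ j ∈ Finset.range (Nat.find hex), (1 + lam * K.ρ j)⁻¹ := by
      refine Finset.sum_le_sum fun j hj => ?_
      have h2 : lam * K.ρ j < 1 := not_le.1 (Nat.find_min hex (Finset.mem_range.1 hj))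
      have h3 := mul_nonneg hlam.le (K.ρ_nonneg j)
      rw [one_div]
      exact inv_anti₀ (by linarith) (by linarith)
    have h2 := (K.trace_summable lam hlam).sum_le_tsum (Finset.range (Nat.find hex))
      fun j _ => by have := mul_nonneg hlam.le (K.ρ_nonneg j); positivity
    have h3 := K.trace_le lam hlam hlam1
    simp only [Finset.sum_const, Finset.card_range, nsmul_eq_mul] at h1
    linarith

/-- Sets on which the penalty is small are covered by few small cells. -/
theorem Coordinates.exists_cover (K : Coordinates L r) (hr : 1 < r) {ε₀ : ℝ} (hε₀ : 0 < ε₀) :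
    ∃ A : ℝ, 0 < A ∧ ∀ (lam a : ℝ), 0 < lam → lam ≤ 1 → 0 < a → ∀ V : Set (Param p H),
      (∀ v ∈ V, K.W v ≤ a ∧ lam * M.J v.2 v.2 ≤ ε₀ * a) →
      ∃ T : Finset (Param p H), (∀ v ∈ T, v ∈ V) ∧
        (T.card : ℝ) ≤ Real.exp (A * lam ^ (-(1 / r))) ∧
        ∀ v ∈ V, ∃ v' ∈ T, K.W (v - v') ≤ 5 * ε₀ * a ∧
          lam * M.J (v - v').2 (v - v').2 ≤ 4 * ε₀ * a := by
  classical
  obtain ⟨A₀, hA₀, hcard⟩ := exists_card_int_points_le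
  have hKC := K.C_pos
  have hr0 : 0 ≤ 1 / r := by positivity
  refine ⟨(2 / ε₀ + 2) * (2 * K.C + 1) + A₀ * (2 * K.C), by positivity,
    fun lam a hlam hlam1 ha V hV => ?_⟩
  obtain ⟨D, hD, hDle⟩ := K.exists_cutoff hlam hlam1
  set d := lam ^ (-(1 / r)) with hd
  have hd1 : 1 ≤ d := Real.one_le_rpow_of_pos_of_le_one_of_nonpos hlam hlam1 (by linarith)
  -- Grid width for which the first `D` coordinates contribute at most `ε₀ a` in total; `D + 1`
  -- covers the case `D = 0`.
  set h := √(ε₀ * a / (D + 1)) with hh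
  have hh0 : 0 < h := Real.sqrt_pos.2 (by positivity)
  have hh2 : h ^ 2 = ε₀ * a / (D + 1) := Real.sq_sqrt (by positivity)
  let key : Param p H → Fin D → ℤ := fun v j => ⌊K.x j v / h⌋
  set Λ := (2 / ε₀ + 2) * (D + 1) with hΛ
  obtain ⟨T, hT1, hT2⟩ := hcard D Λ
  have hkey : ∀ v ∈ V, key v ∈ T := by
    intro v hv
    refine hT1 _ ?_
    have h1 : ∀ j : Fin D, (key v j : ℝ) ^ 2 ≤ 2 * (K.x j v ^ 2 / h ^ 2) + 2 := by
      intro j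
      have e1 := Int.floor_le (K.x j v / h)
      have e2 := Int.lt_floor_add_one (K.x j v / h)
      rw [← div_pow]
      simp only [key]
      set y := K.x j v / h
      have e3 : ((⌊y⌋ : ℝ) - y) ^ 2 ≤ 1 := by nlinarith
      nlinarith [sq_nonneg ((⌊y⌋ : ℝ) - 2 * y)]
    have h2 : ∑ j : Fin D, K.x j v ^ 2 ≤ a := by
      rw [← Finset.sum_range fun j => K.x j v ^ 2]
      exact ((K.summable v).sum_le_tsum _ fun _ _ => sq_nonneg _).trans (hV v hv).1
    calc ∑ j, (key v j : ℝ) ^ 2 ≤ ∑ j : Fin D, (2 * (K.x j v ^ 2 / h ^ 2) + 2) :=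
          Finset.sum_le_sum fun j _ => h1 j
      _ = 2 * ((∑ j : Fin D, K.x j v ^ 2) / h ^ 2) + 2 * D := by
          rw [Finset.sum_add_distrib, ← Finset.mul_sum, Finset.sum_div]
          simp [mul_comm]
      _ ≤ 2 * (a / h ^ 2) + 2 * D := by gcongr
      _ = 2 / ε₀ * (D + 1) + 2 * D := by rw [hh2]; field_simp
      _ ≤ Λ := by rw [hΛ]; linarith
  -- Centres are chosen in `V`, as lower bounds at the centres are needed later. The default 0 is
  -- never reached, since only occupied cells are kept.
  let rep : (Fin D → ℤ) → Param p H := fun k =>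
    if hk : ∃ v ∈ V, key v = k then hk.choose else 0
  have hrep : ∀ k, (∃ v ∈ V, key v = k) → rep k ∈ V ∧ key (rep k) = k := by
    intro k hk
    simp only [rep, dif_pos hk]
    exact hk.choose_spec
  refine ⟨(T.filter fun k => ∃ v ∈ V, key v = k).image rep, ?_, ?_, ?_⟩
  · intro v hv
    obtain ⟨k, hk, rfl⟩ := Finset.mem_image.1 hv
    exact (hrep k (Finset.mem_filter.1 hk).2).1
  · have h1 : (((T.filter fun k => ∃ v ∈ V, key v = k).image rep).card : ℝ) ≤ T.card := by
      exact_mod_cast Finset.card_image_le.trans (Finset.card_filter_le _ _)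
    refine h1.trans (hT2.trans (Real.exp_le_exp.2 ?_))
    have h2 : (D : ℝ) + 1 ≤ (2 * K.C + 1) * d := by linarith
    have h3 : Λ ≤ (2 / ε₀ + 2) * ((2 * K.C + 1) * d) := by
      rw [hΛ]
      exact mul_le_mul_of_nonneg_left h2 (by positivity)
    have h4 := mul_le_mul_of_nonneg_left hDle hA₀.le
    calc Λ + A₀ * D ≤ (2 / ε₀ + 2) * ((2 * K.C + 1) * d) + A₀ * (2 * (K.C * d)) := add_le_add h3 h4
      _ = _ := by ring
  · intro v hv
    obtain ⟨hr1, hr2⟩ := hrep (key v) ⟨v, hv, rfl⟩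
    refine ⟨rep (key v), Finset.mem_image.2 ⟨key v, Finset.mem_filter.2
      ⟨hkey v hv, v, hv, rfl⟩, rfl⟩, ?_⟩
    set v' := rep (key v) with hv'
    have hJ : lam * M.J (v - v').2 (v - v').2 ≤ 4 * ε₀ * a := by
      have h1 := mul_le_mul_of_nonneg_left (K.penalty_sub_le v v') hlam.le
      have h2 := (hV v hv).2
      have h3 := (hV v' hr1).2
      linarith
    refine ⟨?_, hJ⟩
    have hfin : HasSum (fun j => if j < D then h ^ 2 else 0) (D * h ^ 2) := by
      have : HasSum (fun j => if j < D then h ^ 2 else 0)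
          (∑ j ∈ Finset.range D, if j < D then h ^ 2 else 0) :=
        hasSum_sum_of_ne_finset_zero fun j hj => if_neg (by simpa using hj)
      rw [Finset.sum_congr rfl fun j hj => if_pos (Finset.mem_range.1 hj)] at this
      simpa using this
    -- Points of one cell differ by at most `h` in the first `D` coordinates. In the others `1 ≤ lam
    -- ρ_j`, so the penalty dominates the square.
    have h1 : K.W (v - v') ≤ D * h ^ 2 + lam * M.J (v - v').2 (v - v').2 := by
      refine hasSum_le (fun j => ?_) (K.summable (v - v')).hasSum
        (hfin.add ((K.penalty (v - v')).mul_left lam))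
      have hρ := mul_nonneg (mul_nonneg hlam.le (K.ρ_nonneg j)) (sq_nonneg (K.x j (v - v')))
      split_ifs with hj
      · have e1 : ⌊K.x j v / h⌋ = ⌊K.x j v' / h⌋ := (congrFun hr2 ⟨j, hj⟩).symm
        have e2 := (Int.abs_sub_lt_one_of_floor_eq_floor e1).le
        rw [← sub_div, abs_div, abs_of_pos hh0, div_le_one hh0, ← map_sub] at e2
        have e3 : K.x j (v - v') ^ 2 ≤ h ^ 2 := by
          rw [← sq_abs]
          exact pow_le_pow_left₀ (abs_nonneg _) e2 2
        linarith
      · have := mul_le_mul_of_nonneg_right (hD j (not_lt.1 hj)) (sq_nonneg (K.x j (v - v')))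
        linarith
    have h2 : D * h ^ 2 ≤ ε₀ * a := by
      rw [hh2, mul_div_assoc', div_le_iff₀ (by positivity)]
      have : 0 < ε₀ * a := by positivity
      nlinarith
    linarith

end Model

/-! ### Lower bound for the nonlinear part of the likelihood -/

namespace Model

variable {p m : ℕ} {X : Fin m → Type u} [∀ l, MeasurableSpace (X l)]
  {H : Type v} [NormedAddCommGroup H] [InnerProductSpace ℝ H] {M : Model p m X H}
  {Nθ : Set (EuclideanSpace ℝ (Fin p))} {Nh : Set H} {L : M.Ops} {c C b c₂ : ℝ}
  [∀ l, IsProbabilityMeasure (M.law l M.τ₀)]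
  {Ω : Type w} [MeasurableSpace Ω] {P : Measure Ω} [IsProbabilityMeasure P]
  {ξ : ∀ l, ℕ → Ω → X l} {r : ℝ}

/-- The part of the negative log likelihood that is not linear. -/
def nonlinear (M : Model p m X H) {Ω : Type w} (ξ : ∀ l, ℕ → Ω → X l) (n : Fin m → ℕ) (ω : Ω)
    (v : Param p H) : ℝ :=
  M.excess v - ∑ l, empMean ξ n ω l (M.rem l v)

/-- On a single cell, the nonlinear part of the likelihood is bounded from below. -/
theorem LocalBounds.nonlinear_ge_of_cell (hB : M.LocalBounds L Nθ Nh c C b c₂)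
    (K : Coordinates L r) {n : Fin m → ℕ} {ω : Ω} {v v' : Param p H}
    (hv' : M.τ₀ + v' ∈ Nθ ×ˢ Nh)
    (h1 : M.excess v' - C * √(L.q v') * √(L.q (v - v')) +
      ∑ l, empMean ξ n ω l (fun x => max (-b) (-M.rem l v' x + M.gap l v' (v - v') x)) ≤
      M.nonlinear ξ n ω v) {s lam t E a ε₀ : ℝ} (hs : 0 < s) (ha : 0 < a) (hε₀ : 0 < ε₀)
    (hε₀1 : ε₀ ≤ 1 / 2)
    (h2 : ∀ l, empMean ξ n ω l (fun x => min (M.rem l v' x - M.gap l v' (v - v') x) b) ≤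
      s * (48 * C * L.q v' + (48 * (C * K.C) + 1 / 2) * K.W (v - v')
        + 1 / 2 * (lam * M.J (v - v').2 (v - v').2)) + E / (n l * s))
    (hE : ∀ l, E / (n l * s) ≤ t)
    (hq1 : K.W v' ≤ a) (hq2 : (1 - ε₀) * a ≤ K.W v')
    (hw1 : K.W (v - v') ≤ 5 * ε₀ * a)
    (hw2 : lam * M.J (v - v').2 (v - v').2 ≤ 4 * ε₀ * a) :
    (c * K.c / 2 - C * K.C * √(5 * ε₀)
      - m * (s * (48 * C * K.C + (48 * (C * K.C) + 1 / 2) * 5 + 2))) * a - m * t ≤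
      M.nonlinear ξ n ω v := by
  have hC := hB.C_pos
  have hKC := K.C_pos
  have hc := hB.c_pos
  have hKc := K.c_pos
  have e1 : c * K.c / 2 * a ≤ M.excess v' := by
    have h3 := hB.excess_ge v' hv'
    have h4 := mul_le_mul_of_nonneg_left (K.lower v') hc.le
    have h5 : K.c * (a / 2) ≤ K.c * K.W v' := by
      refine mul_le_mul_of_nonneg_left ?_ hKc.le
      nlinarith
    have h6 := mul_le_mul_of_nonneg_left h5 hc.le
    have h7 : c * (K.c * K.W v') ≤ c * L.q v' := h4
    linarith
  have hq3 : L.q v' ≤ K.C * a := (K.upper v').trans (mul_le_mul_of_nonneg_left hq1 hKC.le)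
  have hq4 : L.q (v - v') ≤ K.C * a * (5 * ε₀) :=
    (K.upper _).trans ((mul_le_mul_of_nonneg_left hw1 hKC.le).trans_eq (by ring))
  have e2 : C * √(L.q v') * √(L.q (v - v')) ≤ C * K.C * √(5 * ε₀) * a := by
    calc C * √(L.q v') * √(L.q (v - v')) ≤ C * √(K.C * a) * √(K.C * a * (5 * ε₀)) := by gcongr
      _ = C * (√(K.C * a) * √(K.C * a)) * √(5 * ε₀) := by
          rw [Real.sqrt_mul (show 0 ≤ K.C * a by positivity) (5 * ε₀)]; ring
      _ = _ := by rw [Real.mul_self_sqrt (by positivity)]; ring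
  have e3 : ∀ l, -(s * (48 * C * K.C + (48 * (C * K.C) + 1 / 2) * 5 + 2) * a + t) ≤
      empMean ξ n ω l (fun x => max (-b) (-M.rem l v' x + M.gap l v' (v - v') x)) := by
    intro l
    have h3 : (fun x => max (-b) (-M.rem l v' x + M.gap l v' (v - v') x)) =
        fun x => (-1) * min (M.rem l v' x - M.gap l v' (v - v') x) b := by
      ext x
      rw [neg_one_mul, ← max_neg_neg, max_comm]
      congr 1
      ring
    rw [h3, empMean_const_mul, neg_one_mul]
    refine neg_le_neg ((h2 l).trans (add_le_add ?_ (hE l)))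
    refine (mul_le_mul_of_nonneg_left (c := (48 * C * K.C + (48 * (C * K.C) + 1 / 2) * 5 + 2) * a)
      ?_ hs.le).trans_eq (by ring)
    have g1 : 48 * C * L.q v' ≤ 48 * C * (K.C * a) := by gcongr
    have hεa : ε₀ * a ≤ 1 * a := mul_le_mul_of_nonneg_right (by linarith) ha.le
    have g2 : (48 * (C * K.C) + 1 / 2) * K.W (v - v') ≤ (48 * (C * K.C) + 1 / 2) * (5 * a) := by
      refine mul_le_mul_of_nonneg_left ?_ (by positivity)
      linarith
    linarith
  have e4 := Finset.sum_le_sum fun l (_ : l ∈ Finset.univ) => e3 l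
  simp only [Finset.sum_const, Finset.card_univ, Fintype.card_fin, nsmul_eq_mul] at e4
  linarith

/-- Away from the true parameter, in the norm of the problem, the nonlinear part of the likelihood
is, uniformly, bounded from below by the square of the distance, with high probability. -/
theorem LocalBounds.exists_nonlinear_bound (hm : 1 ≤ m) (hη : M.SmoothnessAssumption Nθ Nh)
    (hB : M.LocalBounds L Nθ Nh c C b c₂) (K : Coordinates L r) (hr : 1 < r)
    (hlaw : ∀ l i, HasLaw (ξ l i) (M.law l M.τ₀) P)
    (hindep : iIndepFun (fun j : Fin m × ℕ => ξ j.1 j.2) P) :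
    ∃ ε₀ c₀ : ℝ, 0 < ε₀ ∧ 0 < c₀ ∧ ∀ ε : ℝ, 0 < ε → ∃ R₀ : ℝ, 0 < R₀ ∧
      ∀ (n : Fin m → ℕ) (N : ℕ) (lam a : ℝ), 0 < N → (∀ l, N ≤ n l) → 0 < lam → lam ≤ 1 →
        (∀ᵐ ω ∂P, ConvexOn ℝ (Nθ ×ˢ Nh) (M.negLogLik ξ n ω)) →
        R₀ * ((N : ℝ)⁻¹ * lam ^ (-(1 / r))) ≤ a → 0 < a →
        P {ω | ∃ v, M.τ₀ + v ∈ Nθ ×ˢ Nh ∧ K.sq lam v = a ∧ lam * M.J v.2 v.2 ≤ ε₀ * a ∧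
          M.nonlinear ξ n ω v < c₀ * a} ≤ ENNReal.ofReal ε := by
  have hsep := K.separableSpace
  have hC := hB.C_pos
  have hKC := K.C_pos
  have hc := hB.c_pos
  have hKc := K.c_pos
  have hb := hB.b_pos
  have hm0 : (0 : ℝ) < m := by exact_mod_cast hm
  -- The excess contributes at least `4 g a`. The choices of `ε₀`, `s` and `R₀` keep the tangent
  -- error, the variance terms and the deviation terms at most `g a` each, so that `g a` remains.
  set g := c * K.c / 8 with hg
  have hg0 : 0 < g := by positivity
  set ε₀ := min (1 / 2) ((g / (C * K.C)) ^ 2 / 5) with hε₀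
  have hε₀0 : 0 < ε₀ := lt_min (by norm_num) (by positivity)
  have hε₀1 : ε₀ ≤ 1 / 2 := min_le_left _ _
  have hε₀2 : C * K.C * √(5 * ε₀) ≤ g := by
    have h1 : √(5 * ε₀) ≤ g / (C * K.C) := by
      refine Real.sqrt_le_iff.2 ⟨by positivity, ?_⟩
      have : ε₀ ≤ (g / (C * K.C)) ^ 2 / 5 := min_le_right _ _
      linarith
    calc C * K.C * √(5 * ε₀) ≤ C * K.C * (g / (C * K.C)) := by gcongr
      _ = g := by field_simp
  set Z := 48 * C * K.C + (48 * (C * K.C) + 1 / 2) * 5 + 2 with hZ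
  have hZ0 : 0 < Z := by positivity
  set s := min (1 / b) (g / (m * Z)) with hs
  have hs0 : 0 < s := lt_min (by positivity) (by positivity)
  have hsb : s * b ≤ 1 := by
    have : s ≤ 1 / b := min_le_left _ _
    calc s * b ≤ 1 / b * b := by gcongr
      _ = 1 := by field_simp
  have hsZ : m * (s * Z) ≤ g := by
    have : s ≤ g / (m * Z) := min_le_right _ _
    calc m * (s * Z) ≤ m * (g / (m * Z) * Z) := by gcongr
      _ = g := by field_simp
  obtain ⟨A, hA, hcover⟩ := K.exists_cover hr hε₀0
  refine ⟨ε₀, g, hε₀0, hg0, fun ε hε => ?_⟩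
  set t₀ := 2 * m / ε with ht₀
  have ht₀0 : 0 < t₀ := by positivity
  set E₀ := 52 * (C * K.C * K.C) + 3 * (A + t₀) with hE₀
  have hE₀0 : 0 < E₀ := by positivity
  refine ⟨m * E₀ / s / g, by positivity, fun n N lam a hN hn hlam hlam1 hconv hRa ha => ?_⟩
  set d := lam ^ (-(1 / r)) with hd
  have hd1 : 1 ≤ d := Real.one_le_rpow_of_pos_of_le_one_of_nonpos hlam hlam1 (by
    have : 0 < 1 / r := by positivity
    linarith)
  have hn0 : ∀ l, 0 < n l := fun l => hN.trans_le (hn l)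
  have hN0 : (0 : ℝ) < N := by exact_mod_cast hN
  set V : Set (Param p H) := {v | M.τ₀ + v ∈ Nθ ×ˢ Nh ∧ K.sq lam v = a ∧
    lam * M.J v.2 v.2 ≤ ε₀ * a} with hV
  have hJ0 : ∀ v : Param p H, 0 ≤ M.J v.2 v.2 := fun v =>
    (K.penalty v).nonneg fun j => mul_nonneg (K.ρ_nonneg j) (sq_nonneg _)
  have hVW : ∀ v ∈ V, K.W v ≤ a ∧ (1 - ε₀) * a ≤ K.W v := by
    rintro v ⟨-, h2, h3⟩
    have h4 := mul_nonneg hlam.le (hJ0 v)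
    rw [Coordinates.sq] at h2
    constructor <;> linarith
  obtain ⟨T, hTV, hTcard, hT⟩ := hcover lam a hlam hlam1 ha V fun v hv => ⟨(hVW v hv).1, hv.2.2⟩
  -- The first summand offsets the number `exp (A d)` of cells in the union bound; the second brings
  -- the remaining probability below `ε`.
  set t := A * d + t₀ with ht
  set E := 52 * (C * K.C * (K.C * d)) + 3 * t with hE
  have hEle : E ≤ E₀ * d := by
    have : t₀ ≤ t₀ * d := le_mul_of_one_le_right ht₀0.le hd1
    rw [hE, hE₀, ht]
    linarith
  have hE0 : 0 ≤ E := by positivity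
  set t₁ := E₀ * d / (N * s) with ht₁
  have hEt : ∀ l, E / (n l * s) ≤ t₁ := fun l => by
    have h1 : (N : ℝ) ≤ n l := by exact_mod_cast hn l
    rw [ht₁]
    gcongr
  have ht₁a : m * t₁ ≤ g * a := by
    calc m * t₁ = g * (m * E₀ / s / g * ((N : ℝ)⁻¹ * d)) := by rw [ht₁]; field_simp
      _ ≤ g * a := by gcongr
  let bad : Param p H → Fin m → Set Ω := fun v l => {ω | ∃ w : Param p H,
    s * (48 * C * L.q v + (48 * (C * K.C) + 1 / 2) * K.W w + 1 / 2 * (lam * M.J w.2 w.2))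
      + E / (n l * s) < empMean ξ n ω l (fun x => min (M.rem l v x - M.gap l v w x) b)}
  have hbad : ∀ v ∈ T, ∀ l, P (bad v l) ≤ 2 * ENNReal.ofReal (Real.exp (-t)) := fun v hv l =>
    hB.measure_exists_clipped_gt hη K hlaw hindep (hn0 l) (hTV v hv).1 hs0 hsb hlam hlam1 t
  have hgood : ∀ᵐ ω ∂P, ∀ v' ∈ (T : Set (Param p H)), ∀ v, M.τ₀ + v ∈ Nθ ×ˢ Nh →
      M.excess v' - C * √(L.q v') * √(L.q (v - v')) +
      ∑ l, empMean ξ n ω l (fun x => max (-b) (-M.rem l v' x + M.gap l v' (v - v') x)) ≤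
      M.nonlinear ξ n ω v :=
    (ae_ball_iff T.countable_toSet).2 fun v' hv' =>
      hB.lower_bound_ae hη hlaw hindep hn0 hconv (hTV v' hv').1
  have hsub : P {ω | ∃ v, M.τ₀ + v ∈ Nθ ×ˢ Nh ∧ K.sq lam v = a ∧ lam * M.J v.2 v.2 ≤ ε₀ * a ∧
      M.nonlinear ξ n ω v < g * a} ≤ P (⋃ v ∈ T, ⋃ l, bad v l) := by
    refine measure_mono_ae ?_
    filter_upwards [hgood] with ω hω
    rintro ⟨v, hv1, hv2, hv3, hv4⟩
    by_contra hnot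
    have hnot' : ω ∉ ⋃ v ∈ T, ⋃ l, bad v l := hnot
    simp only [Set.mem_iUnion, not_exists] at hnot'
    obtain ⟨v', hv', hw1, hw2⟩ := hT v ⟨hv1, hv2, hv3⟩
    have hcell := hB.nonlinear_ge_of_cell K (hTV v' hv').1 (hω v' hv' v hv1) hs0 ha hε₀0 hε₀1
      (E := E) (t := t₁) (lam := lam) (fun l => by
        have := hnot' v' hv' l
        by_contra hlt
        exact this ⟨v - v', not_le.1 hlt⟩) hEt (hVW v' (hTV v' hv')).1 (hVW v' (hTV v' hv')).2
        hw1 hw2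
    rw [← hZ] at hcell
    have h1 : (g + g) * a ≤ (c * K.c / 2 - C * K.C * √(5 * ε₀) - m * (s * Z)) * a := by
      refine mul_le_mul_of_nonneg_right ?_ ha.le
      have : c * K.c / 2 = 4 * g := by rw [hg]; ring
      linarith
    linarith
  refine hsub.trans ((measure_biUnion_finset_le T _).trans ?_)
  have h1 : ∀ v ∈ T, P (⋃ l, bad v l) ≤ ENNReal.ofReal (m * (2 * Real.exp (-t))) := by
    intro v hv
    refine (measure_iUnion_fintype_le P _).trans ((Finset.sum_le_sum fun l _ =>
      hbad v hv l).trans (le_of_eq ?_))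
    rw [Finset.sum_const, Finset.card_univ, Fintype.card_fin, nsmul_eq_mul,
      ENNReal.ofReal_mul hm0.le, ENNReal.ofReal_mul zero_le_two]
    simp
  refine (Finset.sum_le_sum h1).trans ?_
  rw [Finset.sum_const, nsmul_eq_mul, ← ENNReal.ofReal_natCast, ← ENNReal.ofReal_mul (by positivity)]
  refine ENNReal.ofReal_le_ofReal ?_
  have h2 : Real.exp (-t₀) ≤ ε / (2 * m) := by
    rw [Real.exp_neg]
    have h3 : t₀ ≤ Real.exp t₀ := by linarith [Real.add_one_le_exp t₀]
    calc (Real.exp t₀)⁻¹ ≤ t₀⁻¹ := inv_anti₀ ht₀0 h3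
      _ = _ := by rw [ht₀, inv_div]
  calc T.card * (m * (2 * Real.exp (-t)))
      ≤ Real.exp (A * d) * (m * (2 * Real.exp (-t))) := by gcongr
    _ = m * 2 * (Real.exp (A * d) * Real.exp (-t)) := by ring
    _ = m * 2 * Real.exp (-t₀) := by rw [← Real.exp_add]; congr 2; rw [ht]; ring
    _ ≤ m * 2 * (ε / (2 * m)) := by gcongr
    _ = ε := by field_simp

end Model

/-! ### Basic inequalities -/

namespace Model

variable {p m : ℕ} {X : Fin m → Type u} [∀ l, MeasurableSpace (X l)]
  {H : Type v} [NormedAddCommGroup H] [InnerProductSpace ℝ H] {M : Model p m X H}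
  {Nθ : Set (EuclideanSpace ℝ (Fin p))} {Nh : Set H} {L : M.Ops} {c C b c₂ : ℝ}
  {Ω : Type w} {ξ : ∀ l, ℕ → Ω → X l} {n : Fin m → ℕ} {ω : Ω} {r lam : ℝ}
  [∀ l, IsProbabilityMeasure (M.law l M.τ₀)]

theorem PenaltyAssumption.add_self (hJ : M.PenaltyAssumption) (g h : H) :
    M.J (g + h) (g + h) = M.J g g + 2 * M.J g h + M.J h h := by
  simp only [map_add, LinearMap.add_apply, hJ.symm h g]
  ring

theorem PenaltyAssumption.abs_le (hJ : M.PenaltyAssumption) (g h : H) :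
    |M.J g h| ≤ √(M.J g g) * √(M.J h h) := by
  let B : LinearMap.BilinForm ℝ H := M.J
  have h1 := LinearMap.BilinForm.apply_sq_le_of_symm B hJ.nonneg
    ⟨fun x y => by simpa using hJ.symm x y⟩ g h
  rw [← Real.sqrt_mul (hJ.nonneg g)]
  exact Real.abs_le_sqrt h1

theorem PenaltyAssumption.convexOn (hJ : M.PenaltyAssumption) {S : Set (Param p H)}
    (hS : Convex ℝ S) : ConvexOn ℝ S fun τ : Param p H => M.J τ.2 τ.2 := by
  refine ⟨hS, fun x _ y _ s t hs ht hst => ?_⟩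
  have h1 := hJ.nonneg (x.2 - y.2)
  simp only [Prod.snd_add, Prod.smul_snd, map_add, map_sub, map_smul, LinearMap.add_apply,
    LinearMap.sub_apply, LinearMap.smul_apply, smul_eq_mul, hJ.symm y.2 x.2] at h1 ⊢
  have h2 := mul_nonneg (mul_nonneg hs ht) h1
  obtain rfl : t = 1 - s := by linarith
  nlinarith

theorem Coordinates.sq_smul (K : Coordinates L r) (lam t : ℝ) (v : Param p H) :
    K.sq lam (t • v) = t ^ 2 * K.sq lam v := by
  simp only [Coordinates.sq, Coordinates.W, map_smul, smul_eq_mul, mul_pow, tsum_mul_left,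
    Prod.smul_snd, LinearMap.smul_apply]
  ring

theorem Coordinates.sq_nonneg (K : Coordinates L r) (hlam : 0 ≤ lam) (v : Param p H) :
    0 ≤ K.sq lam v :=
  (K.hasSum_sq lam v).nonneg fun j =>
    mul_nonneg (by have := mul_nonneg hlam (K.ρ_nonneg j); linarith) (_root_.sq_nonneg _)

theorem Coordinates.cross_le (K : Coordinates L r) (hJ : M.PenaltyAssumption) (hlam : 0 ≤ lam)
    (h : H) (v : Param p H) :
    |lam * M.J h v.2| ≤ √(lam * M.J h h) * √(K.sq lam v) := by
  have h1 := mul_le_mul_of_nonneg_left (hJ.abs_le h v.2) hlam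
  have h2 : √(lam * M.J v.2 v.2) ≤ √(K.sq lam v) :=
    Real.sqrt_le_sqrt (by rw [Coordinates.sq]; linarith [K.W_nonneg v])
  rw [abs_mul, abs_of_nonneg hlam]
  calc lam * |M.J h v.2| ≤ lam * (√(M.J h h) * √(M.J v.2 v.2)) := h1
    _ = √lam * √lam * (√(M.J h h) * √(M.J v.2 v.2)) := by rw [Real.mul_self_sqrt hlam]
    _ = √(lam * M.J h h) * √(lam * M.J v.2 v.2) := by
        rw [Real.sqrt_mul hlam, Real.sqrt_mul hlam]; ring
    _ ≤ _ := by gcongr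

theorem excess_zero : M.excess 0 = 0 := by simp [excess, logZ, dev]

theorem negLogLik_sub_eq (hη : M.SmoothnessAssumption Nθ Nh) {v : Param p H}
    (hv : M.τ₀ + v ∈ Nθ ×ˢ Nh) :
    M.negLogLik ξ n ω (M.τ₀ + v) - M.negLogLik ξ n ω M.τ₀ =
      M.nonlinear ξ n ω v - M.score ξ n ω v := by
  have h := negLogLik_sub hη ξ n ω hv (v' := 0) (by simpa using hη.mem)
  rw [add_zero, excess_zero, sub_zero] at h
  rw [h, nonlinear, score, sub_sub, ← Finset.sum_add_distrib]
  congr 1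
  refine Finset.sum_congr rfl fun l _ => ?_
  rw [← empMean_add]
  congr 1
  ext x
  simp [rem]

/-- The tangent inequality at the true parameter, where the error term carries the factor `√(q 0) =
0`. -/
theorem LocalBounds.nonlinear_nonneg (hη : M.SmoothnessAssumption Nθ Nh)
    (hB : M.LocalBounds L Nθ Nh c C b c₂)
    (hconv : ConvexOn ℝ (Nθ ×ˢ Nh) (M.negLogLik ξ n ω)) {v : Param p H}
    (hv : M.τ₀ + v ∈ Nθ ×ˢ Nh) : 0 ≤ M.nonlinear ξ n ω v := by
  have h := hB.tangent_le hη hconv hv (v' := 0) (by simpa using hη.mem)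
  rw [excess_zero, L.q_zero, Real.sqrt_zero, mul_zero, zero_mul, add_zero, sub_zero] at h
  have e : ∀ l, M.rem l v =
      fun x => M.η l (M.τ₀ + v) x - M.η l M.τ₀ x - M.Dηpt l x M.τ₀ v := fun l => rfl
  simp only [nonlinear, e, sub_nonneg]
  simpa using h

/-- The basic inequality for the penalized likelihood estimator. -/
theorem LocalBounds.sq_le_of_isLocalMin (hη : M.SmoothnessAssumption Nθ Nh)
    (hB : M.LocalBounds L Nθ Nh c C b c₂) (K : Coordinates L r) (hJ : M.PenaltyAssumption)
    (hlam : 0 < lam) (hconv : ConvexOn ℝ (Nθ ×ˢ Nh) (M.negLogLik ξ n ω)) {v : Param p H}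
    (hv : M.τ₀ + v ∈ Nθ ×ˢ Nh) (hmin : IsLocalMin (M.penLik ξ n lam ω) (M.τ₀ + v))
    {a B ε₀ c₀ : ℝ} (ha : 0 < a) (hscore : ∀ v, |M.score ξ n ω v| ≤ B * √(K.sq lam v))
    (hnon : ∀ v, M.τ₀ + v ∈ Nθ ×ˢ Nh → K.sq lam v = a → lam * M.J v.2 v.2 ≤ ε₀ * a →
      c₀ * a ≤ M.nonlinear ξ n ω v)
    (hlt₁ : (B + √(lam * M.J M.τ₀.2 M.τ₀.2)) * √a < c₀ * a)
    (hlt₂ : (B + √(lam * M.J M.τ₀.2 M.τ₀.2)) * √a < ε₀ / 2 * a) : K.sq lam v ≤ a := by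
  by_contra! hgt
  have hpc : ConvexOn ℝ (Nθ ×ˢ Nh) (M.penLik ξ n lam ω) :=
    hconv.add ((hJ.convexOn hη.convex).smul (by positivity : 0 ≤ lam / 2))
  have hglob := IsMinOn.of_isLocalMinOn_of_convexOn hv (hmin.on _) hpc
  have hsq0 : 0 < K.sq lam v := ha.trans hgt
  -- Were the minimizer outside the ball, the penalized likelihood on the whole segment from the
  -- true parameter would be at most its value there, in particular where the segment crosses the
  -- sphere.
  set t := √(a / K.sq lam v) with ht
  have ht2 : t ^ 2 = a / K.sq lam v := Real.sq_sqrt (by positivity)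
  have ht0 : 0 ≤ t := Real.sqrt_nonneg _
  have ht1 : t ≤ 1 := Real.sqrt_le_one.2 ((div_le_one hsq0).2 hgt.le)
  have hsqt : K.sq lam (t • v) = a := by
    rw [K.sq_smul, ht2, div_mul_cancel₀ _ hsq0.ne']
  have hpt : (1 - t) • M.τ₀ + t • (M.τ₀ + v) = M.τ₀ + t • v := by module
  have hmem : M.τ₀ + t • v ∈ Nθ ×ˢ Nh := by
    rw [← hpt]
    exact hη.convex hη.mem hv (by linarith) ht0 (by ring)
  have hpen : M.penLik ξ n lam ω (M.τ₀ + t • v) ≤ M.penLik ξ n lam ω M.τ₀ := by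
    have h1 := hpc.2 hη.mem hv (show 0 ≤ 1 - t by linarith) ht0 (by ring)
    rw [hpt, smul_eq_mul, smul_eq_mul] at h1
    have h2 : M.penLik ξ n lam ω (M.τ₀ + v) ≤ M.penLik ξ n lam ω M.τ₀ := hglob hη.mem
    have h3 := mul_le_mul_of_nonneg_left h2 ht0
    linarith
  set u := t • v with hu
  have h1 := negLogLik_sub_eq (ξ := ξ) (n := n) (ω := ω) hη hmem
  have h2 := hscore u
  have h3 := K.cross_le hJ hlam.le M.τ₀.2 u
  rw [hsqt] at h2 h3
  have h4 : M.J (M.τ₀ + u).2 (M.τ₀ + u).2 =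
      M.J M.τ₀.2 M.τ₀.2 + 2 * M.J M.τ₀.2 u.2 + M.J u.2 u.2 := hJ.add_self _ _
  simp only [penLik, h4] at hpen
  have h5 : M.nonlinear ξ n ω u + 1 / 2 * (lam * M.J u.2 u.2) ≤
      (B + √(lam * M.J M.τ₀.2 M.τ₀.2)) * √a := by
    have := le_abs_self (M.score ξ n ω u)
    have := neg_abs_le (lam * M.J M.τ₀.2 u.2)
    linarith
  have h6 := mul_nonneg hlam.le (hJ.nonneg u.2)
  -- With a small penalty the nonlinear part alone reaches `c₀ a`. With a large one half the penalty
  -- reaches `ε₀ a / 2`, and the nonlinear part is nonnegative. Both exceed the linear terms.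
  rcases le_total (lam * M.J u.2 u.2) (ε₀ * a) with h | h
  · have := hnon u hmem hsqt h
    linarith
  · have := hB.nonlinear_nonneg hη hconv hmem
    linarith

theorem LocalBounds.V_Dη_ge (hη : M.SmoothnessAssumption Nθ Nh)
    (hB : M.LocalBounds L Nθ Nh c C b c₂) (v : Param p H) :
    c * L.q v ≤ M.V M.τ₀ (M.Dη M.τ₀ v) (M.Dη M.τ₀ v) := by
  rw [V_self_eq_sum_norm_sq (F := M.Dη M.τ₀ v) (fun l => hη.fderiv_mem_L20 hη.mem l v)
    fun l => EventuallyEq.rfl]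
  refine (hB.deriv_ge v).trans_eq (Finset.sum_congr rfl fun l _ => ?_)
  exact integral_sq_eq_norm_sq (hη.Dηpt_ae_eq hη.mem l v)

/-- The basic inequality for the linear approximation of the estimator. -/
theorem LocalBounds.sq_le_of_isMinOn_quadLik (hη : M.SmoothnessAssumption Nθ Nh)
    (hB : M.LocalBounds L Nθ Nh c C b c₂) (K : Coordinates L r) (hJ : M.PenaltyAssumption)
    (hlam : 0 < lam) {v : Param p H}
    (hmin : IsMinOn (M.quadLik ξ n lam ω) Set.univ (M.τ₀ + v))
    {B : ℝ} (hscore : ∀ v, |M.score ξ n ω v| ≤ B * √(K.sq lam v)) :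
    K.sq lam v ≤ (2 * (B + √(lam * M.J M.τ₀.2 M.τ₀.2)) / min (c * K.c) 1) ^ 2 := by
  have hmin' : M.quadLik ξ n lam ω (M.τ₀ + v) ≤ M.quadLik ξ n lam ω M.τ₀ := hmin (Set.mem_univ _)
  have hint : ∀ w l, ∫ x, M.Dη M.τ₀ w l x ∂(M.law l M.τ₀) = 0 := fun w l =>
    integral_L20 _ ⟨_, hη.fderiv_mem_L20 hη.mem l w⟩
  have hV0 : M.V M.τ₀ (M.Dη M.τ₀ 0) (M.Dη M.τ₀ 0) = 0 := by
    rw [V_self_eq_sum_norm_sq (F := M.Dη M.τ₀ 0) (fun l => hη.fderiv_mem_L20 hη.mem l 0)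
      fun l => EventuallyEq.rfl]
    simp
  have hlin : ∀ w, ∑ l, (-((n l : ℝ)⁻¹ * ∑ i ∈ Finset.range (n l), M.Dηpt l (ξ l i ω) M.τ₀ w)
      + ∫ x, M.Dη M.τ₀ w l x ∂(M.law l M.τ₀)) = -M.score ξ n ω w := by
    intro w
    simp only [hint, add_zero, Finset.sum_neg_distrib]
    rfl
  have hadd : M.score ξ n ω (M.τ₀ + v) = M.score ξ n ω M.τ₀ + M.score ξ n ω v := by
    simp only [score, ← Finset.sum_add_distrib, ← empMean_add, Dηpt, map_add]
  have h4 : M.J (M.τ₀ + v).2 (M.τ₀ + v).2 =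
      M.J M.τ₀.2 M.τ₀.2 + 2 * M.J M.τ₀.2 v.2 + M.J v.2 v.2 := hJ.add_self _ _
  simp only [quadLik, hlin, hadd, h4, add_sub_cancel_left, sub_self, hV0] at hmin'
  have h1 := hB.V_Dη_ge hη v
  have h2 := mul_le_mul_of_nonneg_left (K.lower v) hB.c_pos.le
  have h3 := K.cross_le hJ hlam.le M.τ₀.2 v
  have h5 := hscore v
  have h6 := le_abs_self (M.score ξ n ω v)
  have h7 := neg_abs_le (lam * M.J M.τ₀.2 v.2)
  set μ := min (c * K.c) 1 with hμ
  have hμ0 : 0 < μ := lt_min (mul_pos hB.c_pos K.c_pos) one_pos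
  have h8 : μ * K.W v ≤ c * (K.c * K.W v) := by
    rw [← mul_assoc]
    exact mul_le_mul_of_nonneg_right (min_le_left _ _) (K.W_nonneg v)
  have h9 : μ * (lam * M.J v.2 v.2) ≤ 1 * (lam * M.J v.2 v.2) :=
    mul_le_mul_of_nonneg_right (min_le_right _ _) (mul_nonneg hlam.le (hJ.nonneg _))
  have h2' : c * (K.c * K.W v) ≤ c * L.q v := h2
  set G := B + √(lam * M.J M.τ₀.2 M.τ₀.2) with hG
  have h10 : μ * K.sq lam v ≤ 2 * G * √(K.sq lam v) := by
    have : μ * K.sq lam v = μ * K.W v + μ * (lam * M.J v.2 v.2) := by rw [Coordinates.sq]; ring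
    rw [this, hG]
    linarith
  have hs0 := K.sq_nonneg hlam.le v
  set y := √(K.sq lam v) with hy
  have hy2 : y ^ 2 = K.sq lam v := Real.sq_sqrt hs0
  have hy0 : 0 ≤ y := Real.sqrt_nonneg _
  rw [← hy2]
  refine pow_le_pow_left₀ hy0 ?_ 2
  rcases hy0.eq_or_lt with h0 | h0
  · rw [← h0]
    -- If `y = 0`, the claim amounts to `0 ≤ G`. The score bound at a vector of positive norm forces
    -- `0 ≤ B`.
    have hB0 : 0 ≤ G := by
      obtain ⟨w, hw⟩ : ∃ w : Param p H, 0 < K.sq lam w := by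
        refine ⟨K.e 0, ?_⟩
        have e1 : K.W (K.e 0) = 1 := by simp [Coordinates.W, K.biorthogonal]
        rw [Coordinates.sq, e1]
        have := mul_nonneg hlam.le (hJ.nonneg (K.e 0).2)
        linarith
      have e2 := (abs_nonneg _).trans (hscore w)
      have e3 : 0 ≤ B := nonneg_of_mul_nonneg_left e2 (Real.sqrt_pos.2 hw)
      positivity
    positivity
  · rw [le_div_iff₀ hμ0]
    rw [← hy2] at h10
    have : y * (y * μ) ≤ y * (2 * G) := by linarith
    exact le_of_mul_le_mul_left this h0

end Model

/-! ### Rates in probability -/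

namespace Model

variable {p m : ℕ} {X : Fin m → Type u} [∀ l, MeasurableSpace (X l)]
  {H : Type v} [NormedAddCommGroup H] [InnerProductSpace ℝ H] {M : Model p m X H}
  {Nθ : Set (EuclideanSpace ℝ (Fin p))} {Nh : Set H} {L : M.Ops} {c C b c₂ : ℝ} {r : ℝ}

/-- Stochastic boundedness, simultaneously for the estimator and its linear approximation. -/
theorem LocalBounds.exists_rate_bound [∀ l, IsProbabilityMeasure (M.law l M.τ₀)] (hm : 1 ≤ m)
    (hη : M.SmoothnessAssumption Nθ Nh)
    (hB : M.LocalBounds L Nθ Nh c C b c₂) (K : Coordinates L r) (hr : 1 < r)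
    (hJ : M.PenaltyAssumption)
    {Ω : Type w} [MeasurableSpace Ω] {P : Measure Ω} [IsProbabilityMeasure P]
    {ξ : ∀ l, ℕ → Ω → X l}
    (hlaw : ∀ l i, HasLaw (ξ l i) (M.law l M.τ₀) P)
    (hindep : iIndepFun (fun j : Fin m × ℕ => ξ j.1 j.2) P)
    {n : ℕ → Fin m → ℕ} {N : ℕ → ℕ} {lam : ℕ → ℝ} (hNn : ∀ k l, N k ≤ n k l)
    (hlam_pos : ∀ k, 0 < lam k) (hN : Tendsto N atTop atTop) (hlam : Tendsto lam atTop (𝓝 0))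
    (hconv : ∀ k, ∀ᵐ ω ∂P, ConvexOn ℝ (Nθ ×ˢ Nh) (M.negLogLik ξ (n k) ω))
    {τhat τtil : ℕ → Ω → Param p H}
    (hhat : Tendsto (fun k => P {ω | ¬ (τhat k ω ∈ Nθ ×ˢ Nh ∧
        IsLocalMin (M.penLik ξ (n k) (lam k) ω) (τhat k ω))}) atTop (𝓝 0))
    (htil : ∀ k, ∀ᵐ ω ∂P, IsMinOn (M.quadLik ξ (n k) (lam k) ω) Set.univ (τtil k ω))
    {ε : ℝ} (hε : 0 < ε) :
    ∃ A : ℝ, 0 < A ∧ ∀ᶠ k in atTop,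
      P {ω | ¬ (K.sq (lam k) (τhat k ω - M.τ₀) ≤ A * ((N k : ℝ)⁻¹ * lam k ^ (-(1 / r)) + lam k) ∧
        K.sq (lam k) (τtil k ω - M.τ₀) ≤ A * ((N k : ℝ)⁻¹ * lam k ^ (-(1 / r)) + lam k))}
      ≤ ENNReal.ofReal ε := by
  obtain ⟨ε₀, c₀, hε₀, hc₀, hnon⟩ := hB.exists_nonlinear_bound hm hη K hr hlaw hindep
  obtain ⟨R₀, hR₀, hnon⟩ := hnon (ε / 3) (by positivity)
  have hC := hB.C_pos
  have hKC := K.C_pos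
  have hm0 : (0 : ℝ) < m := by exact_mod_cast hm
  set Z := m * C * K.C * K.C with hZ
  have hZ0 : 0 < Z := by positivity
  -- Chosen so that Markov's bound for the score at level `B₀ √R` is at most `ε / 3`.
  set B₀ := √(Z / (ε / 3)) with hB₀
  have hB₀0 : 0 < B₀ := Real.sqrt_pos.2 (by positivity)
  have hB₀2 : B₀ ^ 2 = Z / (ε / 3) := Real.sq_sqrt (by positivity)
  set J₀ := √(M.J M.τ₀.2 M.τ₀.2) with hJ₀
  have hJ₀0 : 0 ≤ J₀ := Real.sqrt_nonneg _
  set g := min c₀ (ε₀ / 2) with hg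
  have hg0 : 0 < g := lt_min hc₀ (by positivity)
  set μ := min (c * K.c) 1 with hμ
  have hμ0 : 0 < μ := lt_min (mul_pos hB.c_pos K.c_pos) one_pos
  -- The squared radius `A₁ R` has to pass the threshold `R₀` and satisfy `(B₀ + J₀) √R √(A₁ R) < g
  -- A₁ R`, that is, `√A₁ > (B₀ + J₀) / g`.
  set A₁ := R₀ + ((B₀ + J₀ + 1) / g) ^ 2 with hA₁
  have hA₁0 : 0 < A₁ := by positivity
  set A₂ := (2 * (B₀ + J₀) / μ) ^ 2 with hA₂
  have hA₂0 : 0 ≤ A₂ := by positivity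
  refine ⟨A₁ + A₂, by positivity, ?_⟩
  have hev1 : ∀ᶠ k in atTop, lam k ≤ 1 :=
    (hlam.eventually (gt_mem_nhds one_pos)).mono fun k hk => hk.le
  have hev2 : ∀ᶠ k in atTop, 0 < N k := hN.eventually_gt_atTop 0
  have hev3 : ∀ᶠ k in atTop, P {ω | ¬ (τhat k ω ∈ Nθ ×ˢ Nh ∧
        IsLocalMin (M.penLik ξ (n k) (lam k) ω) (τhat k ω))} ≤ ENNReal.ofReal (ε / 3) :=
    (hhat.eventually (gt_mem_nhds (ENNReal.ofReal_pos.2 (by positivity)))).mono fun k hk => hk.le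
  filter_upwards [hev1, hev2, hev3] with k hk1 hk2 hk3
  have hl := hlam_pos k
  set x := (N k : ℝ)⁻¹ * lam k ^ (-(1 / r)) with hx
  have hN0 : (0 : ℝ) < N k := by exact_mod_cast hk2
  have hx0 : 0 < x := mul_pos (inv_pos.2 hN0) (Real.rpow_pos_of_pos hl _)
  set R := x + lam k with hR
  have hR0 : 0 < R := by positivity
  have hsR : 0 < √R := Real.sqrt_pos.2 hR0
  have hRR : √R * √R = R := Real.mul_self_sqrt hR0.le
  have hcross : √(lam k * M.J M.τ₀.2 M.τ₀.2) ≤ J₀ * √R := by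
    rw [Real.sqrt_mul hl.le, mul_comm]
    have : √(lam k) ≤ √R := Real.sqrt_le_sqrt (by linarith)
    gcongr
  have hsum : B₀ * √R + √(lam k * M.J M.τ₀.2 M.τ₀.2) ≤ (B₀ + J₀) * √R := by linarith
  set bad₁ := {ω | ¬ (τhat k ω ∈ Nθ ×ˢ Nh ∧ IsLocalMin (M.penLik ξ (n k) (lam k) ω) (τhat k ω))}
  set bad₂ := {ω | ∃ v, B₀ * √R * √(K.sq (lam k) v) < |M.score ξ (n k) ω v|} with hbad₂
  set bad₃ := {ω | ∃ v, M.τ₀ + v ∈ Nθ ×ˢ Nh ∧ K.sq (lam k) v = A₁ * R ∧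
    lam k * M.J v.2 v.2 ≤ ε₀ * (A₁ * R) ∧ M.nonlinear ξ (n k) ω v < c₀ * (A₁ * R)} with hbad₃
  have h2 : P bad₂ ≤ ENNReal.ofReal (ε / 3) := by
    refine (hB.measure_score_gt hη K hlaw hindep hk2 (hNn k) hl hk1
      (mul_pos hB₀0 hsR)).trans (ENNReal.ofReal_le_ofReal ?_)
    rw [mul_pow, hB₀2, Real.sq_sqrt hR0.le, div_le_iff₀ (by positivity)]
    have : ε / 3 * (Z / (ε / 3) * R) = Z * R := by field_simp
    rw [this]
    exact mul_le_mul_of_nonneg_left (by linarith) hZ0.le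
  have h3 : P bad₃ ≤ ENNReal.ofReal (ε / 3) := by
    refine hnon (n k) (N k) (lam k) (A₁ * R) hk2 (hNn k) hl hk1 (hconv k) ?_ (by positivity)
    have e1 : R₀ ≤ A₁ := by rw [hA₁]; linarith [sq_nonneg ((B₀ + J₀ + 1) / g)]
    exact mul_le_mul e1 (by linarith) hx0.le hA₁0.le
  have hlt : (B₀ * √R + √(lam k * M.J M.τ₀.2 M.τ₀.2)) * √(A₁ * R) < g * (A₁ * R) := by
    have e1 : (B₀ + J₀ + 1) / g ≤ √A₁ := Real.le_sqrt_of_sq_le (by rw [hA₁]; linarith)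
    have e2 : B₀ + J₀ < g * √A₁ := by
      rw [div_le_iff₀ hg0] at e1
      linarith
    have e3 : 0 < √A₁ := Real.sqrt_pos.2 hA₁0
    have e4 : √A₁ * √A₁ = A₁ := Real.mul_self_sqrt hA₁0.le
    calc _ ≤ (B₀ + J₀) * √R * (√A₁ * √R) := by rw [Real.sqrt_mul hA₁0.le]; gcongr
      _ < g * √A₁ * √R * (√A₁ * √R) := by gcongr
      _ = g * ((√A₁ * √A₁) * (√R * √R)) := by ring
      _ = _ := by rw [e4, hRR]
  refine (measure_mono_ae (t := bad₁ ∪ bad₂ ∪ bad₃) ?_).trans ?_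
  · filter_upwards [hconv k, htil k] with ω hω1 hω2 hω3
    by_contra hnot
    have hnot' : ω ∉ bad₁ ∪ bad₂ ∪ bad₃ := hnot
    simp only [Set.mem_union, not_or] at hnot'
    obtain ⟨⟨g1, g2⟩, g3⟩ := hnot'
    have g1' : τhat k ω ∈ Nθ ×ˢ Nh ∧ IsLocalMin (M.penLik ξ (n k) (lam k) ω) (τhat k ω) :=
      not_not.1 g1
    have g2' : ∀ v, |M.score ξ (n k) ω v| ≤ B₀ * √R * √(K.sq (lam k) v) := fun v =>
      not_lt.1 fun hv => g2 ⟨v, hv⟩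
    have g3' : ∀ v, M.τ₀ + v ∈ Nθ ×ˢ Nh → K.sq (lam k) v = A₁ * R →
        lam k * M.J v.2 v.2 ≤ ε₀ * (A₁ * R) → c₀ * (A₁ * R) ≤ M.nonlinear ξ (n k) ω v :=
      fun v a1 a2 a3 => not_lt.1 fun hv => g3 ⟨v, a1, a2, a3, hv⟩
    have hAR : 0 < A₁ * R := by positivity
    have e1 : K.sq (lam k) (τhat k ω - M.τ₀) ≤ A₁ * R := by
      refine hB.sq_le_of_isLocalMin hη K hJ hl hω1 (by simpa using g1'.1) (by simpa using g1'.2)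
        hAR g2' g3' (hlt.trans_le ?_) (hlt.trans_le ?_)
      · exact mul_le_mul_of_nonneg_right (min_le_left _ _) hAR.le
      · exact mul_le_mul_of_nonneg_right (min_le_right _ _) hAR.le
    have e2 : K.sq (lam k) (τtil k ω - M.τ₀) ≤ A₂ * R := by
      refine (hB.sq_le_of_isMinOn_quadLik hη K hJ hl (by simpa using hω2) g2').trans ?_
      have : 0 ≤ B₀ * √R + √(lam k * M.J M.τ₀.2 M.τ₀.2) := by positivity
      calc _ ≤ (2 * ((B₀ + J₀) * √R) / μ) ^ 2 := by gcongr
        _ = (2 * (B₀ + J₀) / μ) ^ 2 * (√R * √R) := by ring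
        _ = _ := by rw [hRR]
    refine hω3 ⟨e1.trans ?_, e2.trans ?_⟩
    · exact mul_le_mul_of_nonneg_right (by linarith) hR0.le
    · exact mul_le_mul_of_nonneg_right (by linarith) hR0.le
  · refine (measure_union_le _ _).trans ((add_le_add (measure_union_le _ _) le_rfl).trans ?_)
    refine (add_le_add (add_le_add hk3 h2) h3).trans_eq ?_
    rw [← ENNReal.ofReal_add (by positivity) (by positivity),
      ← ENNReal.ofReal_add (by positivity) (by positivity)]
    congr 1
    ring

theorem sqNorm_le [∀ l, IsProbabilityMeasure (M.law l M.τ₀)] (K : Coordinates L r) {lam : ℝ}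
    (hlam : 0 ≤ lam) (hJ : M.PenaltyAssumption) (v : Param p H) :
    L.sqNorm lam v ≤ (K.C + 1) * K.sq lam v := by
  have h1 := K.upper v
  have h2 := mul_nonneg hlam (hJ.nonneg v.2)
  have h3 := mul_nonneg K.C_pos.le h2
  have h4 := K.W_nonneg v
  have h5 : L.q v ≤ K.C * K.W v := h1
  rw [Ops.sqNorm, Ops.V_app_self, Coordinates.sq]
  linarith

theorem sqNorm_nonneg [∀ l, IsProbabilityMeasure (M.law l M.τ₀)] {lam : ℝ}
    (hlam : 0 ≤ lam) (hJ : M.PenaltyAssumption) (v : Param p H) : 0 ≤ L.sqNorm lam v := by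
  rw [Ops.sqNorm, Ops.V_app_self]
  exact add_nonneg (L.q_nonneg v) (mul_nonneg hlam (hJ.nonneg _))

theorem Coordinates.sq_sub_le (K : Coordinates L r) {lam : ℝ} (hlam : 0 ≤ lam) (v w : Param p H) :
    K.sq lam (v - w) ≤ 2 * K.sq lam v + 2 * K.sq lam w := by
  refine hasSum_le (fun j => ?_) (K.hasSum_sq lam (v - w))
    (((K.hasSum_sq lam v).mul_left 2).add ((K.hasSum_sq lam w).mul_left 2))
  rw [map_sub]
  have h1 : (K.x j v - K.x j w) ^ 2 ≤ 2 * K.x j v ^ 2 + 2 * K.x j w ^ 2 := by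
    nlinarith [_root_.sq_nonneg (K.x j v + K.x j w)]
  have h2 : 0 ≤ 1 + lam * K.ρ j := by
    have := mul_nonneg hlam (K.ρ_nonneg j)
    linarith
  have := mul_le_mul_of_nonneg_left h1 h2
  linarith

end Model

end SemiparDensity

end

/-! ### Conclusion -/

theorem theorem5
    {p m : ℕ} (hm : 1 ≤ m)
    {X : Fin m → Type*} [∀ l, MeasurableSpace (X l)]
    {H : Type*} [NormedAddCommGroup H] [InnerProductSpace ℝ H] [CompleteSpace H]
    (M : SemiparDensity.Model p m X H) (L : M.Ops)
    (Nθ : Set (EuclideanSpace ℝ (Fin p))) (Nh : Set H) (r : ℝ)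
    -- the observations: `ξ l i` is the `i`-th observation of the `l`-th sample
    {Ω : Type*} [MeasurableSpace Ω] (P : Measure Ω) [IsProbabilityMeasure P]
    (ξ : ∀ l, ℕ → Ω → X l)
    (hlaw : ∀ l i, HasLaw (ξ l i) (M.law l M.τ₀) P)
    (hindep : iIndepFun (fun j : Fin m × ℕ => ξ j.1 j.2) P)
    -- the assumptions on the model
    (hJ : M.PenaltyAssumption)
    (hL : M.NormAssumption L)
    (hη : M.SmoothnessAssumption Nθ Nh)
    (hD : M.DerivativeAssumption L Nθ Nh)
    (hV : M.WeightAssumption Nθ Nh)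
    (hcc : M.CompletelyContinuous L)
    (hρ : M.EigenvalueGrowth L r)
    -- the sample sizes and the smoothing parameter along the asymptotics
    (n : ℕ → Fin m → ℕ) (lam : ℕ → ℝ)
    (hn_pos : ∀ k l, 0 < n k l) (hlam_pos : ∀ k, 0 < lam k)
    (hn : Tendsto (fun k => ⨅ l, n k l) atTop atTop)
    (hlam : Tendsto lam atTop (𝓝 0))
    (hnlam : Tendsto (fun k => ((⨅ l, n k l : ℕ) : ℝ) * lam k ^ (1 / r)) atTop atTop)
    -- the true parameter is the unique root of the expected score in the neighbourhood
    (hroot : ∀ k, ∀ τ ∈ Nθ ×ˢ Nh, M.IsMeanScoreRoot ξ (n k) P τ ↔ τ = M.τ₀)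
    -- the joint negative log likelihood is convex
    (hconv : ∀ k, ∀ᵐ ω ∂P, ConvexOn ℝ (Nθ ×ˢ Nh) (M.negLogLik ξ (n k) ω))
    -- the estimator is the unique local minimizer of the penalized likelihood in the neighbourhood,
    -- with probability tending to one
    (τhat : ℕ → Ω → SemiparDensity.Param p H)
    (hhat : Tendsto (fun k => P {ω | ¬ (τhat k ω ∈ Nθ ×ˢ Nh ∧
        IsLocalMin (M.penLik ξ (n k) (lam k) ω) (τhat k ω) ∧
        ∀ τ ∈ Nθ ×ˢ Nh, IsLocalMin (M.penLik ξ (n k) (lam k) ω) τ → τ = τhat k ω)})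
      atTop (𝓝 0))
    -- its linear approximation minimizes the quadratic approximation of the penalized likelihood
    (τtil : ℕ → Ω → SemiparDensity.Param p H)
    (htil : ∀ k, ∀ᵐ ω ∂P, IsMinOn (M.quadLik ξ (n k) (lam k) ω) Set.univ (τtil k ω)) :
    SemiparDensity.IsBigOp P
      (fun k ω => L.sqNorm (lam k) (τhat k ω - τtil k ω))
      (fun k => ((⨅ l, n k l : ℕ) : ℝ)⁻¹ * lam k ^ (-(1 / r)) + lam k) ∧
    SemiparDensity.IsBigOp P
      (fun k ω => L.sqNorm (lam k) (τhat k ω - M.τ₀))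
      (fun k => ((⨅ l, n k l : ℕ) : ℝ)⁻¹ * lam k ^ (-(1 / r)) + lam k) := by
  -- A tilted measure may vanish in general; that this one has mass one comes from its being the law
  -- of an observation.
  have hprob : ∀ l, IsProbabilityMeasure (M.law l M.τ₀) := fun l =>
    (hlaw l 0).map_eq ▸ Measure.isProbabilityMeasure_map (hlaw l 0).aemeasurable
  obtain ⟨K⟩ := L.exists_coordinates hm hJ hL hcc hρ
  obtain ⟨c, C, b, c₂, hB⟩ := SemiparDensity.Model.exists_localBounds hη hL hρ.infinite hD hV
  have hhat' : Tendsto (fun k => P {ω | ¬ (τhat k ω ∈ Nθ ×ˢ Nh ∧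
      IsLocalMin (M.penLik ξ (n k) (lam k) ω) (τhat k ω))}) atTop (𝓝 0) :=
    tendsto_of_tendsto_of_tendsto_of_le_of_le tendsto_const_nhds hhat (fun _ => zero_le)
      fun k => measure_mono fun ω hω h => hω ⟨h.1, h.2.1⟩
  have key := fun {ε : ℝ} (hε : 0 < ε) => hB.exists_rate_bound (N := fun k => ⨅ l, n k l) hm hη K
    hρ.one_lt hJ hlaw hindep (fun k l => ciInf_le (OrderBot.bddBelow _) l) hlam_pos hn hlam hconv
    hhat' htil hε
  have hC := K.C_pos
  constructor
  · intro ε hε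
    obtain ⟨A, hA, hev⟩ := key hε
    -- `4 A` is twice `A + A`, from the two errors; `K.C + 1` compares `L.sqNorm` with the
    -- coordinate norm.
    refine ⟨(K.C + 1) * (4 * A), by positivity, hev.mono fun k hk =>
      (measure_mono ?_).trans hk⟩
    intro ω hω hgood
    have h1 := K.sq_sub_le (hlam_pos k).le (τhat k ω - M.τ₀) (τtil k ω - M.τ₀)
    rw [sub_sub_sub_cancel_right] at h1
    have h2 := SemiparDensity.Model.sqNorm_le K (hlam_pos k).le hJ (τhat k ω - τtil k ω)
    have h3 := mul_le_mul_of_nonneg_left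
      (h1.trans (show _ ≤ 4 * (A * (((⨅ l, n k l : ℕ) : ℝ)⁻¹ * lam k ^ (-(1 / r)) + lam k)) by
        linarith [hgood.1, hgood.2])) (by positivity : 0 ≤ K.C + 1)
    refine absurd (show _ < |L.sqNorm (lam k) (τhat k ω - τtil k ω)| from hω) (not_lt.2 ?_)
    rw [abs_of_nonneg (SemiparDensity.Model.sqNorm_nonneg (hlam_pos k).le hJ _)]
    linarith
  · intro ε hε
    obtain ⟨A, hA, hev⟩ := key hε
    refine ⟨(K.C + 1) * A, by positivity, hev.mono fun k hk =>
      (measure_mono ?_).trans hk⟩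
    intro ω hω hgood
    have h2 := SemiparDensity.Model.sqNorm_le K (hlam_pos k).le hJ (τhat k ω - M.τ₀)
    have h3 := mul_le_mul_of_nonneg_left hgood.1 (by positivity : 0 ≤ K.C + 1)
    refine absurd (show _ < |L.sqNorm (lam k) (τhat k ω - M.τ₀)| from hω) (not_lt.2 ?_)
    rw [abs_of_nonneg (SemiparDensity.Model.sqNorm_nonneg (hlam_pos k).le hJ _)]
    linarith
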